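/- **Setting.** Let $\mathbb H_{\mathbb C}=\mathbb C\otimes\mathbb H$ be the algebra of complex $2\times 2$ matrices, with units $e_0=1$, $e_1=\begin{pmatrix}0&-i\\-i&0\end{pmatrix}$, $e_2=\begin{pmatrix}0&-1\\1&0\end{pmatrix}$, $e_3=\begin{pmatrix}-i&0\\0&i\end{pmatrix}$ and quadratic form $N(Z)=\det Z$. Write $Z=z^0e_0+z^1e_1+z^2e_2+z^3e_3$ with $z^j\in\mathbb C$. Minkowski space is $\mathbb M=\{Z\in\mathbb H_{\mathbb C}: Z^*=-Z\}$, with real basis $\tilde e_0=-ie_0,e_1,e_2,e_3$ and real coordinates $y^0,\dots,y^3$. Put $$Dz=e_0\,dz^1\wedge dz^2\wedge dz^3-e_1\,dz^0\wedge dz^2\wedge dz^3+e_2\,dz^0\wedge dz^1\wedge dz^3-e_3\,dz^0\wedge dz^1\wedge dz^2 .$$ Fix $m\ge 0$. Functions take values in the complex $2\times m$ matrices, on which $\mathbb H_{\mathbb C}$ acts by left multiplication ($m=2$: $\mathbb H_{\mathbb C}$-valued functions; $m=1$: spinor-valued functions). A real-differentiable function $f$ on $\mathbb M$ is left-regular if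 $$-\tilde e_0\,\partial f/\partial y^0+e_1\,\partial f/\partial y^1+e_2\,\partial f/\partial y^2+e_3\,\partial f/\partial y^3=0 .$$ For a function $h$ put $$(Th)(X)=\frac{(iX-1)^{-1}}{N(iX-1)}\,h\bigl((X-i)(X+i)^{-1}\bigr),\qquad N(X+i)\neq0 ;$$ the map $X\mapsto (X-i)(X+i)^{-1}$ sends $\{X\in U(2): N(X+i)\ne0\}$ into $\mathbb M$. Let $\mathcal V(\mathbb M)$ be the space of left-regular functions $f$ on $\mathbb M$ such that $Tf$, defined on $\{X\in U(2): N(X+i)\neq 0\}$, extends to a holomorphic function on an open neighbourhood of $U(2)$ in $\mathbb H_{\mathbb C}$. A *continuation* of $f\in\mathcal V(\mathbb M)$ is a function $f^{\mathbb C}$ on $\mathbb H_{\mathbb C}$ which equals $f$ on $\mathbb M$ and for which there are an open $W\supseteq U(2)$ and a holomorphic function $F$ on $W$ with $F=Tf^{\mathbb C}$ on $\{X\in W: N(X+i)\ne0\}$. (The values of $f^{\mathbb C}$ at points that are not of the form $(X-i)(X+i)^{-1}$ with $X\in W$ and that lie off $\mathbb M$ are irrelevant.) For $R>0$ let $H_R=\{Y\in\mathbb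 M: N(Y)=-R^2\}$, a two-sheeted hyperboloid, oriented so that $\{e_1,e_2,e_3\}$ is a positively oriented basis of its tangent spaces at $\pm iR$. For $Y\in\mathbb M$ with $N(Y)<0$ and $\epsilon\in\mathbb R$ let $Y^\epsilon=(1+i\epsilon)Y$ if $i\operatorname{Tr}Y>0$ and $Y^\epsilon=(1-i\epsilon)Y$ if $i\operatorname{Tr}Y<0$, and let $H_R^\epsilon=\{Y^\epsilon: Y\in H_R\}$, with the orientation induced from $H_R$. **Theorem.** Let $f\in\mathcal V(\mathbb M)$. Then $f$ has a continuation. For every continuation $f^{\mathbb C}$ of $f$ there is $\epsilon_0>0$ such that for all $0<\epsilon<\epsilon_0$ and all $R,R'>0$ the function $f^{\mathbb C}$ is holomorphic (complex differentiable) at every point of $H_R^{\epsilon}\cup H_{R'}^{-\epsilon}$, and for every $Y_0\in\mathbb M$ with $N(Y_0)<0$ one has $N(Z-Y_0)\ne0$ on $H_R^{\epsilon}\cup H_{R'}^{-\epsilon}$, the integrals below converge absolutely, and $$f(Y_0)=\frac1{2\pi^2}\int_{H_R^{\epsilon}-H_{R'}^{-\epsilon}}\frac{(Z-Y_0)^{-1}}{N(Z-Y_0)}\cdot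 Dz\cdot f^{\mathbb C}(Z),$$ where $\int_{H_R^{\epsilon}-H_{R'}^{-\epsilon}}$ means the integral over $H_R^{\epsilon}$ minus the integral over $H_{R'}^{-\epsilon}$. -/

import Mathlib

namespace MinkowskiFueter

open Complex MeasureTheory

/-- The complexified quaternions, realized as complex `2 × 2` matrices. The quadratic form `N` is
the determinant. -/
abbrev HC : Type := Matrix (Fin 2) (Fin 2) ℂ

/-- The values of the functions considered: complex `2 × m` matrices, on which `HC` acts by left
multiplication. For `m = 2` this is `HC` itself, for `m = 1` it is the space of spinors. -/
abbrev Val (m : ℕ) : Type := Matrix (Fin 2) (Fin m) ℂ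

/-- The quaternionic units `e₀, e₁, e₂, e₃`. -/
noncomputable def e : Fin 4 → HC :=
  ![1, !![0, -I; -I, 0], !![0, -1; 1, 0], !![-I, 0; 0, I]]

/-- The coordinates `z⁰, z¹, z², z³` of `Z = z⁰ e₀ + z¹ e₁ + z² e₂ + z³ e₃`. -/
noncomputable def coord (Z : HC) : Fin 4 → ℂ :=
  ![(Z 0 0 + Z 1 1) / 2, I * (Z 0 1 + Z 1 0) / 2, (Z 1 0 - Z 0 1) / 2, I * (Z 0 0 - Z 1 1) / 2]

lemma sum_coord (Z : HC) : ∑ j, coord Z j • e j = Z := by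
  ext a b
  fin_cases a <;> fin_cases b <;> simp [coord, e, Fin.sum_univ_four] <;> ring_nf <;>
    simp [I_sq] <;> ring

/-- Minkowski space `𝕄 = {Z : Z* = -Z}`, a real form of `HC`. -/
noncomputable abbrev Minkowski : Submodule ℝ HC := skewAdjoint.submodule ℝ HC

/-- The basis `ẽ₀ = -i e₀, e₁, e₂, e₃` of Minkowski space. -/
noncomputable def et : Fin 4 → HC := ![-I • e 0, e 1, e 2, e 3]

lemma et_mem (j : Fin 4) : et j ∈ Minkowski := by
  change star (et j) = -et j
  ext a b
  fin_cases j <;> fin_cases a <;> fin_cases b <;> simp [et, e, Matrix.star_apply]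

/-- The partial derivative `∂f/∂yʲ` at `Y` of a function on Minkowski space. -/
noncomputable def pderiv {m : ℕ} (j : Fin 4) (f : Minkowski → Val m) (Y : Minkowski) : Val m :=
  fderiv ℝ f Y ⟨et j, et_mem j⟩

/-- Left-regular functions on Minkowski space. -/
def LeftRegular {m : ℕ} (f : Minkowski → Val m) : Prop :=
  Differentiable ℝ f ∧ ∀ Y : Minkowski,
    -(et 0 * pderiv 0 f Y) + et 1 * pderiv 1 f Y + et 2 * pderiv 2 f Y + et 3 * pderiv 3 f Y = 0

/-- For `g = (a b; c d)`, the fractional linear map `X ↦ (a X + b) (c X + d)⁻¹`. -/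
noncomputable def fracLin (g : Matrix (Fin 2) (Fin 2) HC) (X : HC) : HC :=
  (g 0 0 * X + g 0 1) * (g 1 0 * X + g 1 1)⁻¹

/-- For `g = (a b; c d)`, the factor `(c X + d)⁻¹ / N(c X + d)`. The action `π_l` on functions is
`(π_l(h) f)(X) = factor h⁻¹ X * f (fracLin h⁻¹ X)`. -/
noncomputable def factor (g : Matrix (Fin 2) (Fin 2) HC) (X : HC) : HC :=
  ((g 1 0 * X + g 1 1).det)⁻¹ • (g 1 0 * X + g 1 1)⁻¹

/-- The points at which the fractional linear map and the factor are defined. -/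
def Nonsing (g : Matrix (Fin 2) (Fin 2) HC) (X : HC) : Prop := (g 1 0 * X + g 1 1).det ≠ 0

/-- `γ = (i 1; i -1)`; thus `fracLin γ X = (X - i) (X + i)⁻¹` is the map `π_l(γ⁻¹)`. -/
noncomputable def γ : Matrix (Fin 2) (Fin 2) HC := !![I • 1, 1; I • 1, -1]

/-- The group `U(2) ⊆ HC`, a compactification of Minkowski space. -/
def U2 : Set HC := {X | X ∈ Matrix.unitaryGroup (Fin 2) ℂ}

lemma fracLin_γ_mem {X : HC} (hX : X ∈ U2) (h : Nonsing γ X) : fracLin γ X ∈ Minkowski := by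
  set A : HC := I • X + 1 with hA
  set B : HC := I • X - 1 with hB
  have hf : fracLin γ X = A * B⁻¹ := by
    simp [fracLin, γ, hA, hB, sub_eq_add_neg]
  have hdet : B.det ≠ 0 := by
    simpa [Nonsing, γ, hB, sub_eq_add_neg] using h
  have hdet' : (star B).det ≠ 0 := by
    rw [Matrix.star_eq_conjTranspose, Matrix.det_conjTranspose]
    exact star_ne_zero.2 hdet
  have hXX : star X * X = 1 := Matrix.mem_unitaryGroup_iff'.1 hX
  have key : star A * B = -(star B * A) := by
    simp only [hA, hB, star_add, star_sub, star_smul, star_one, mul_add, mul_sub, add_mul, sub_mul,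
      smul_mul_smul_comm, hXX, mul_one, one_mul]
    simp
    abel
  have hB' : B * B⁻¹ = 1 := Matrix.mul_nonsing_inv B (Ne.isUnit hdet)
  have hB'' : (star B)⁻¹ * star B = 1 := Matrix.nonsing_inv_mul _ (Ne.isUnit hdet')
  change star (fracLin γ X) = -fracLin γ X
  rw [hf, star_mul]
  have hs : star (B⁻¹) = (star B)⁻¹ := by
    rw [Matrix.star_eq_conjTranspose, Matrix.star_eq_conjTranspose,
      Matrix.conjTranspose_nonsing_inv]
  rw [hs]
  calc (star B)⁻¹ * star A = (star B)⁻¹ * (star A * B) * B⁻¹ := by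
        rw [mul_assoc, mul_assoc, hB', mul_one]
    _ = -(((star B)⁻¹ * star B) * (A * B⁻¹)) := by
        rw [key]; simp only [mul_neg, neg_mul, mul_assoc]
    _ = -(A * B⁻¹) := by rw [hB'', one_mul]

/-- The space `𝒱(𝕄)`: left-regular functions `f` on Minkowski space such that `π_l(γ⁻¹) f`
extends holomorphically to an open neighbourhood of `U(2)` in `HC`. -/
def V (m : ℕ) : Set (Minkowski → Val m) :=
  {f | LeftRegular f ∧ ∃ W : Set HC, IsOpen W ∧ U2 ⊆ W ∧ ∃ F : HC → Val m,
    DifferentiableOn ℂ F W ∧ ∀ (X : HC) (hX : X ∈ U2) (h : Nonsing γ X),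
      F X = factor γ X * f ⟨fracLin γ X, fracLin_γ_mem hX h⟩}

/-- `fC` is the holomorphic continuation of `f ∈ 𝒱(𝕄)` off Minkowski space given by a holomorphic
extension of `π_l(γ⁻¹) f`: it equals `f` on `𝕄`, and `π_l(γ⁻¹) fC` extends to a holomorphic
function on some open neighbourhood `W` of `U(2)`. -/
def IsContinuation {m : ℕ} (f : Minkowski → Val m) (fC : HC → Val m) : Prop :=
  (∀ Y : Minkowski, fC Y = f Y) ∧ ∃ W : Set HC, IsOpen W ∧ U2 ⊆ W ∧ ∃ F : HC → Val m,
    DifferentiableOn ℂ F W ∧ ∀ X ∈ W, Nonsing γ X → F X = factor γ X * fC (fracLin γ X)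

/-- The two-sheeted hyperboloid `H_R = {Y ∈ 𝕄 : N(Y) = -R²}`. -/
def hyperboloid (R : ℝ) : Set HC := {Y | Y ∈ Minkowski ∧ Y.det = -(R : ℂ) ^ 2}

open Classical in
/-- `Y^ε`, which is `(1 + iε) Y` if `i Tr Y > 0` and `(1 - iε) Y` if `i Tr Y < 0`. (The number
`i Tr Y` is real for `Y ∈ 𝕄`, and it is nonzero if moreover `N(Y) < 0`.) -/
noncomputable def deform (ε : ℝ) (Y : HC) : HC :=
  if 0 < (I * Y.trace).re then (1 + I * ε) • Y else (1 - I * ε) • Y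

/-- The deformed hyperboloid `H_R^ε`. -/
def deformedHyperboloid (R ε : ℝ) : Set HC := deform ε '' hyperboloid R

/-- For `σ = 1` and `σ = -1` these are global charts of the two sheets of `H_R`. The derivative in
the direction of the `j`-th coordinate at `y = 0` is `e_j` on both sheets, so both charts are
positively oriented for the orientation of `H_R` in which `e₁, e₂, e₃` is a positive basis of the
tangent spaces at `±iR`. -/
noncomputable def sheet (R σ : ℝ) (y : Fin 3 → ℝ) : HC :=
  (σ * √(R ^ 2 + ∑ j, y j ^ 2)) • et 0 + ∑ j : Fin 3, y j • et j.succ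

/-- The charts of the two sheets of `H_R^ε` (with the orientation induced from `H_R`). -/
noncomputable def deformedSheet (R ε σ : ℝ) (y : Fin 3 → ℝ) : HC := deform ε (sheet R σ y)

lemma range_sheet (R : ℝ) :
    Set.range (sheet R 1) ∪ Set.range (sheet R (-1)) = hyperboloid R := by
  ext Y
  simp only [Set.mem_union, Set.mem_range]
  constructor
  · have main : ∀ σ : ℝ, σ ^ 2 = 1 → ∀ y, sheet R σ y ∈ hyperboloid R := by
      intro σ hσ y
      refine ⟨?_, ?_⟩
      · exact Submodule.add_mem _ (Submodule.smul_mem _ _ (et_mem 0))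
          (Submodule.sum_mem _ fun j _ => Submodule.smul_mem _ _ (et_mem j.succ))
      · have hs : √(R ^ 2 + ∑ j, y j ^ 2) ^ 2 = R ^ 2 + ∑ j, y j ^ 2 :=
          Real.sq_sqrt (by positivity)
        have h2 : ((σ * √(R ^ 2 + ∑ j, y j ^ 2) : ℝ) : ℂ) ^ 2 =
            (R : ℂ) ^ 2 + (y 0 : ℂ) ^ 2 + (y 1 : ℂ) ^ 2 + (y 2 : ℂ) ^ 2 := by
          rw [← ofReal_pow, mul_pow, hσ, hs, Fin.sum_univ_three]
          push_cast
          ring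
        rw [sheet]
        generalize σ * √(R ^ 2 + ∑ j, y j ^ 2) = t at h2
        simp [Matrix.det_fin_two, Fin.sum_univ_three, et, e]
        linear_combination (-1 : ℂ) * h2 +
          ((t : ℂ) ^ 2 - (y 2 : ℂ) ^ 2 - (y 0 : ℂ) ^ 2) * I_sq
    rintro (⟨y, rfl⟩ | ⟨y, rfl⟩)
    · exact main 1 (by norm_num) y
    · exact main (-1) (by norm_num) y
  · rintro ⟨hM, hd⟩
    have hst : star Y = -Y := hM
    have h00 := congrFun (congrFun hst 0) 0
    have h11 := congrFun (congrFun hst 1) 1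
    have h01 := congrFun (congrFun hst 0) 1
    simp only [Matrix.star_apply, Matrix.neg_apply, Complex.ext_iff, RCLike.star_def, conj_re,
      conj_im, neg_re, neg_im] at h00 h11 h01
    rw [Matrix.det_fin_two] at hd
    have hd' := congrArg Complex.re hd
    simp [pow_two] at hd'
    have hr : (Y 0 0).re = 0 := by linarith [h00.1]
    have hi : (Y 1 0).im = (Y 0 1).im := by linarith [h01.2]
    rw [hr, h01.1, hi] at hd'
    set t : ℝ := -((Y 0 0).im + (Y 1 1).im) / 2 with ht
    set y : Fin 3 → ℝ := ![-(Y 0 1).im, -(Y 0 1).re, ((Y 1 1).im - (Y 0 0).im) / 2] with hy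
    have hsq : t ^ 2 = R ^ 2 + ∑ j, y j ^ 2 := by
      simp [Fin.sum_univ_three, hy, ht]
      linear_combination -hd'
    have hY : Y = t • et 0 + ∑ j : Fin 3, y j • et j.succ := by
      ext a b
      fin_cases a <;> fin_cases b <;>
        simp [Fin.sum_univ_three, et, e, hy, ht, Complex.ext_iff] <;>
        constructor <;> linarith
    rcases le_total 0 t with h | h
    · left
      refine ⟨y, ?_⟩
      rw [sheet, ← hsq, Real.sqrt_sq h, one_mul, ← hY]
    · right
      refine ⟨y, ?_⟩
      rw [sheet, ← hsq, Real.sqrt_sq_eq_abs, abs_of_nonpos h, neg_one_mul, neg_neg, ← hY]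

lemma range_deformedSheet (R ε : ℝ) :
    Set.range (deformedSheet R ε 1) ∪ Set.range (deformedSheet R ε (-1)) =
      deformedHyperboloid R ε := by
  rw [deformedHyperboloid, ← range_sheet R, Set.image_union, ← Set.range_comp,
    ← Set.range_comp]
  rfl

/-- The 3-form `dzⁱ ∧ dzʲ ∧ dzᵏ`. -/
noncomputable def wedge (i j k : Fin 4) (h : Fin 3 → HC) : ℂ :=
  Matrix.det (Matrix.of fun a b : Fin 3 => coord (h a) (![i, j, k] b))

/-- The holomorphic `HC`-valued 3-form `Dz = e₀ dz¹∧dz²∧dz³ - e₁ dz⁰∧dz²∧dz³ + e₂ dz⁰∧dz¹∧dz³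
- e₃ dz⁰∧dz¹∧dz²`, evaluated on a triple of tangent vectors. -/
noncomputable def Dz (h : Fin 3 → HC) : HC :=
  wedge 1 2 3 h • e 0 - wedge 0 2 3 h • e 1 + wedge 0 1 3 h • e 2 - wedge 0 1 2 h • e 3

/-- The 3-form `(Z - Y₀)⁻¹ / N(Z - Y₀) · Dz · f(Z)`, at the point `Z` and evaluated on a triple of
tangent vectors. -/
noncomputable def fueterForm {m : ℕ} (fC : HC → Val m) (Y₀ : HC) (Z : HC) (h : Fin 3 → HC) :
    Val m :=
  (((Z - Y₀).det)⁻¹ • (Z - Y₀)⁻¹) * Dz h * fC Z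

/-- The coefficient of the pull-back of a 3-form along a chart `φ : ℝ³ → HC`. -/
noncomputable def pullback {m : ℕ} (ω : HC → (Fin 3 → HC) → Val m) (φ : (Fin 3 → ℝ) → HC)
    (y : Fin 3 → ℝ) : Val m :=
  ω (φ y) fun j => fderiv ℝ φ y (Pi.single j 1)

/-- Absolute convergence of the integral of a 3-form over `H_R^ε` (all matrix entries are
absolutely integrable on both sheets). -/
def FormIntegrable {m : ℕ} (ω : HC → (Fin 3 → HC) → Val m) (R ε : ℝ) : Prop :=
  ∀ a b, Integrable (fun y => pullback ω (deformedSheet R ε 1) y a b) ∧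
    Integrable (fun y => pullback ω (deformedSheet R ε (-1)) y a b)

/-- The integral of a 3-form over the oriented two-sheeted deformed hyperboloid `H_R^ε`. -/
noncomputable def formIntegral {m : ℕ} (ω : HC → (Fin 3 → HC) → Val m) (R ε : ℝ) : Val m :=
  Matrix.of fun a b => (∫ y, pullback ω (deformedSheet R ε 1) y a b) +
    ∫ y, pullback ω (deformedSheet R ε (-1)) y a b

end MinkowskiFueter

/-! On the sheet σ of the unit hyperboloid H₁ the deformation is multiplication by a complex number:
the sheet σ of H_R^ε is t·H₁ with t = R(1 + iσε). So the theorem concerns, for each sheet, the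
integral over t·H₁ as a function of t in a sector |Im t| < κ Re t; `coeff` is its integrand in the
chart `hyp σ`.

The form K(Z - Y₀)·Dz·f(Z) is closed, since the kernel K is right-regular (`kernel_regular`) and the
continuation of f is left-regular. The latter holds on 𝕄 and spreads to the cone over H₁ by the
identity theorem along each complex ray (`exists_coneRegular`). In coordinates, the t-derivative of
`coeff` is the divergence of `flux` (`hasDerivAt_coeff_eq_div`). Hence the integral is constant on
every connected region of t in which N(tY - Y₀) has no zero (`ConeRegular.integral_coeff_eq`).

Write Y₀ = ρY' with Y' in H₁. As a polynomial in t, N(tY - ρY') has the two real roots ρ(g ± √(g² -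
1)), where g is the `pairing` and |g| ≥ 1. They are positive if Y and Y' lie on the same sheet and
negative otherwise. So the sheet opposite to Y₀ contributes equally to both integrals and drops out,
while on the sheet of Y₀ the difference is the jump of the integral across the positive real axis.

The jump is computed on the circle |t| = ρ (`ConeRegular.tendsto_jump`). There N(tY - Y₀) is 2ρt
times a real factor that is the same for t and its conjugate, so only the numerators differ. As t
approaches ρ the difference concentrates at Y'; blowing up there leaves an explicit integral over
ℝ³, which produces 2π².

Convergence at infinity is the delicate point. Counting sizes factor by factor gives an integrand of
order height⁻², which is not integrable on ℝ³. The relation adj(Y)·Y = N(Y) = -1 cancels two orders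
(`adj_sub_mul_hyp_mul_adj`) and gives height⁻⁴. A uniform κ, and the boundedness behind these
estimates, come from the compactness of U(2), seen through the Cayley transform (`exists_tube`). -/

namespace MinkowskiFueter

open Complex MeasureTheory Filter Topology Set
open scoped Matrix.Norms.Operator

/-! ### The unit hyperboloid, the adjugate and the kernel -/

/-- The height function `√(1 + |y|²)` of the unit hyperboloid over `ℝ³`. -/
noncomputable def height (y : Fin 3 → ℝ) : ℝ := √(1 + ∑ j, y j ^ 2)

lemma height_sq (y : Fin 3 → ℝ) : height y ^ 2 = 1 + (y 0 ^ 2 + y 1 ^ 2 + y 2 ^ 2) := by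
  rw [height, Real.sq_sqrt (by positivity), Fin.sum_univ_three]

lemma height_pos (y : Fin 3 → ℝ) : 0 < height y := by
  rw [height]; positivity

lemma one_le_height (y : Fin 3 → ℝ) : 1 ≤ height y := by
  nlinarith [height_sq y, height_pos y, sq_nonneg (y 0), sq_nonneg (y 1), sq_nonneg (y 2)]

lemma height_ne (y : Fin 3 → ℝ) : (height y : ℂ) ≠ 0 := ofReal_ne_zero.2 (height_pos y).ne'

lemma abs_le_height (y : Fin 3 → ℝ) (j : Fin 3) : |y j| ≤ height y := by
  refine abs_le_of_sq_le_sq ?_ (height_pos y).le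
  rw [height, Real.sq_sqrt (by positivity)]
  have := Finset.single_le_sum (f := fun j => y j ^ 2) (fun i _ => sq_nonneg (y i))
    (Finset.mem_univ j)
  linarith

lemma continuous_height : Continuous height := by
  unfold height; fun_prop

lemma ofReal_height_sq (y : Fin 3 → ℝ) :
    (height y : ℂ) ^ 2 = 1 + ((y 0 : ℂ) ^ 2 + (y 1 : ℂ) ^ 2 + (y 2 : ℂ) ^ 2) := by
  exact_mod_cast congrArg (fun r : ℝ => (r : ℂ)) (height_sq y)

lemma height_sq_sub_one (R : ℝ) (hR : 0 < R) (y : Fin 3 → ℝ) :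
    √(R ^ 2 + ∑ j, y j ^ 2) = R * height (R⁻¹ • y) := by
  have : R ^ 2 + ∑ j, y j ^ 2 = R ^ 2 * (1 + ∑ j, (R⁻¹ • y) j ^ 2) := by
    simp only [Fin.sum_univ_three, Pi.smul_apply, smul_eq_mul]
    field_simp
  rw [this, Real.sqrt_mul (sq_nonneg R), Real.sqrt_sq hR.le, height]

/-- The chart of the sheet `σ` of the unit hyperboloid. -/
noncomputable def hyp (σ : ℝ) (y : Fin 3 → ℝ) : HC :=
  (-(I * σ * height y)) • 1 + ((y 0 : ℂ) • e 1 + (y 1 : ℂ) • e 2 + (y 2 : ℂ) • e 3)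

lemma sheet_eq_smul_hyp {R : ℝ} (hR : 0 < R) (σ : ℝ) (y : Fin 3 → ℝ) :
    sheet R σ y = (R : ℂ) • hyp σ (R⁻¹ • y) := by
  have hR' : (R : ℂ) ≠ 0 := ofReal_ne_zero.2 hR.ne'
  rw [sheet, height_sq_sub_one R hR, hyp]
  generalize height (R⁻¹ • y) = h
  ext a b
  fin_cases a <;> fin_cases b <;>
    simp [Fin.sum_univ_three, et, e, Complex.real_smul] <;> field_simp

lemma sheet_one (σ : ℝ) (y : Fin 3 → ℝ) : sheet 1 σ y = hyp σ y := by
  rw [sheet_eq_smul_hyp one_pos]; simp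

lemma hyp_mem (σ : ℝ) (y : Fin 3 → ℝ) : hyp σ y ∈ Minkowski := by
  rw [← sheet_one]
  exact Submodule.add_mem _ (Submodule.smul_mem _ _ (et_mem 0))
    (Submodule.sum_mem _ fun j _ => Submodule.smul_mem _ _ (et_mem j.succ))

/-- The adjugate of `2 × 2` matrices, as a linear map. -/
noncomputable def adj : HC →L[ℂ] HC :=
  LinearMap.toContinuousLinearMap
    { toFun := fun Z => Z.adjugate
      map_add' := fun A B => by
        ext a b; fin_cases a <;> fin_cases b <;> simp [Matrix.adjugate_fin_two] <;> ring
      map_smul' := fun c A => by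
        ext a b; fin_cases a <;> fin_cases b <;> simp [Matrix.adjugate_fin_two] }

lemma adj_apply (Z : HC) : adj Z = Z.adjugate := rfl

lemma adj_mul_self (Z : HC) : adj Z * Z = Z.det • 1 := Matrix.adjugate_mul Z

lemma self_mul_adj (Z : HC) : Z * adj Z = Z.det • 1 := Matrix.mul_adjugate Z

lemma adj_one : adj (1 : HC) = 1 := by
  rw [adj_apply, Matrix.adjugate_one]

lemma inv_eq_smul_adj (Z : HC) : Z⁻¹ = (Z.det)⁻¹ • adj Z := by
  rw [Matrix.inv_def, Ring.inverse_eq_inv', adj_apply]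

/-- The kernel `(Z - Y₀)⁻¹ / N(Z - Y₀)`. -/
noncomputable def kernel (Y₀ Z : HC) : HC := (((Z - Y₀).det)⁻¹ ^ 2) • adj (Z - Y₀)

lemma kernel_eq (Y₀ Z : HC) : ((Z - Y₀).det)⁻¹ • (Z - Y₀)⁻¹ = kernel Y₀ Z := by
  rw [kernel, inv_eq_smul_adj, smul_smul, sq]

lemma det_hyp {σ : ℝ} (hσ : σ ^ 2 = 1) (y : Fin 3 → ℝ) : (hyp σ y).det = -1 := by
  have h := ofReal_height_sq y
  have hσ' : (σ : ℂ) ^ 2 = 1 := by exact_mod_cast congrArg (fun r : ℝ => (r : ℂ)) hσ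
  rw [hyp]
  generalize (height y : ℂ) = s at h ⊢
  simp [Matrix.det_fin_two, e]
  linear_combination (s ^ 2 * σ ^ 2 - y 0 ^ 2 - y 2 ^ 2) * I_sq - s ^ 2 * hσ' - h

/-! ### Values of N along complex rays -/

/-- The pairing of points of the sheets `σ` and `σ'`, up to sign. -/
noncomputable def pairing (σ σ' : ℝ) (y y' : Fin 3 → ℝ) : ℝ :=
  σ * σ' * (height y * height y') - (y 0 * y' 0 + y 1 * y' 1 + y 2 * y' 2)

/-- The roots ρ(g ± √(g² - 1)) in t locate the singularities of the integrand. -/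
lemma det_smul_hyp_sub {σ σ' : ℝ} (hσ : σ ^ 2 = 1) (hσ' : σ' ^ 2 = 1) (y y' : Fin 3 → ℝ)
    (t ρ : ℂ) : (t • hyp σ y - ρ • hyp σ' y').det =
      -(t ^ 2 - 2 * ρ * pairing σ σ' y y' * t + ρ ^ 2) := by
  have h := det_hyp hσ y
  have h' := det_hyp hσ' y'
  rw [pairing]
  rw [hyp] at h h' ⊢
  rw [hyp]
  push_cast
  generalize (height y : ℂ) = s at h ⊢
  generalize (height y' : ℂ) = s' at h' ⊢
  simp [Matrix.det_fin_two, e] at h h' ⊢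
  linear_combination t ^ 2 * h + ρ ^ 2 * h' + 2 * ρ * t * (-(s * s' * σ * σ') + y 0 * y' 0
    + y 2 * y' 2) * I_sq

lemma det_one_sub_smul_hyp {σ : ℝ} (hσ : σ ^ 2 = 1) (y : Fin 3 → ℝ) (t : ℂ) :
    (1 - t • hyp σ y).det = 1 - t ^ 2 + 2 * I * σ * height y * t := by
  have h := det_hyp hσ y
  rw [hyp] at h ⊢
  generalize (height y : ℂ) = s at h ⊢
  simp [Matrix.det_fin_two, e] at h ⊢
  linear_combination t ^ 2 * h

/-! ### Tangent frame, and the form Dz pulled back to the hyperboloid -/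

/-- The derivative of `hyp σ` in the direction of the `j`-th coordinate. -/
noncomputable def tangent (σ : ℝ) (y : Fin 3 → ℝ) (j : Fin 3) : HC :=
  (-(I * σ * (y j / height y))) • 1 + e j.succ

lemma hasFDerivAt_height (y : Fin 3 → ℝ) :
    ∃ h' : (Fin 3 → ℝ) →L[ℝ] ℝ, HasFDerivAt height h' y ∧
      ∀ v, h' v = (y 0 * v 0 + y 1 * v 1 + y 2 * v 2) / height y := by
  have h1 : ∀ j, HasFDerivAt (fun y : Fin 3 → ℝ => y j ^ 2)
      ((2 * y j) • ContinuousLinearMap.proj (R := ℝ) (φ := fun _ : Fin 3 => ℝ) j) y := by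
    intro j
    have := (hasFDerivAt_apply (𝕜 := ℝ) (F' := fun _ : Fin 3 => ℝ) j y).pow 2
    simpa using this
  have h2 : HasFDerivAt (fun y : Fin 3 → ℝ => 1 + ∑ j, y j ^ 2)
      (∑ j, (2 * y j) • ContinuousLinearMap.proj (R := ℝ) (φ := fun _ : Fin 3 => ℝ) j) y :=
    (HasFDerivAt.fun_sum fun j _ => h1 j).const_add 1
  have h3 := h2.sqrt (by positivity)
  refine ⟨_, h3, fun v => ?_⟩
  have := height_pos y
  rw [← height.eq_1 y]
  simp [Fin.sum_univ_three]
  field_simp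

lemma hasFDerivAt_hyp (σ : ℝ) (y : Fin 3 → ℝ) :
    ∃ h' : (Fin 3 → ℝ) →L[ℝ] HC, HasFDerivAt (hyp σ) h' y ∧
      ∀ j, h' (Pi.single j 1) = tangent σ y j := by
  obtain ⟨h', hh, hv⟩ := hasFDerivAt_height y
  have e1 : hyp σ = fun y => (height y) • ((-(I * σ)) • (1 : HC)) + (y 0 • e 1 + y 1 • e 2
      + y 2 • e 3) := by
    funext y
    rw [hyp]
    congr 1
    rw [← Complex.coe_smul, smul_smul]
    congr 1; ring
  rw [e1]
  have hp := fun j : Fin 3 => hasFDerivAt_apply (𝕜 := ℝ) (F' := fun _ : Fin 3 => ℝ) j y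
  refine ⟨_, (hh.smul_const _).add ((((hp 0).smul_const _).add ((hp 1).smul_const _)).add
    ((hp 2).smul_const _)), fun j => ?_⟩
  have key : ∀ r : ℝ, r • ((-(I * σ)) • (1 : HC)) = (-(I * σ * r)) • (1 : HC) := by
    intro r; rw [← Complex.coe_smul, smul_smul]; congr 1; ring
  change h' (Pi.single j 1) • ((-(I * σ)) • (1 : HC)) + ((Pi.single j 1 : Fin 3 → ℝ) 0 • e 1 +
    (Pi.single j 1 : Fin 3 → ℝ) 1 • e 2 + (Pi.single j 1 : Fin 3 → ℝ) 2 • e 3) = _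
  rw [hv, key]
  fin_cases j <;> simp [tangent]

lemma differentiable_hyp (σ : ℝ) : Differentiable ℝ (hyp σ) := fun y =>
  (hasFDerivAt_hyp σ y).choose_spec.1.differentiableAt

lemma continuous_hyp (σ : ℝ) : Continuous (hyp σ) := (differentiable_hyp σ).continuous

/-- On the tangent space of H₁, Dz is the normal, which is Y itself, times the invariant volume
dy/height up to the factor iσ. Scaling the three tangent vectors by c gives c³. -/
lemma Dz_smul_tangent {σ : ℝ} (hσ : σ ^ 2 = 1) (y : Fin 3 → ℝ) (c : ℂ) :
    Dz (fun j => c • tangent σ y j) = (c ^ 3 * (I * σ / height y)) • hyp σ y := by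
  have hσ' : (σ : ℂ) ^ 2 = 1 := by exact_mod_cast congrArg (fun r : ℝ => (r : ℂ)) hσ
  have hs := height_ne y
  have hc : ∀ j k, coord (c • tangent σ y j) k = c * coord (tangent σ y j) k := by
    intro j k
    fin_cases k <;> simp [coord] <;> ring
  have h0 : ∀ j, coord (tangent σ y j) 0 = -(I * σ * (y j / height y)) := by
    intro j
    fin_cases j <;> simp [coord, tangent, e] <;> ring
  have h1 : ∀ j k, coord (tangent σ y j) (Fin.succ k) = if j = k then 1 else 0 := by
    intro j k
    fin_cases j <;> fin_cases k <;> simp [coord, tangent, e] <;> ring_nf <;> simp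
  have h11 := fun j => h1 j 0
  have h12 := fun j => h1 j 1
  have h13 := fun j => h1 j 2
  simp only [Fin.succ_zero_eq_one, Fin.succ_one_eq_two] at h11 h12
  rw [show (2 : Fin 3).succ = 3 from rfl] at h13
  have hw0 : wedge 1 2 3 (fun j => c • tangent σ y j) = c ^ 3 := by
    simp [wedge, Matrix.det_fin_three, hc, h11, h12, h13]; ring
  have hw1 : wedge 0 2 3 (fun j => c • tangent σ y j) = -(c ^ 3 * (I * σ * (y 0 / height y))) := by
    simp [wedge, Matrix.det_fin_three, hc, h0, h12, h13]; ring
  have hw2 : wedge 0 1 3 (fun j => c • tangent σ y j) = c ^ 3 * (I * σ * (y 1 / height y)) := by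
    simp [wedge, Matrix.det_fin_three, hc, h0, h11, h13]; ring
  have hw3 : wedge 0 1 2 (fun j => c • tangent σ y j) = -(c ^ 3 * (I * σ * (y 2 / height y))) := by
    simp [wedge, Matrix.det_fin_three, hc, h0, h11, h12]; ring
  rw [Dz, hw0, hw1, hw2, hw3, hyp, show e 0 = (1 : HC) from rfl]
  match_scalars <;> field_simp
  linear_combination c ^ 3 * σ ^ 2 * I_sq - c ^ 3 * hσ'

/-- The coefficient of the pull-back of the form `K(Z - Y₀) · Dz · φ(Z)` along the chart
`y ↦ t Y` of `t H₁`, on the sheet `σ`. -/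
noncomputable def coeff (Y₀ : HC) (φ : HC → HC) (σ : ℝ) (t : ℂ) (y : Fin 3 → ℝ) : HC :=
  (I * σ * t ^ 3 / height y) • (kernel Y₀ (t • hyp σ y) * hyp σ y * φ (t • hyp σ y))

/-- The sign of i Tr Y is that of σ, so the two cases of `deform` merge into the single factor 1 +
iσε. -/
lemma deformedSheet_eq {R : ℝ} (hR : 0 < R) (ε : ℝ) {σ : ℝ} (hσ : σ = 1 ∨ σ = -1) :
    deformedSheet R ε σ = fun y => ((R : ℂ) * (1 + I * (σ * ε))) • hyp σ (R⁻¹ • y) := by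
  funext y
  have htr : (I * (sheet R σ y).trace).re = 2 * (σ * (R * height (R⁻¹ • y))) := by
    rw [sheet_eq_smul_hyp hR, hyp]
    simp [Matrix.trace_fin_two, e]
    ring
  have hp := mul_pos hR (height_pos (R⁻¹ • y))
  rw [deformedSheet, deform, htr, sheet_eq_smul_hyp hR, smul_smul, smul_smul]
  rcases hσ with rfl | rfl
  · rw [if_pos (by linarith)]; congr 1; push_cast; ring
  · rw [if_neg (by linarith)]; congr 1; push_cast; ring

/-- Rescaling ℝ³ by R absorbs the radius into the complex parameter t; R⁻³ later cancels against the
Jacobian. -/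
lemma pullback_deformedSheet {R : ℝ} (hR : 0 < R) (ε : ℝ) {σ : ℝ} (hσ : σ = 1 ∨ σ = -1)
    (Y₀ : HC) (φ : HC → HC) (y : Fin 3 → ℝ) :
    pullback (m := 2) (fueterForm φ Y₀) (deformedSheet R ε σ) y =
      ((R⁻¹) ^ 3 : ℝ) • coeff Y₀ φ σ ((R : ℂ) * (1 + I * (σ * ε))) (R⁻¹ • y) := by
  have hσ2 : σ ^ 2 = 1 := by rcases hσ with rfl | rfl <;> norm_num
  have hR' : (R : ℂ) ≠ 0 := ofReal_ne_zero.2 hR.ne'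
  rw [deformedSheet_eq hR ε hσ]
  generalize ((R : ℂ) * (1 + I * (σ * ε))) = t
  obtain ⟨h', hh, hj⟩ := hasFDerivAt_hyp σ (R⁻¹ • y)
  have hl : HasFDerivAt (fun y : Fin 3 → ℝ => R⁻¹ • y)
      (R⁻¹ • ContinuousLinearMap.id ℝ (Fin 3 → ℝ)) y :=
    (hasFDerivAt_id y).const_smul R⁻¹
  have hd : HasFDerivAt (fun y : Fin 3 → ℝ => t • hyp σ (R⁻¹ • y)) _ y :=
    (hh.comp y hl).const_smul t
  have hv : ∀ j, fderiv ℝ (fun y : Fin 3 → ℝ => t • hyp σ (R⁻¹ • y)) y (Pi.single j 1) =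
      (t * (R : ℂ)⁻¹) • tangent σ (R⁻¹ • y) j := by
    intro j
    rw [hd.fderiv]
    change t • h' (R⁻¹ • Pi.single j 1) = _
    rw [map_smul, hj, mul_smul, ← Complex.coe_smul]
    push_cast
    rfl
  simp only [pullback, fueterForm, kernel_eq, hv, Dz_smul_tangent hσ2, coeff]
  rw [mul_smul_comm, smul_mul_assoc, ← Complex.coe_smul, smul_smul]
  congr 1
  push_cast
  field_simp

/-! ### Right-regularity of the kernel -/

lemma hasFDerivAt_det_sub (Y₀ Z : HC) :
    ∃ d : HC →L[ℂ] ℂ, HasFDerivAt (fun Z : HC => (Z - Y₀).det) d Z ∧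
      ∀ h, d h = (adj (Z - Y₀) * h).trace := by
  have hp : ∀ a b, HasFDerivAt (fun Z : HC => (Z - Y₀) a b)
      (LinearMap.toContinuousLinearMap (Matrix.entryLinearMap ℂ ℂ a b)) Z := by
    intro a b
    exact ((LinearMap.toContinuousLinearMap
      (Matrix.entryLinearMap ℂ ℂ a b)).hasFDerivAt (x := Z)).sub_const (Y₀ a b)
  have h1 := ((hp 0 0).mul (hp 1 1)).sub ((hp 0 1).mul (hp 1 0))
  refine ⟨_, h1.congr_of_eventuallyEq (Eventually.of_forall fun Z => Matrix.det_fin_two _),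
    fun h => ?_⟩
  change (Z - Y₀) 0 0 * h 1 1 + (Z - Y₀) 1 1 * h 0 0 - ((Z - Y₀) 0 1 * h 1 0 +
    (Z - Y₀) 1 0 * h 0 1) = _
  rw [adj_apply, Matrix.adjugate_fin_two, Matrix.trace_fin_two, Matrix.mul_apply,
    Matrix.mul_apply, Fin.sum_univ_two, Fin.sum_univ_two]
  simp only [Matrix.of_apply, Matrix.cons_val_zero, Matrix.cons_val_one, Matrix.cons_val']
  ring

lemma hasFDerivAt_kernel (Y₀ Z : HC) (hZ : (Z - Y₀).det ≠ 0) :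
    ∃ A : HC →L[ℂ] HC, HasFDerivAt (kernel Y₀) A Z ∧
      ∀ h, A h = ((Z - Y₀).det⁻¹ ^ 2) • adj h +
        (-2 * (Z - Y₀).det⁻¹ ^ 3 * (adj (Z - Y₀) * h).trace) • adj (Z - Y₀) := by
  obtain ⟨d, hd, hd'⟩ := hasFDerivAt_det_sub Y₀ Z
  have ha : HasFDerivAt (fun Z : HC => adj (Z - Y₀)) adj Z :=
    ((adj.hasFDerivAt (x := Z)).sub_const (adj Y₀)).congr_of_eventuallyEq
      (Eventually.of_forall fun Z => map_sub adj Z Y₀)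
  have h1 := ((hasDerivAt_inv hZ).comp_hasFDerivAt Z hd).pow 2
  refine ⟨_, h1.smul ha, fun h => ?_⟩
  change ((Z - Y₀).det⁻¹ ^ 2) • adj h + ((2 • (Z - Y₀).det⁻¹ ^ (2 - 1)) • ((-((Z - Y₀).det ^ 2)⁻¹)
    • d h)) • adj (Z - Y₀) = _
  rw [hd']
  congr 2
  simp only [nsmul_eq_mul, smul_eq_mul]
  push_cast
  ring

/-- With W = Z - Y₀ and N = det W, differentiating adj W contributes N⁻² ∑ adj(eⱼ)eⱼ = 4N⁻².
Differentiating N⁻² contributes -2N⁻³ ∑ tr(adj(W) eⱼ) adj(W) eⱼ = -2N⁻³·2N, and the two cancel. -/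
lemma kernel_regular (Y₀ Z : HC) (hZ : (Z - Y₀).det ≠ 0) :
    ∃ A : HC →L[ℂ] HC, HasFDerivAt (kernel Y₀) A Z ∧
      A 1 + (A (e 1) * e 1 + A (e 2) * e 2 + A (e 3) * e 3) = 0 := by
  obtain ⟨A, hA, h⟩ := hasFDerivAt_kernel Y₀ Z hZ
  refine ⟨A, hA, ?_⟩
  simp only [h]
  generalize Z - Y₀ = W at hZ
  have e1 : adj 1 + (adj (e 1) * e 1 + adj (e 2) * e 2 + adj (e 3) * e 3) = (4 : ℂ) • (1 : HC) := by
    ext a b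
    fin_cases a <;> fin_cases b <;>
      simp [e, adj_apply, Matrix.adjugate_fin_two] <;> norm_num
  have e2 : (adj W * 1).trace • adj W + ((adj W * e 1).trace • (adj W * e 1) +
      (adj W * e 2).trace • (adj W * e 2) + (adj W * e 3).trace • (adj W * e 3)) =
      (2 * W.det) • (1 : HC) := by
    rw [Matrix.det_fin_two]
    ext a b
    fin_cases a <;> fin_cases b <;>
    · simp [e, adj_apply, Matrix.adjugate_fin_two, Matrix.trace_fin_two]
      ring_nf
      simp only [I_sq]
      ring
  calc _ = (W.det⁻¹ ^ 2) • (adj 1 + (adj (e 1) * e 1 + adj (e 2) * e 2 + adj (e 3) * e 3)) -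
      (2 * W.det⁻¹ ^ 3) • ((adj W * 1).trace • adj W + ((adj W * e 1).trace • (adj W * e 1) +
      (adj W * e 2).trace • (adj W * e 2) + (adj W * e 3).trace • (adj W * e 3))) := by
        simp only [add_mul, smul_mul_assoc]
        module
    _ = 0 := by
        rw [e1, e2, smul_smul, smul_smul, ← sub_smul]
        convert zero_smul ℂ (1 : HC) using 2
        field_simp
        ring

/-! ### The t-derivative of the integrand as a divergence -/

/-- The vector field on `ℝ³` whose divergence is the derivative of `coeff` with respect to `t`. -/
noncomputable def flux (Y₀ : HC) (φ : HC → HC) (σ : ℝ) (t : ℂ) (i : Fin 3) (y : Fin 3 → ℝ) : HC :=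
  (I * σ * t ^ 2 / height y) • (kernel Y₀ (t • hyp σ y) * (e i.succ + (y i : ℂ) • hyp σ y) *
    φ (t • hyp σ y))

/-- For the bilinear form of N, the frame consisting of Y and the three tangent vectors has as dual
frame -Y and the vectors eᵢ + yᵢY, because N(Y) = -1 and Y is normal to H₁. The hypothesis is a
contraction of dual frames, so it may be written in this frame; its normal part -A(Y)Y is then moved
to the right. -/
lemma sum_right_regular {σ : ℝ} (hσ : σ ^ 2 = 1) (y : Fin 3 → ℝ) (t : ℂ) (A : HC →L[ℂ] HC)
    (hA : A 1 + (A (e 1) * e 1 + A (e 2) * e 2 + A (e 3) * e 3) = 0) :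
    ∑ i, A (t • tangent σ y i) * (e i.succ + (y i : ℂ) • hyp σ y) =
      t • (A (hyp σ y) * hyp σ y) := by
  have hσ' : (σ : ℂ) ^ 2 = 1 := by exact_mod_cast congrArg (fun r : ℝ => (r : ℂ)) hσ
  have hh := ofReal_height_sq y
  have hs := height_ne y
  have h0 := eq_neg_of_add_eq_zero_left hA
  simp only [Fin.sum_univ_three, tangent, Fin.succ_zero_eq_one, Fin.succ_one_eq_two,
    show (2 : Fin 3).succ = 3 from rfl]
  rw [hyp]
  simp only [map_add, map_smul, h0]
  simp only [mul_add, add_mul, smul_mul_assoc, mul_smul_comm, smul_add, smul_smul, mul_one,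
    smul_neg, mul_neg, neg_mul]
  match_scalars <;> field_simp <;> simp only [hh, I_sq, hσ'] <;> ring

lemma sum_left_regular {σ : ℝ} (hσ : σ ^ 2 = 1) (y : Fin 3 → ℝ) (t : ℂ) (B : HC →L[ℂ] HC)
    (hB : B 1 + (e 1 * B (e 1) + e 2 * B (e 2) + e 3 * B (e 3)) = 0) :
    ∑ i : Fin 3, (e i.succ + (y i : ℂ) • hyp σ y) * B (t • tangent σ y i) =
      t • (hyp σ y * B (hyp σ y)) := by
  have hσ' : (σ : ℂ) ^ 2 = 1 := by exact_mod_cast congrArg (fun r : ℝ => (r : ℂ)) hσ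
  have hh := ofReal_height_sq y
  have hs := height_ne y
  have h0 := eq_neg_of_add_eq_zero_left hB
  simp only [Fin.sum_univ_three, tangent, Fin.succ_zero_eq_one, Fin.succ_one_eq_two,
    show (2 : Fin 3).succ = 3 from rfl]
  rw [hyp]
  simp only [map_add, map_smul, h0]
  simp only [mul_add, add_mul, smul_mul_assoc, mul_smul_comm, smul_add, smul_smul, one_mul,
    smul_neg, mul_neg, neg_mul]
  match_scalars <;> field_simp <;> simp only [hh, I_sq, hσ'] <;> ring

/-- The summands are height times the partial derivatives of height⁻¹(eᵢ + yᵢY), the part of `flux`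
without kernel and φ. The factor 3 matches the derivative of t³. -/
lemma sum_tangent (σ : ℝ) (y : Fin 3 → ℝ) :
    ∑ i : Fin 3, ((-(y i / (height y : ℂ) ^ 2)) • (e i.succ + (y i : ℂ) • hyp σ y) +
      (hyp σ y + (y i : ℂ) • tangent σ y i)) = (3 : ℂ) • hyp σ y := by
  have hh := ofReal_height_sq y
  have hs := height_ne y
  simp only [Fin.sum_univ_three, tangent, Fin.succ_zero_eq_one, Fin.succ_one_eq_two,
    show (2 : Fin 3).succ = 3 from rfl]
  rw [hyp]
  simp only [smul_add, smul_smul]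
  match_scalars <;> field_simp <;> simp only [hh] <;> ring

lemma hasDerivAt_height_line (y : Fin 3 → ℝ) (i : Fin 3) :
    HasDerivAt (fun r : ℝ => (height (y + r • Pi.single i 1) : ℂ)) (y i / height y : ℂ) 0 := by
  obtain ⟨h', hh, hv⟩ := hasFDerivAt_height y
  have h1 : HasLineDerivAt ℝ height _ y (Pi.single i 1) := hh.hasLineDerivAt _
  have h2 : h' (Pi.single i 1) = y i / height y := by
    rw [hv]; fin_cases i <;> simp
  rw [h2] at h1
  have h3 := HasDerivAt.ofReal_comp h1
  simpa using h3

lemma hasDerivAt_hyp_line (σ : ℝ) (y : Fin 3 → ℝ) (i : Fin 3) :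
    HasDerivAt (fun r : ℝ => hyp σ (y + r • Pi.single i 1)) (tangent σ y i) 0 := by
  obtain ⟨h', hh, hv⟩ := hasFDerivAt_hyp σ y
  rw [← hv i]
  exact hh.hasLineDerivAt (Pi.single i 1)

lemma hasDerivAt_flux_line (Y₀ : HC) (φ : HC → HC) (σ : ℝ) (t : ℂ) (i : Fin 3) (y : Fin 3 → ℝ)
    {A B : HC →L[ℂ] HC} (hA : HasFDerivAt (kernel Y₀) A (t • hyp σ y))
    (hB : HasFDerivAt φ B (t • hyp σ y)) :
    HasDerivAt (fun r : ℝ => flux Y₀ φ σ t i (y + r • Pi.single i 1))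
      ((I * σ * t ^ 2 / height y) •
        (kernel Y₀ (t • hyp σ y) * ((-(y i / (height y : ℂ) ^ 2)) • (e i.succ + (y i : ℂ) • hyp σ y) +
          (hyp σ y + (y i : ℂ) • tangent σ y i)) * φ (t • hyp σ y) +
        (A (t • tangent σ y i) * (e i.succ + (y i : ℂ) • hyp σ y)) * φ (t • hyp σ y) +
        kernel Y₀ (t • hyp σ y) * ((e i.succ + (y i : ℂ) • hyp σ y) * B (t • tangent σ y i)))) 0 := by
  have hs := height_ne y
  have y0 : y + (0 : ℝ) • Pi.single i (1 : ℝ) = y := by simp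
  have hY := hasDerivAt_hyp_line σ y i
  have hh := hasDerivAt_height_line y i
  have htY := hY.const_smul t
  have hK : HasDerivAt (fun r : ℝ => kernel Y₀ (t • hyp σ (y + r • Pi.single i 1)))
      (A (t • tangent σ y i)) 0 :=
    HasFDerivAt.comp_hasDerivAt (l' := A.restrictScalars ℝ) (l := kernel Y₀)
      (f := fun r : ℝ => t • hyp σ (y + r • Pi.single i 1)) (0 : ℝ)
      (by rw [y0]; exact hA.restrictScalars ℝ) htY
  have hφ : HasDerivAt (fun r : ℝ => φ (t • hyp σ (y + r • Pi.single i 1)))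
      (B (t • tangent σ y i)) 0 :=
    HasFDerivAt.comp_hasDerivAt (l' := B.restrictScalars ℝ) (l := φ)
      (f := fun r : ℝ => t • hyp σ (y + r • Pi.single i 1)) (0 : ℝ)
      (by rw [y0]; exact hB.restrictScalars ℝ) htY
  have hc : HasDerivAt (fun r : ℝ => I * σ * t ^ 2 / (height (y + r • Pi.single i 1) : ℂ))
      (I * σ * t ^ 2 / height y * (-(y i / (height y : ℂ) ^ 2))) 0 := by
    have := (hh.inv (by rw [y0]; exact hs)).const_mul (I * σ * t ^ 2)
    rw [y0] at this
    refine (this.congr_deriv ?_).congr_of_eventuallyEq (Eventually.of_forall fun r => ?_)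
    · field_simp
    · simp [div_eq_mul_inv]
  have hyi : HasDerivAt (fun r : ℝ => (((y + r • (Pi.single i 1 : Fin 3 → ℝ)) i : ℝ) : ℂ)) 1 0 := by
    have : HasDerivAt (fun r : ℝ => y i + r) 1 0 := (hasDerivAt_id (0 : ℝ)).const_add _
    have := HasDerivAt.ofReal_comp this
    simpa using this
  have hM := (hyi.fun_smul hY).const_add (e i.succ)
  have := hc.fun_smul ((hK.fun_mul hM).fun_mul hφ)
  simp only [y0] at this
  refine this.congr_deriv ?_
  generalize I * σ * t ^ 2 / (height y : ℂ) = c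
  generalize (y i / (height y : ℂ) ^ 2) = c'
  simp only [one_smul, mul_add, add_mul, smul_add, mul_smul, smul_mul_assoc, mul_smul_comm,
    mul_assoc]
  module

lemma hasDerivAt_coeff (Y₀ : HC) (φ : HC → HC) (σ : ℝ) (t : ℂ) (y : Fin 3 → ℝ)
    {A B : HC →L[ℂ] HC} (hA : HasFDerivAt (kernel Y₀) A (t • hyp σ y))
    (hB : HasFDerivAt φ B (t • hyp σ y)) :
    HasDerivAt (fun t : ℂ => coeff Y₀ φ σ t y) ((I * σ * t ^ 2 / height y) •
      (kernel Y₀ (t • hyp σ y) * ((3 : ℂ) • hyp σ y) * φ (t • hyp σ y) +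
        (t • (A (hyp σ y) * hyp σ y)) * φ (t • hyp σ y) +
        kernel Y₀ (t • hyp σ y) * (t • (hyp σ y * B (hyp σ y))))) t := by
  have hY : HasDerivAt (fun t : ℂ => t • hyp σ y) (hyp σ y) t := by
    have := (hasDerivAt_id t).smul_const (hyp σ y)
    rwa [one_smul] at this
  have hK : HasDerivAt (fun t : ℂ => kernel Y₀ (t • hyp σ y)) (A (hyp σ y)) t :=
    HasFDerivAt.comp_hasDerivAt (l := kernel Y₀) (f := fun t : ℂ => t • hyp σ y) t hA hY
  have hφ : HasDerivAt (fun t : ℂ => φ (t • hyp σ y)) (B (hyp σ y)) t :=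
    HasFDerivAt.comp_hasDerivAt (l := φ) (f := fun t : ℂ => t • hyp σ y) t hB hY
  have hc : HasDerivAt (fun t : ℂ => I * σ * t ^ 3 / height y)
      (I * σ * t ^ 2 / height y * 3) t := by
    refine (((hasDerivAt_pow 3 t).const_mul (I * σ)).div_const _).congr_deriv ?_
    push_cast; ring
  refine (hc.fun_smul ((hK.mul_const (hyp σ y)).fun_mul hφ)).congr_deriv ?_
  rw [show I * σ * t ^ 3 / height y = I * σ * t ^ 2 / height y * t by ring]
  generalize I * σ * t ^ 2 / (height y : ℂ) = c
  simp only [smul_add, mul_smul, smul_mul_assoc, mul_smul_comm, mul_assoc]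
  module

/-- This is the closedness of K·Dz·φ. The product rule yields three terms: the derivative of K is
handled by right-regularity, that of φ by left-regularity, and the remaining one by `sum_tangent`.
-/
lemma hasDerivAt_coeff_eq_div {σ : ℝ} (hσ : σ ^ 2 = 1) (Y₀ : HC) (φ : HC → HC) (t : ℂ)
    (y : Fin 3 → ℝ) {B : HC →L[ℂ] HC} (hN : (t • hyp σ y - Y₀).det ≠ 0)
    (hB : HasFDerivAt φ B (t • hyp σ y))
    (hB0 : B 1 + (e 1 * B (e 1) + e 2 * B (e 2) + e 3 * B (e 3)) = 0) :
    (∀ i, DifferentiableAt ℝ (flux Y₀ φ σ t i) y) ∧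
    HasDerivAt (fun t : ℂ => coeff Y₀ φ σ t y)
      (∑ i, fderiv ℝ (flux Y₀ φ σ t i) y (Pi.single i 1)) t := by
  obtain ⟨A, hA, hA0⟩ := kernel_regular Y₀ _ hN
  have hdiff : ∀ i, DifferentiableAt ℝ (flux Y₀ φ σ t i) y := by
    intro i
    have hY := differentiable_hyp σ y
    have htY := hY.const_smul t
    have hK : DifferentiableAt ℝ (fun y => kernel Y₀ (t • hyp σ y)) y :=
      DifferentiableAt.comp (g := kernel Y₀) y (hA.restrictScalars ℝ).differentiableAt htY
    have hφ : DifferentiableAt ℝ (fun y => φ (t • hyp σ y)) y :=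
      DifferentiableAt.comp (g := φ) y (hB.restrictScalars ℝ).differentiableAt htY
    have hh : DifferentiableAt ℝ (fun y => (height y : ℂ)) y :=
      DifferentiableAt.comp (g := Complex.ofReal) y Complex.ofRealCLM.differentiableAt
        (hasFDerivAt_height y).choose_spec.1.differentiableAt
    have hyi : DifferentiableAt ℝ (fun y : Fin 3 → ℝ => (y i : ℂ)) y :=
      DifferentiableAt.comp (g := Complex.ofReal) y Complex.ofRealCLM.differentiableAt
        (differentiableAt_apply i y)
    have hc : DifferentiableAt ℝ (fun y => I * σ * t ^ 2 / (height y : ℂ)) y :=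
      by
      simp only [div_eq_mul_inv]
      exact (hh.fun_inv (height_ne y)).const_mul _
    exact hc.smul ((hK.mul ((hyi.smul hY).const_add (e i.succ))).mul hφ)
  refine ⟨hdiff, ?_⟩
  have hline : ∀ i, fderiv ℝ (flux Y₀ φ σ t i) y (Pi.single i 1) = _ := fun i =>
    ((hdiff i).hasFDerivAt.hasLineDerivAt (Pi.single i 1)).unique
      (hasDerivAt_flux_line Y₀ φ σ t i y hA hB)
  refine (hasDerivAt_coeff Y₀ φ σ t y hA hB).congr_deriv ?_
  simp only [hline]
  rw [← Finset.smul_sum, Finset.sum_add_distrib, Finset.sum_add_distrib, ← Finset.sum_mul,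
    ← Finset.sum_mul, ← Finset.mul_sum, ← Finset.mul_sum, sum_tangent,
    sum_right_regular hσ y t A hA0, sum_left_regular hσ y t B hB0]

/-! ### Integrals depending holomorphically on a parameter -/

section HolomorphicParameter

variable {α E : Type*} [MeasurableSpace α] {μ : Measure α} [NormedAddCommGroup E]
  [NormedSpace ℂ E]

/-- Cauchy's estimate on the ball of half the radius. -/
lemma norm_deriv_le_of_norm_le_ball {f : ℂ → E} {t₀ : ℂ} {r C : ℝ} (hr : 0 < r)
    (hd : DifferentiableOn ℂ f (Metric.ball t₀ r)) (hC : ∀ t ∈ Metric.ball t₀ r, ‖f t‖ ≤ C)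
    {t : ℂ} (ht : t ∈ Metric.ball t₀ (r / 2)) : ‖deriv f t‖ ≤ C / (r / 4) := by
  have hr4 : 0 < r / 4 := by positivity
  have hsub : Metric.closedBall t (r / 4) ⊆ Metric.ball t₀ r := by
    intro z hz
    rw [Metric.mem_ball] at ht ⊢
    rw [Metric.mem_closedBall] at hz
    linarith [dist_triangle z t t₀]
  refine norm_deriv_le_of_forall_mem_sphere_norm_le hr4 ?_ fun z hz =>
    hC z (hsub (Metric.sphere_subset_closedBall hz))
  refine (hd.mono ?_).diffContOnCl
  rwa [closure_ball t hr4.ne']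

/-- A locally dominated integral of holomorphic functions is holomorphic. -/
lemma hasDerivAt_integral_of_differentiableOn {T : Set ℂ} (hT : IsOpen T)
    {F : ℂ → α → E} (hmeas : ∀ t ∈ T, AEStronglyMeasurable (F t) μ)
    (hd : ∀ a, DifferentiableOn ℂ (fun t => F t a) T) {t₀ : ℂ} (ht₀ : t₀ ∈ T) {b : α → ℝ}
    (hb : Integrable b μ) (hbd : ∀ᶠ t in 𝓝 t₀, ∀ a, ‖F t a‖ ≤ b a) :
    Integrable (fun a => deriv (fun t => F t a) t₀) μ ∧
      HasDerivAt (fun t => ∫ a, F t a ∂μ) (∫ a, deriv (fun t => F t a) t₀ ∂μ) t₀ := by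
  obtain ⟨r, hr, hball⟩ := Metric.eventually_nhds_iff_ball.1 (hbd.and (hT.mem_nhds ht₀))
  have hda : ∀ a, ∀ x ∈ Metric.ball t₀ r, HasDerivAt (fun t => F t a) (deriv (fun t => F t a) x) x :=
    fun a x hx => ((hd a).differentiableAt (hT.mem_nhds (hball x hx).2)).hasDerivAt
  have hbound : ∀ a, ∀ x ∈ Metric.ball t₀ (r / 2), ‖deriv (fun t => F t a) x‖ ≤ b a / (r / 4) := by
    exact fun a x hx => norm_deriv_le_of_norm_le_ball hr
      (DifferentiableOn.mono (hd a) fun z hz => (hball z hz).2) (fun z hz => (hball z hz).1 a) hx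
  have hnb : Metric.ball t₀ (r / 2) ∈ 𝓝 t₀ := Metric.ball_mem_nhds _ (by positivity)
  -- The derivative is measurable as a pointwise limit of difference quotients with real increments
  -- r/(2(n + 1)).
  have hmeas' : AEStronglyMeasurable (fun a => deriv (fun t => F t a) t₀) μ := by
    have hu : ∀ n : ℕ, t₀ + ((r / 2 / (n + 1) : ℝ) : ℂ) ∈ Metric.ball t₀ r := by
      intro n
      have h1 : r / 2 / (n + 1) ≤ r / 2 := div_le_self (by positivity) (by linarith [n.cast_nonneg (α := ℝ)])
      have h2 : 0 < r / 2 / (n + 1) := by positivity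
      rw [Metric.mem_ball, dist_eq, add_sub_cancel_left, norm_real, Real.norm_eq_abs,
        abs_of_pos h2]
      linarith
    have hn0 : ∀ n : ℕ, ((r / 2 / (n + 1) : ℝ) : ℂ) ≠ 0 := fun n =>
      ofReal_ne_zero.2 (by positivity)
    refine aestronglyMeasurable_of_tendsto_ae atTop
      (f := fun (n : ℕ) a => (((r / 2 / (n + 1) : ℝ) : ℂ))⁻¹ •
        (F (t₀ + ((r / 2 / (n + 1) : ℝ) : ℂ)) a - F t₀ a)) (fun n => ?_)
      (Eventually.of_forall fun a => ?_)
    · exact ((hmeas _ (hball _ (hu n)).2).sub (hmeas _ ht₀)).const_smul _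
    · have h1 := (hasDerivAt_iff_tendsto_slope_zero.1
        (hda a t₀ (Metric.mem_ball_self hr)))
      refine h1.comp (tendsto_nhdsWithin_iff.2 ⟨?_, Eventually.of_forall hn0⟩)
      have : Tendsto (fun n : ℕ => r / 2 / ((n : ℝ) + 1)) atTop (𝓝 0) :=
        tendsto_const_nhds.div_atTop (tendsto_atTop_add_const_right _ _ tendsto_natCast_atTop_atTop)
      exact (continuous_ofReal.tendsto' 0 0 ofReal_zero).comp this
  refine hasDerivAt_integral_of_dominated_loc_of_deriv_le (bound := fun a => b a / (r / 4)) hnb ?_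
    ?_ hmeas' (Eventually.of_forall hbound) (hb.div_const _)
    (Eventually.of_forall fun a x hx => hda a x (Metric.ball_subset_ball (by linarith) hx))
  · filter_upwards [hT.mem_nhds ht₀] with t ht using hmeas t ht
  · exact hb.mono' (hmeas t₀ ht₀) (Eventually.of_forall fun a => hbd.self_of_nhds a)

/-- The partial derivative of a holomorphic function along a line in another direction is
holomorphic along the line. -/
lemma differentiableAt_fderiv_line {G : Type*} [NormedAddCommGroup G] [NormedSpace ℂ G]
    [CompleteSpace E] {φ : G → E} {Ω : Set G} (hΩ : IsOpen Ω)
    (hφ : DifferentiableOn ℂ φ Ω) (a v : G) {t₀ : ℂ} (ht₀ : t₀ • a ∈ Ω) :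
    DifferentiableAt ℂ (fun t : ℂ => fderiv ℂ φ (t • a) v) t₀ := by
  have hc : Continuous fun p : ℂ × ℂ => p.1 • a + p.2 • v := by fun_prop
  have h0 : ∀ᶠ p : ℂ × ℂ in 𝓝 (t₀, 0), p.1 • a + p.2 • v ∈ Ω ∧ ‖φ (p.1 • a + p.2 • v)‖ ≤
      ‖φ (t₀ • a)‖ + 1 := by
    have hp : (fun p : ℂ × ℂ => p.1 • a + p.2 • v) (t₀, 0) = t₀ • a := by simp
    have h1 : Tendsto (fun p : ℂ × ℂ => p.1 • a + p.2 • v) (𝓝 (t₀, 0)) (𝓝 (t₀ • a)) := by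
      rw [← hp]; exact hc.continuousAt
    have h2 : ∀ᶠ z in 𝓝 (t₀ • a), z ∈ Ω ∧ ‖φ z‖ ≤ ‖φ (t₀ • a)‖ + 1 :=
      (show ∀ᶠ z in 𝓝 (t₀ • a), z ∈ Ω from hΩ.mem_nhds ht₀).and ((hφ.differentiableAt (hΩ.mem_nhds ht₀)).continuousAt.norm.eventually_le_const
        (lt_add_one _))
    exact h1.eventually h2
  obtain ⟨r, hr, hball⟩ := Metric.eventually_nhds_iff_ball.1 h0
  have hmem : ∀ t ∈ Metric.ball t₀ r, ∀ h ∈ Metric.closedBall (0 : ℂ) (r / 2),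
      (t, h) ∈ Metric.ball (t₀, (0 : ℂ)) r := by
    intro t ht h hh
    rw [← ball_prod_same]
    exact ⟨ht, Metric.closedBall_subset_ball (by linarith) hh⟩
  have hr2 : 0 < r / 2 := by positivity
  have hdφ : ∀ t ∈ Metric.ball t₀ r, ∀ h ∈ Metric.closedBall (0 : ℂ) (r / 2),
      DifferentiableAt ℂ φ (t • a + h • v) := fun t ht h hh =>
    hφ.differentiableAt (hΩ.mem_nhds (hball _ (hmem t ht h hh)).1)
  have hcirc : ∀ θ, circleMap 0 (r / 2) θ ∈ Metric.closedBall (0 : ℂ) (r / 2) := fun θ =>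
    circleMap_mem_closedBall 0 hr2.le θ
  -- Cauchy's formula in an auxiliary variable h along v expresses the directional derivative as a
  -- circle integral of values of φ, which are holomorphic in t.
  set F : ℂ → ℝ → E := fun t θ => deriv (circleMap 0 (r / 2)) θ •
    ((1 / (circleMap 0 (r / 2) θ - 0) ^ 2) • φ (t • a + circleMap 0 (r / 2) θ • v)) with hF
  have hFint : ∀ t ∈ Metric.ball t₀ r,
      ∫ θ in Ioc 0 (2 * Real.pi), F t θ = (2 * Real.pi * I) • fderiv ℂ φ (t • a) v := by
    intro t ht
    have hdl : ∀ h ∈ Metric.closedBall (0 : ℂ) (r / 2),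
        HasDerivAt (fun h : ℂ => φ (t • a + h • v)) (fderiv ℂ φ (t • a + h • v) v) h := by
      intro h hh
      have h1 : HasDerivAt (fun h : ℂ => t • a + h • v) v h := by
        simpa using ((hasDerivAt_id h).smul_const v).const_add (t • a)
      exact (hdφ t ht h hh).hasFDerivAt.comp_hasDerivAt h h1
    have h1 := DifferentiableOn.deriv_eq_smul_circleIntegral (c := 0) hr2
      (fun h hh => (hdl h hh).differentiableAt.differentiableWithinAt)
    rw [(hdl 0 (Metric.mem_closedBall_self hr2.le)).deriv, zero_smul, add_zero] at h1
    rw [← h1, circleIntegral, intervalIntegral.integral_of_le Real.two_pi_pos.le]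
  have hcont : ∀ t ∈ Metric.ball t₀ r, Continuous (F t) := by
    intro t ht
    have h1 : Continuous fun θ => φ (t • a + circleMap 0 (r / 2) θ • v) :=
      continuous_iff_continuousAt.2 fun θ =>
        ContinuousAt.comp (g := φ) (hdφ t ht _ (hcirc θ)).continuousAt
          (by have := continuous_circleMap 0 (r / 2); fun_prop)
    simp only [hF, deriv_circleMap]
    refine Continuous.smul (by have := continuous_circleMap 0 (r / 2); fun_prop)
      (Continuous.smul (continuous_const.div
        (by have := continuous_circleMap 0 (r / 2); fun_prop) fun θ => ?_) h1)
    rw [sub_zero]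
    exact pow_ne_zero 2 (circleMap_ne_center hr2.ne')
  have hmain := hasDerivAt_integral_of_differentiableOn (μ := volume.restrict (Ioc 0 (2 * Real.pi)))
    (T := Metric.ball t₀ r) Metric.isOpen_ball (F := F)
    (fun t ht => (hcont t ht).aestronglyMeasurable) (fun θ t ht => ?_) (Metric.mem_ball_self hr)
    (b := fun _ => (r / 2) * ((1 / (r / 2) ^ 2) * (‖φ (t₀ • a)‖ + 1))) (integrable_const _) ?_
  · have h2 := (hmain.2.const_smul (2 * Real.pi * I : ℂ)⁻¹).differentiableAt
    refine h2.congr_of_eventuallyEq ?_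
    filter_upwards [Metric.ball_mem_nhds t₀ hr] with t ht
    rw [Pi.smul_apply, hFint t ht, smul_smul, inv_mul_cancel₀ two_pi_I_ne_zero, one_smul]
  · have h1 : DifferentiableAt ℂ (fun t : ℂ => t • a + circleMap 0 (r / 2) θ • v) t := by fun_prop
    exact (((DifferentiableAt.comp (g := φ) t (hdφ t ht _ (hcirc θ)) h1).const_smul _).const_smul
      _).differentiableWithinAt
  · filter_upwards [Metric.ball_mem_nhds t₀ hr] with t ht θ
    have hn : ‖circleMap 0 (r / 2) θ‖ = r / 2 := by simp [hr2.le]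
    simp only [hF, deriv_circleMap, norm_smul, norm_mul, norm_I, mul_one, sub_zero, norm_div,
      norm_one, norm_pow, hn]
    gcongr
    exact (hball _ (hmem t ht _ (hcirc θ))).2

end HolomorphicParameter

/-! ### Integrability on ℝ³ and vanishing of integrated divergences -/

lemma integrable_height_pow : Integrable fun y : Fin 3 → ℝ => (height y)⁻¹ ^ 4 := by
  have h1 := integrable_rpow_neg_one_add_norm_sq (E := Fin 3 → ℝ) (μ := volume) (r := 4)
    (by simp; norm_num)
  refine h1.mono' ?_ (Eventually.of_forall fun y => ?_)
  · exact ((continuous_height.inv₀ fun y => (height_pos y).ne').pow 4).aestronglyMeasurable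
  · have hh : (1 + ‖y‖ ^ 2) ≤ height y ^ 2 := by
      rw [height, Real.sq_sqrt (by positivity)]
      have h1 : ‖y‖ ≤ √(∑ j, y j ^ 2) :=
        (pi_norm_le_iff_of_nonneg (Real.sqrt_nonneg _)).2 fun j => Real.abs_le_sqrt
          (Finset.single_le_sum (f := fun j => y j ^ 2) (fun i _ => sq_nonneg (y i))
            (Finset.mem_univ j))
      have h2 := pow_le_pow_left₀ (norm_nonneg y) h1 2
      rw [Real.sq_sqrt (by positivity)] at h2
      linarith
    have hp := height_pos y
    have h0 : 0 < 1 + ‖y‖ ^ 2 := by positivity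
    rw [Real.norm_of_nonneg (by positivity), show (-4 / 2 : ℝ) = -((2 : ℕ) : ℝ) by norm_num,
      Real.rpow_neg h0.le, Real.rpow_natCast, inv_pow, show height y ^ 4 = (height y ^ 2) ^ 2 by ring]
    gcongr

/-- The integral of the divergence of a rapidly decreasing vector field vanishes. -/
lemma integral_div_eq_zero {E : Type*} [NormedAddCommGroup E] [NormedSpace ℝ E]
    {V : Fin 3 → (Fin 3 → ℝ) → E} (hV : ∀ i, Differentiable ℝ (V i)) {C : ℝ}
    (hC : ∀ i y, ‖V i y‖ ≤ C * (height y)⁻¹ ^ 3)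
    (hi : Integrable fun y => ∑ i, fderiv ℝ (V i) y (Pi.single i 1)) :
    ∫ y, ∑ i, fderiv ℝ (V i) y (Pi.single i 1) = 0 := by
  have hC0 : 0 ≤ C := by
    have := (norm_nonneg _).trans (hC 0 0)
    have h := height_pos 0
    by_contra hneg
    have : C * (height 0)⁻¹ ^ 3 < 0 := mul_neg_of_neg_of_pos (not_le.1 hneg) (by positivity)
    linarith
  have hlim : Tendsto (fun n : ℕ => ∫ y in Icc (fun _ => -((n : ℝ) + 1)) (fun _ => (n : ℝ) + 1),
      ∑ i, fderiv ℝ (V i) y (Pi.single i 1)) atTop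
      (𝓝 (∫ y, ∑ i, fderiv ℝ (V i) y (Pi.single i 1))) := by
    have ht : Tendsto (fun n : ℕ => (n : ℝ) + 1) atTop atTop :=
      tendsto_atTop_add_const_right _ _ tendsto_natCast_atTop_atTop
    refine (aecover_Icc ?_ ?_).integral_tendsto_of_countably_generated hi
    · refine tendsto_atBot.2 fun b => ?_
      have : ∀ᶠ n : ℕ in atTop, ∀ i, -((n : ℝ) + 1) ≤ b i :=
        eventually_all.2 fun i => (tendsto_neg_atTop_atBot.comp ht).eventually_le_atBot (b i)
      exact this
    · refine tendsto_atTop.2 fun b => ?_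
      have : ∀ᶠ n : ℕ in atTop, ∀ i, b i ≤ (n : ℝ) + 1 :=
        eventually_all.2 fun i => ht.eventually_ge_atTop (b i)
      exact this
  refine tendsto_nhds_unique hlim ?_
  -- A cube of half-side a has six faces of area (2a)². On each of them height ≥ |yᵢ| = a, so the
  -- flux through it is at most C a⁻³(2a)².
  have hb : ∀ n : ℕ, ‖∫ y in Icc (fun _ => -((n : ℝ) + 1)) (fun _ => (n : ℝ) + 1),
      ∑ i, fderiv ℝ (V i) y (Pi.single i 1)‖ ≤ 24 * C / ((n : ℝ) + 1) := by
    intro n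
    set a : ℝ := (n : ℝ) + 1 with ha
    have ha0 : 0 < a := by positivity
    have hface : ∀ (i : Fin 3) (s : ℝ), |s| = a →
        ‖∫ x : Fin 2 → ℝ in Icc ((fun _ : Fin 3 => -a) ∘ i.succAbove) ((fun _ : Fin 3 => a) ∘
          i.succAbove), V i (i.insertNth s x)‖ ≤ C * a⁻¹ ^ 3 * (2 * a) ^ 2 := by
      intro i s hs
      have hvol : volume.real (Icc ((fun _ : Fin 3 => -a) ∘ i.succAbove)
          ((fun _ : Fin 3 => a) ∘ i.succAbove)) = (2 * a) ^ 2 := by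
        rw [Measure.real, Real.volume_Icc_pi_toReal (fun j => by simp; linarith)]
        simp; ring
      rw [← hvol]
      refine norm_setIntegral_le_of_norm_le_const ?_ fun x _ => ?_
      · rw [Real.volume_Icc_pi]; exact ENNReal.prod_lt_top fun _ _ => ENNReal.ofReal_lt_top
      · refine (hC i _).trans ?_
        have : a ≤ height (i.insertNth (α := fun _ : Fin 3 => ℝ) s x) := by
          have := abs_le_height (i.insertNth (α := fun _ : Fin 3 => ℝ) s x) i
          rwa [Fin.insertNth_apply_same, hs] at this
        have hp := (height_pos (i.insertNth (α := fun _ : Fin 3 => ℝ) s x)).le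
        gcongr
    rw [integral_divergence_of_hasFDerivAt_off_countable' (fun _ => -a) (fun _ => a)
      (fun _ => by simp only; linarith) V (fun i => fderiv ℝ (V i)) ∅ countable_empty
      (fun i => (hV i).continuous.continuousOn) (fun x _ i => (hV i x).hasFDerivAt)
      hi.integrableOn]
    refine (norm_sum_le _ _).trans ?_
    calc _ ≤ ∑ i : Fin 3, 2 * (C * a⁻¹ ^ 3 * (2 * a) ^ 2) := by
          refine Finset.sum_le_sum fun i _ => (norm_sub_le _ _).trans ?_
          have h1 := hface i a (abs_of_pos ha0)
          have h2 := hface i (-a) (by rw [abs_neg, abs_of_pos ha0])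
          linarith
      _ = 24 * C / a := by
          rw [Finset.sum_const, Finset.card_univ, Fintype.card_fin]
          simp only [nsmul_eq_mul]
          field_simp
          norm_num
          ring
  exact squeeze_zero_norm hb (tendsto_const_nhds.div_atTop
    (tendsto_atTop_add_const_right _ _ tendsto_natCast_atTop_atTop))

/-! ### The sector of parameters and regular functions on the cone -/

/-- The sector `|Im t| < κ Re t` around the positive real axis. -/
def sector (κ : ℝ) : Set ℂ := {t | 0 < t.re ∧ |t.im| < κ * t.re}

lemma isOpen_sector (κ : ℝ) : IsOpen (sector κ) :=
  (isOpen_lt continuous_const continuous_re).inter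
    (isOpen_lt continuous_im.abs (continuous_const.mul continuous_re))

lemma convex_sector (κ : ℝ) : Convex ℝ (sector κ) := by
  rintro s ⟨hs, hs'⟩ t ⟨ht, ht'⟩ a b ha hb hab
  have h1 : (a • s + b • t).re = a * s.re + b * t.re := by simp
  have h2 : (a • s + b • t).im = a * s.im + b * t.im := by simp
  rw [abs_lt] at hs' ht'
  refine ⟨?_, ?_⟩
  · rw [h1]
    rcases ha.eq_or_lt with rfl | ha
    · have : b = 1 := by linarith
      subst this; simpa using ht
    · have := mul_pos ha hs; have := mul_nonneg hb ht.le; linarith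
  · rw [h1, h2, abs_lt]
    rcases ha.eq_or_lt with rfl | ha
    · have : b = 1 := by linarith
      subst this; constructor <;> linarith
    · constructor <;> nlinarith

/-- Holomorphic left-regular functions near the cone over the hyperboloid, with the decay of
continuations of functions in `𝒱(𝕄)`. -/
structure ConeRegular (φ : HC → HC) (κ : ℝ) : Prop where
  diff : ∀ t ∈ sector κ, ∀ σ : ℝ, σ ^ 2 = 1 → ∀ y, DifferentiableAt ℂ φ (t • hyp σ y)
  regular : ∀ t ∈ sector κ, ∀ σ : ℝ, σ ^ 2 = 1 → ∀ y,
    fderiv ℂ φ (t • hyp σ y) 1 + (e 1 * fderiv ℂ φ (t • hyp σ y) (e 1) +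
      e 2 * fderiv ℂ φ (t • hyp σ y) (e 2) + e 3 * fderiv ℂ φ (t • hyp σ y) (e 3)) = 0
  bound : ∃ C : ℝ, ∀ t ∈ sector κ, ∀ σ : ℝ, σ ^ 2 = 1 → ∀ y, ∃ Φ : HC, ‖Φ‖ ≤ C ∧
    φ (t • hyp σ y) = ((1 - t • hyp σ y).det⁻¹ ^ 2) • (adj (1 - t • hyp σ y) * Φ)

/-! ### Lower bounds for N, linear in the height -/

lemma one_add_norm_le {t x : ℂ} {d : ℝ} (hd : 0 < d) (h : d ≤ ‖t - x‖) :
    1 + ‖x‖ ≤ ((1 + ‖t‖) / d + 1) * ‖t - x‖ := by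
  have h1 : ‖x‖ ≤ ‖t‖ + ‖t - x‖ := by
    have := norm_sub_le t (t - x)
    rwa [sub_sub_cancel] at this
  have h2 : 1 + ‖t‖ ≤ (1 + ‖t‖) / d * ‖t - x‖ := by
    rw [div_mul_eq_mul_div, le_div_iff₀ hd]
    have : 0 ≤ 1 + ‖t‖ := by positivity
    gcongr
  linarith

/-- Used with x, x' the roots of a monic quadratic in t: their sum is a coefficient, so the
polynomial is bounded below without knowing the size of either root. -/
lemma one_add_norm_add_le {t x x' : ℂ} {d : ℝ} (hd : 0 < d) (h : d ≤ ‖t - x‖)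
    (h' : d ≤ ‖t - x'‖) :
    1 + ‖x + x'‖ ≤ ((1 + ‖t‖) / d + 1) ^ 2 * ‖(t - x) * (t - x')‖ := by
  have h1 := one_add_norm_le hd h
  have h2 := one_add_norm_le hd h'
  calc 1 + ‖x + x'‖ ≤ (1 + ‖x‖) * (1 + ‖x'‖) := by
        nlinarith [norm_add_le x x', norm_nonneg x, norm_nonneg x', mul_nonneg (norm_nonneg x)
          (norm_nonneg x')]
    _ ≤ (((1 + ‖t‖) / d + 1) * ‖t - x‖) * (((1 + ‖t‖) / d + 1) * ‖t - x'‖) := by gcongr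
    _ = _ := by rw [norm_mul]; ring

/-- The roots iσ(s ± √(s² - 1)), with s the height, lie on the imaginary axis, hence at distance at
least Re t from t; their sum has modulus 2s. -/
lemma height_le_det_one_sub {t : ℂ} (ht : 0 < t.re) {σ : ℝ} (hσ : σ ^ 2 = 1) (y : Fin 3 → ℝ) :
    height y ≤ ((1 + ‖t‖) / t.re + 1) ^ 2 * ‖(1 - t • hyp σ y).det‖ := by
  have hh := one_le_height y
  set s := height y with hs
  have hr : √(s ^ 2 - 1) ^ 2 = s ^ 2 - 1 := Real.sq_sqrt (by nlinarith)
  set r := √(s ^ 2 - 1)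
  have hr' : (r : ℂ) ^ 2 = s ^ 2 - 1 := by exact_mod_cast congrArg (fun r : ℝ => (r : ℂ)) hr
  have hσ' : (σ : ℂ) ^ 2 = 1 := by exact_mod_cast congrArg (fun r : ℝ => (r : ℂ)) hσ
  have hd : ∀ a : ℝ, t.re ≤ ‖t - I * a‖ := fun a => by
    refine le_trans (le_of_eq ?_) (re_le_norm _); simp
  have h1 := one_add_norm_add_le ht (hd (σ * (s + r))) (hd (σ * (s - r)))
  have h2 : (1 - t • hyp σ y).det = -((t - I * (σ * (s + r) : ℝ)) * (t - I * (σ * (s - r) : ℝ))) := by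
    rw [det_one_sub_smul_hyp hσ]
    push_cast
    linear_combination (σ ^ 2 * (s ^ 2 - r ^ 2)) * I_sq - (s ^ 2 - r ^ 2) * hσ' + hr'
  have h3 : I * (σ * (s + r) : ℝ) + I * (σ * (s - r) : ℝ) = I * ((2 * (σ * s) : ℝ) : ℂ) := by
    push_cast; ring
  have h4 : |σ| = 1 := by
    rcases eq_or_eq_neg_of_sq_eq_sq σ 1 (by simpa using hσ) with h | h <;> simp [h]
  rw [h3, norm_mul, norm_I, norm_real, Real.norm_eq_abs, abs_mul, abs_mul, h4,
    abs_of_pos (height_pos y), ← hs] at h1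
  rw [h2, norm_neg]
  simp only [abs_two] at h1
  linarith

lemma dot_sq_le (y y' : Fin 3 → ℝ) : (y 0 * y' 0 + y 1 * y' 1 + y 2 * y' 2) ^ 2 ≤
    (height y ^ 2 - 1) * (height y' ^ 2 - 1) := by
  rw [height_sq, height_sq]
  nlinarith [sq_nonneg (y 0 * y' 1 - y 1 * y' 0), sq_nonneg (y 0 * y' 2 - y 2 * y' 0),
    sq_nonneg (y 1 * y' 2 - y 2 * y' 1)]

/-- The constant in the lower bound of `|pairing|`. -/
noncomputable def gap (y' : Fin 3 → ℝ) : ℝ := height y' - √(height y' ^ 2 - 1)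

lemma gap_pos (y' : Fin 3 → ℝ) : 0 < gap y' := by
  have h := height_pos y'
  have : √(height y' ^ 2 - 1) < height y' := by
    rw [Real.sqrt_lt' h]; linarith
  rw [gap]; linarith

/-- A reversed Cauchy–Schwarz inequality. With s, s' the heights, a = √(s² - 1) and b = √(s'² - 1),
the dot product is at most ab, while ss' - ab is at least 1 and at least (s' - b)s. -/
lemma abs_dot_le (y y' : Fin 3 → ℝ) : |y 0 * y' 0 + y 1 * y' 1 + y 2 * y' 2| ≤
    height y * height y' - max 1 (gap y' * height y) := by
  have h := one_le_height y
  have h' := one_le_height y'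
  set a := √(height y ^ 2 - 1) with ha
  set b := √(height y' ^ 2 - 1) with hb
  have ha2 : a ^ 2 = height y ^ 2 - 1 := Real.sq_sqrt (by nlinarith)
  have hb2 : b ^ 2 = height y' ^ 2 - 1 := Real.sq_sqrt (by nlinarith)
  have ha0 : 0 ≤ a := Real.sqrt_nonneg _
  have hb0 : 0 ≤ b := Real.sqrt_nonneg _
  have h1 : |y 0 * y' 0 + y 1 * y' 1 + y 2 * y' 2| ≤ a * b := by
    refine abs_le_of_sq_le_sq ?_ (mul_nonneg ha0 hb0)
    rw [mul_pow, ha2, hb2]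
    exact dot_sq_le y y'
  refine h1.trans ?_
  have h2 : a ≤ height y := by nlinarith
  have h3 : 1 + a * b ≤ height y * height y' := by
    refine abs_le_of_sq_le_sq' ?_ (by positivity) |>.2
    have e1 : height y ^ 2 = 1 + a ^ 2 := by linarith
    have e2 : height y' ^ 2 = 1 + b ^ 2 := by linarith
    rw [mul_pow, e1, e2]
    nlinarith [sq_nonneg (a - b)]
  have h4 : gap y' * height y + a * b ≤ height y * height y' := by
    rw [gap, ← hb]; nlinarith
  rcases max_cases 1 (gap y' * height y) with ⟨h, _⟩ | ⟨h, _⟩ <;> rw [h] <;> linarith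

lemma pairing_ge {σ σ' : ℝ} (hσ : σ * σ' = 1) (y y' : Fin 3 → ℝ) :
    max 1 (gap y' * height y) ≤ pairing σ σ' y y' := by
  have := (abs_le.1 (abs_dot_le y y')).2
  rw [pairing, hσ]; linarith

lemma pairing_le {σ σ' : ℝ} (hσ : σ * σ' = -1) (y y' : Fin 3 → ℝ) :
    pairing σ σ' y y' ≤ -max 1 (gap y' * height y) := by
  have := (abs_le.1 (abs_dot_le y y')).1
  rw [pairing, hσ]; linarith

/-- The roots ρ(g ± √(g² - 1)) are real, so t is at distance at least |Im t| from them. On opposite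
sheets they are nonpositive, and Re t serves instead, even for real t. Their sum 2ρg has modulus at
least 2ρ·gap·height. -/
lemma height_le_det_sub {t : ℂ} {d : ℝ} (hd : 0 < d) {ρ : ℝ} (hρ : 0 < ρ) {σ σ' : ℝ}
    (hσ : σ ^ 2 = 1) (hσ' : σ' ^ 2 = 1) (y y' : Fin 3 → ℝ)
    (h : d ≤ |t.im| ∨ (d ≤ t.re ∧ σ * σ' = -1)) :
    2 * ρ * gap y' * height y ≤
      ((1 + ‖t‖) / d + 1) ^ 2 * ‖(t • hyp σ y - (ρ : ℂ) • hyp σ' y').det‖ := by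
  rw [det_smul_hyp_sub hσ hσ']
  have hg : max 1 (gap y' * height y) ≤ |pairing σ σ' y y'| ∧
      (σ * σ' = -1 → pairing σ σ' y y' ≤ -1) := by
    have : (σ * σ') ^ 2 = 1 := by rw [mul_pow, hσ, hσ', one_mul]
    rcases eq_or_eq_neg_of_sq_eq_sq (σ * σ') 1 (by simpa using this) with h | h
    · refine ⟨(pairing_ge h y y').trans (le_abs_self _), fun h' => by linarith⟩
    · have := pairing_le h y y'
      refine ⟨?_, fun _ => this.trans (neg_le_neg (le_max_left _ _))⟩
      rw [← abs_neg]
      exact le_trans (by linarith) (le_abs_self _)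
  generalize pairing σ σ' y y' = g at hg
  have hg1 : 1 ≤ |g| := (le_max_left _ _).trans hg.1
  have hgh : gap y' * height y ≤ |g| := (le_max_right _ _).trans hg.1
  have hg2 : 1 ≤ g ^ 2 := by rw [← sq_abs]; nlinarith
  have hr : √(g ^ 2 - 1) ^ 2 = g ^ 2 - 1 := Real.sq_sqrt (by linarith)
  have hr0 := Real.sqrt_nonneg (g ^ 2 - 1)
  set r := √(g ^ 2 - 1)
  have hr' : (r : ℂ) ^ 2 = g ^ 2 - 1 := by exact_mod_cast congrArg (fun r : ℝ => (r : ℂ)) hr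
  have hx : ∀ x : ℝ, (σ * σ' = -1 → x ≤ 0) → d ≤ ‖t - x‖ := by
    intro x hx
    rcases h with h | ⟨h, h'⟩
    · refine h.trans (le_trans (le_of_eq ?_) (abs_im_le_norm _)); simp
    · refine h.trans (le_trans ?_ (re_le_norm _))
      have := hx h'
      simpa using this
  have hx1 : σ * σ' = -1 → ρ * (g + r) ≤ 0 := fun h => by
    have h1 := hg.2 h
    have : r ≤ -g := by
      refine abs_le_of_sq_le_sq' ?_ (by linarith) |>.2
      rw [hr]; nlinarith
    exact mul_nonpos_of_nonneg_of_nonpos hρ.le (by linarith)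
  have hx2 : σ * σ' = -1 → ρ * (g - r) ≤ 0 := fun h => by
    have h1 := hg.2 h
    exact mul_nonpos_of_nonneg_of_nonpos hρ.le (by linarith)
  have h1 := one_add_norm_add_le hd (hx _ hx1) (hx _ hx2)
  have h2 : -(t ^ 2 - 2 * ρ * g * t + ρ ^ 2) =
      -((t - (ρ * (g + r) : ℝ)) * (t - (ρ * (g - r) : ℝ))) := by
    push_cast
    linear_combination -ρ ^ 2 * hr'
  have h3 : (((ρ * (g + r) : ℝ) : ℂ) + (ρ * (g - r) : ℝ)) = ((2 * ρ * g : ℝ) : ℂ) := by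
    push_cast; ring
  rw [h3, norm_real, Real.norm_eq_abs, abs_mul, abs_of_pos (by positivity : 0 < 2 * ρ)] at h1
  rw [h2, norm_neg]
  have : 2 * ρ * (gap y' * height y) ≤ 2 * ρ * |g| := by gcongr
  linarith

/-! ### Decay of the integrand and of the flux -/

noncomputable instance : ContinuousENorm HC :=
  @SeminormedAddGroup.toContinuousENorm HC _

instance : TopologicalSpace.PseudoMetrizableSpace HC :=
  @PseudoEMetricSpace.pseudoMetrizableSpace HC _

lemma abs_eq_one_of_sq {σ : ℝ} (hσ : σ ^ 2 = 1) : |σ| = 1 := by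
  rcases eq_or_eq_neg_of_sq_eq_sq σ 1 (by simpa using hσ) with h | h <;> simp [h]

lemma norm_hyp_le : ∃ c : ℝ, 0 < c ∧ ∀ σ : ℝ, σ ^ 2 = 1 → ∀ y, ‖hyp σ y‖ ≤ c * height y := by
  refine ⟨‖(1 : HC)‖ + (‖e 1‖ + ‖e 2‖ + ‖e 3‖), by
    have : 0 < ‖(1 : HC)‖ := norm_pos_iff.2 one_ne_zero
    positivity, fun σ hσ y => ?_⟩
  have h0 : ‖-(I * σ * height y)‖ = height y := by
    rw [norm_neg, norm_mul, norm_mul, norm_I, norm_real, norm_real, Real.norm_eq_abs,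
      abs_eq_one_of_sq hσ, one_mul, one_mul, Real.norm_of_nonneg (height_pos y).le]
  have h1 : ∀ j, ‖(y j : ℂ)‖ ≤ height y := fun j => by
    rw [norm_real]; exact abs_le_height y j
  rw [hyp]
  refine (norm_add_le _ _).trans ?_
  rw [norm_smul, h0]
  have h2 : ‖(y 0 : ℂ) • e 1 + (y 1 : ℂ) • e 2 + (y 2 : ℂ) • e 3‖ ≤
      height y * (‖e 1‖ + ‖e 2‖ + ‖e 3‖) := by
    refine (norm_add₃_le).trans ?_
    rw [norm_smul, norm_smul, norm_smul, mul_add, mul_add]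
    gcongr <;> exact h1 _
  linarith

lemma norm_adj_le : ∃ c : ℝ, 0 < c ∧ ∀ Z : HC, ‖adj Z‖ ≤ c * ‖Z‖ := by
  obtain ⟨c, hc, h⟩ := (adj : HC →L[ℂ] HC).bound
  exact ⟨c, hc, h⟩

/-- The decisive cancellation: each of the three factors grows like Y, but adj(Y)·Y = Y·adj(Y) = -1
makes the product grow only linearly. -/
lemma adj_sub_mul_hyp_mul_adj {σ : ℝ} (hσ : σ ^ 2 = 1) (W : HC) (t : ℂ) (y : Fin 3 → ℝ) :
    adj (t • hyp σ y - W) * hyp σ y * adj (1 - t • hyp σ y) =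
      t ^ 2 • adj (hyp σ y) - t • 1 - adj W * hyp σ y - t • adj W := by
  have h1 := adj_mul_self (hyp σ y)
  have h2 := self_mul_adj (hyp σ y)
  rw [det_hyp hσ] at h1 h2
  rw [map_sub, map_sub, map_smul, adj_one]
  generalize adj (hyp σ y) = P at *
  generalize adj W = Q
  generalize hyp σ y = Y at *
  have e1 : P * Y * P = -P := by rw [h1]; simp
  have e2 : Q * Y * P = -Q := by rw [mul_assoc, h2]; simp
  calc _ = t • (P * Y) - t ^ 2 • (P * Y * P) - Q * Y + t • (Q * Y * P) := by
        simp only [sub_mul, mul_sub, smul_mul_assoc, mul_smul_comm, mul_one]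
        module
    _ = _ := by
        rw [e1, e2, h1]
        module

lemma norm_adj_sub_le (W : HC) : ∃ c : ℝ, 0 < c ∧ ∀ (t : ℂ) (σ : ℝ), σ ^ 2 = 1 → ∀ y,
    ‖adj (t • hyp σ y - W)‖ ≤ c * (1 + ‖t‖) * height y := by
  obtain ⟨c, hc, hYc⟩ := norm_hyp_le
  obtain ⟨a, ha, hac⟩ := norm_adj_le
  have hW := norm_nonneg W
  refine ⟨a * (c + ‖W‖), by positivity, fun t σ hσ y => (hac _).trans ?_⟩
  have hY := hYc σ hσ y
  have hh := one_le_height y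
  have ht := norm_nonneg t
  have h1 : ‖t • hyp σ y - W‖ ≤ ‖t‖ * (c * height y) + ‖W‖ :=
    (norm_sub_le _ _).trans (by rw [norm_smul]; gcongr)
  have h2 : ‖W‖ ≤ ‖W‖ * ((1 + ‖t‖) * height y) :=
    le_mul_of_one_le_right hW (one_le_mul_of_one_le_of_one_le (by linarith) hh)
  have h3 : 0 ≤ c * height y := by positivity
  calc a * ‖t • hyp σ y - W‖ ≤ a * ((c + ‖W‖) * ((1 + ‖t‖) * height y)) := by
        gcongr
        linarith
    _ = _ := by ring

lemma norm_adj_sub_mul_hyp_mul_adj_le (W : HC) : ∃ c : ℝ, 0 < c ∧ ∀ (t : ℂ) (σ : ℝ), σ ^ 2 = 1 →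
    ∀ y, ‖adj (t • hyp σ y - W) * hyp σ y * adj (1 - t • hyp σ y)‖ ≤
      c * (1 + ‖t‖) ^ 2 * height y := by
  obtain ⟨c, hc, hYc⟩ := norm_hyp_le
  obtain ⟨a, ha, hac⟩ := norm_adj_le
  have hW := norm_nonneg W
  have hn := norm_nonneg (1 : HC)
  refine ⟨a * c + ‖(1 : HC)‖ + (a * ‖W‖) * c + a * ‖W‖, by positivity, fun t σ hσ y => ?_⟩
  rw [adj_sub_mul_hyp_mul_adj hσ]
  have hY := hYc σ hσ y
  have hh := one_le_height y
  have ht := norm_nonneg t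
  have e1 : ‖t ^ 2 • adj (hyp σ y)‖ ≤ ‖t‖ ^ 2 * (a * (c * height y)) := by
    rw [norm_smul, norm_pow]
    gcongr
    exact (hac _).trans (by gcongr)
  have e2 : ‖t • (1 : HC)‖ = ‖t‖ * ‖(1 : HC)‖ := norm_smul _ _
  have e3 : ‖adj W * hyp σ y‖ ≤ (a * ‖W‖) * (c * height y) :=
    (norm_mul_le _ _).trans (mul_le_mul (hac W) hY (norm_nonneg _) (by positivity))
  have e4 : ‖t • adj W‖ ≤ ‖t‖ * (a * ‖W‖) := by
    rw [norm_smul]; gcongr; exact hac W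
  have e5 : ‖t‖ ^ 2 ≤ (1 + ‖t‖) ^ 2 := by gcongr; linarith
  have e7 : 1 ≤ (1 + ‖t‖) ^ 2 := one_le_pow₀ (by linarith)
  have e6 : ‖t‖ ≤ (1 + ‖t‖) ^ 2 * height y :=
    calc ‖t‖ ≤ (1 + ‖t‖) ^ 2 := by nlinarith only [ht]
      _ ≤ _ := le_mul_of_one_le_right (by positivity) hh
  calc _ ≤ ‖t‖ ^ 2 * (a * (c * height y)) + ‖t‖ * ‖(1 : HC)‖ + (a * ‖W‖) * (c * height y) +
        ‖t‖ * (a * ‖W‖) := by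
        refine (norm_sub_le _ _).trans (add_le_add ((norm_sub_le _ _).trans
          (add_le_add ((norm_sub_le _ _).trans (add_le_add e1 e2.le)) e3)) e4)
    _ ≤ (1 + ‖t‖) ^ 2 * (a * (c * height y)) + (1 + ‖t‖) ^ 2 * height y * ‖(1 : HC)‖ +
        (1 + ‖t‖) ^ 2 * ((a * ‖W‖) * (c * height y)) +
        (1 + ‖t‖) ^ 2 * height y * (a * ‖W‖) := by
        have : 0 ≤ (a * ‖W‖) * (c * height y) := by positivity
        have := le_mul_of_one_le_left this e7
        gcongr
    _ = _ := by ring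

/-- The constant in the lower bound of `|N(1 - t Y)|`. -/
noncomputable def decayConst (t : ℂ) : ℝ := ((1 + ‖t‖) / t.re + 1) ^ 2

lemma continuousOn_decayConst (κ : ℝ) : ContinuousOn decayConst (sector κ) := by
  unfold decayConst
  refine ((ContinuousOn.div ?_ continuous_re.continuousOn fun t ht => ht.1.ne').add
    continuousOn_const).pow 2
  exact (continuous_const.add continuous_norm).continuousOn

/-- Here N(1 - tY)⁻² is of order height⁻² and adj(1 - tY) of order height, whence the first bound.
The two additional growing factors in the second bound cost nothing, by `adj_sub_mul_hyp_mul_adj`.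
-/
lemma ConeRegular.decay {φ : HC → HC} {κ : ℝ} (hφ : ConeRegular φ κ) (W : HC) :
    ∃ C : ℝ, 0 < C ∧ ∀ t ∈ sector κ, ∀ σ : ℝ, σ ^ 2 = 1 → ∀ y,
      ‖φ (t • hyp σ y)‖ ≤ C * ((1 + ‖t‖) ^ 2 * decayConst t ^ 2) * (height y)⁻¹ ∧
      ‖adj (t • hyp σ y - W) * hyp σ y * φ (t • hyp σ y)‖ ≤
        C * ((1 + ‖t‖) ^ 2 * decayConst t ^ 2) * (height y)⁻¹ := by
  obtain ⟨C, hC⟩ := hφ.bound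
  obtain ⟨c₁, hc₁, h₁⟩ := norm_adj_sub_le 1
  obtain ⟨c₂, hc₂, h₂⟩ := norm_adj_sub_mul_hyp_mul_adj_le W
  refine ⟨(c₁ + c₂) * (|C| + 1), by positivity, fun t ht σ hσ y => ?_⟩
  obtain ⟨Φ, hΦ, heq⟩ := hC t ht σ hσ y
  have hΦ' : ‖Φ‖ ≤ |C| + 1 := hΦ.trans ((le_abs_self C).trans (by linarith))
  have hh := height_pos y
  have hdn : ‖(1 - t • hyp σ y).det⁻¹ ^ 2‖ ≤ decayConst t ^ 2 * (height y)⁻¹ ^ 2 := by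
    have hdet := height_le_det_one_sub ht.1 hσ y
    have hpos : 0 < ‖(1 - t • hyp σ y).det‖ := by
      by_contra hneg
      have : ‖(1 - t • hyp σ y).det‖ = 0 := le_antisymm (not_lt.1 hneg) (norm_nonneg _)
      rw [this, mul_zero] at hdet
      linarith
    rw [norm_pow, norm_inv, ← mul_pow]
    refine pow_le_pow_left₀ (by positivity) ?_ 2
    rw [← div_eq_mul_inv, le_div_iff₀ hh, inv_mul_le_iff₀ hpos, mul_comm]
    exact hdet
  have key : ∀ X : HC, ‖X‖ ≤ (c₁ + c₂) * (1 + ‖t‖) ^ 2 * height y →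
      ‖((1 - t • hyp σ y).det⁻¹ ^ 2) • (X * Φ)‖ ≤
        (c₁ + c₂) * (|C| + 1) * ((1 + ‖t‖) ^ 2 * decayConst t ^ 2) * (height y)⁻¹ := by
    intro X hX
    rw [norm_smul]
    calc _ ≤ (decayConst t ^ 2 * (height y)⁻¹ ^ 2) *
          (((c₁ + c₂) * (1 + ‖t‖) ^ 2 * height y) * (|C| + 1)) := by
          gcongr
          exact (norm_mul_le _ _).trans (by gcongr)
      _ = _ := by field_simp
  refine ⟨?_, ?_⟩
  · rw [heq]
    refine key _ ?_
    rw [← neg_sub, map_neg, norm_neg]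
    refine (h₁ t σ hσ y).trans ?_
    have h1 : c₁ ≤ c₁ + c₂ := by linarith
    have h2 : 1 + ‖t‖ ≤ (1 + ‖t‖) ^ 2 := le_self_pow₀ (by linarith [norm_nonneg t]) two_ne_zero
    gcongr
  · rw [heq, mul_smul_comm, ← mul_assoc]
    refine key _ ((h₂ t σ hσ y).trans ?_)
    have h1 : c₂ ≤ c₁ + c₂ := by linarith
    gcongr

/-- A quantitative form of `N(t Y - Y₀) ≠ 0` for `t ∈ T` and `Y` on the sheet `σ`. -/
def Avoids (Y₀ : HC) (σ : ℝ) (T : Set ℂ) : Prop :=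
  ∃ k : ℂ → ℝ, ContinuousOn k T ∧ ∀ t ∈ T, ∀ y, height y ≤ k t * ‖(t • hyp σ y - Y₀).det‖

lemma Avoids.det_ne_zero {Y₀ : HC} {σ : ℝ} {T : Set ℂ} (h : Avoids Y₀ σ T) {t : ℂ} (ht : t ∈ T)
    (y : Fin 3 → ℝ) : (t • hyp σ y - Y₀).det ≠ 0 := by
  obtain ⟨k, _, hk⟩ := h
  intro h0
  have := hk t ht y
  rw [h0, norm_zero, mul_zero] at this
  linarith [height_pos y]

lemma norm_inv_det_le {Y₀ : HC} {σ k : ℝ} {t : ℂ} {y : Fin 3 → ℝ}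
    (h : height y ≤ k * ‖(t • hyp σ y - Y₀).det‖) :
    ‖(t • hyp σ y - Y₀).det⁻¹ ^ 2‖ ≤ k ^ 2 * (height y)⁻¹ ^ 2 := by
  have hh := height_pos y
  have hpos : 0 < ‖(t • hyp σ y - Y₀).det‖ := by
    by_contra hneg
    have : ‖(t • hyp σ y - Y₀).det‖ = 0 := le_antisymm (not_lt.1 hneg) (norm_nonneg _)
    rw [this, mul_zero] at h
    linarith
  rw [norm_pow, norm_inv, ← mul_pow]
  refine pow_le_pow_left₀ (by positivity) ?_ 2
  rw [← div_eq_mul_inv, le_div_iff₀ hh, inv_mul_le_iff₀ hpos, mul_comm]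
  exact h

/-- Orders in `coeff`: height⁻¹ from the prefactor, height⁻² from N(tY - Y₀)⁻² and height⁻¹ from the
second bound of `ConeRegular.decay`. In `flux` the term with eᵢ has three factors of order height⁻¹,
and the term with yᵢY loses one order against `coeff`. Order -4 is integrable on ℝ³, and order -3
beats the area of large cube faces. -/
lemma ConeRegular.coeff_bound {φ : HC → HC} {κ : ℝ} (hφ : ConeRegular φ κ) {Y₀ : HC} {σ : ℝ}
    (hσ : σ ^ 2 = 1) {T : Set ℂ} (hT : T ⊆ sector κ) (hA : Avoids Y₀ σ T) :
    (∃ M : ℂ → ℝ, ContinuousOn M T ∧ ∀ t ∈ T, ∀ y,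
      ‖coeff Y₀ φ σ t y‖ ≤ M t * (height y)⁻¹ ^ 4) ∧
    ∀ t ∈ T, ∃ C : ℝ, ∀ i y, ‖flux Y₀ φ σ t i y‖ ≤ C * (height y)⁻¹ ^ 3 := by
  obtain ⟨C, hC0, hC⟩ := hφ.decay Y₀
  obtain ⟨c, hc0, hc⟩ := norm_adj_sub_le Y₀
  obtain ⟨k, hk, hN⟩ := hA
  have hns : ‖(σ : ℂ)‖ = 1 := by rw [norm_real, Real.norm_eq_abs, abs_eq_one_of_sq hσ]
  have hpre : ∀ (t : ℂ) (n : ℕ) y, ‖I * σ * t ^ n / height y‖ = ‖t‖ ^ n * (height y)⁻¹ := by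
    intro t n y
    rw [norm_div, norm_mul, norm_mul, norm_I, hns, norm_pow, norm_real,
      Real.norm_of_nonneg (height_pos y).le, one_mul, one_mul, div_eq_mul_inv]
  have hKY : ∀ t ∈ T, ∀ y, ‖kernel Y₀ (t • hyp σ y) * hyp σ y * φ (t • hyp σ y)‖ ≤
      k t ^ 2 * (C * ((1 + ‖t‖) ^ 2 * decayConst t ^ 2)) * (height y)⁻¹ ^ 3 := by
    intro t ht y
    have hh := height_pos y
    rw [kernel, smul_mul_assoc, smul_mul_assoc, norm_smul]
    calc _ ≤ (k t ^ 2 * (height y)⁻¹ ^ 2) *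
          (C * ((1 + ‖t‖) ^ 2 * decayConst t ^ 2) * (height y)⁻¹) := by
          gcongr
          · exact norm_inv_det_le (hN t ht y)
          · exact (hC t (hT ht) σ hσ y).2
      _ = _ := by ring
  refine ⟨⟨fun t => ‖t‖ ^ 3 * (k t ^ 2 * (C * ((1 + ‖t‖) ^ 2 * decayConst t ^ 2))), ?_,
    fun t ht y => ?_⟩, fun t ht => ?_⟩
  · have h1 := (continuousOn_decayConst κ).mono hT
    have h2 : ContinuousOn (fun t : ℂ => ‖t‖) T := continuous_norm.continuousOn
    exact (h2.pow 3).mul ((hk.pow 2).mul (continuousOn_const.mul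
      (((continuousOn_const.add h2).pow 2).mul (h1.pow 2))))
  · have hh := height_pos y
    rw [coeff, norm_smul, hpre]
    calc _ ≤ (‖t‖ ^ 3 * (height y)⁻¹) *
          (k t ^ 2 * (C * ((1 + ‖t‖) ^ 2 * decayConst t ^ 2)) * (height y)⁻¹ ^ 3) := by
          gcongr; exact hKY t ht y
      _ = _ := by ring
  · set m := C * ((1 + ‖t‖) ^ 2 * decayConst t ^ 2) with hm
    have hm0 : 0 ≤ m := by positivity
    set ee := ‖e 1‖ + ‖e 2‖ + ‖e 3‖ with hee
    have hei : ∀ i : Fin 3, ‖e i.succ‖ ≤ ee := by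
      have h1 := norm_nonneg (e 1)
      have h2 := norm_nonneg (e 2)
      have h3 := norm_nonneg (e 3)
      intro i
      fin_cases i
      · show ‖e 1‖ ≤ ee; linarith
      · show ‖e 2‖ ≤ ee; linarith
      · show ‖e 3‖ ≤ ee; linarith
    have hee0 : 0 ≤ ee := by positivity
    refine ⟨‖t‖ ^ 2 * (k t ^ 2 * (c * (1 + ‖t‖)) * ee * m) + ‖t‖ ^ 2 * (k t ^ 2 * m), fun i y => ?_⟩
    have hh := height_pos y
    have d1 := (hC t (hT ht) σ hσ y).1
    have d3 := hc t σ hσ y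
    have hK : ‖kernel Y₀ (t • hyp σ y)‖ ≤ k t ^ 2 * (c * (1 + ‖t‖)) * (height y)⁻¹ := by
      rw [kernel, norm_smul]
      calc _ ≤ (k t ^ 2 * (height y)⁻¹ ^ 2) * (c * (1 + ‖t‖) * height y) := by
            gcongr
            exact norm_inv_det_le (hN t ht y)
        _ = _ := by field_simp
    have hf : flux Y₀ φ σ t i y = (I * σ * t ^ 2 / height y) •
        (kernel Y₀ (t • hyp σ y) * e i.succ * φ (t • hyp σ y)) +
        (I * σ * t ^ 2 / height y) • ((y i : ℂ) •
          (kernel Y₀ (t • hyp σ y) * hyp σ y * φ (t • hyp σ y))) := by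
      rw [flux, ← smul_add]
      simp only [mul_add, add_mul, mul_smul_comm, smul_mul_assoc]
    have hyi : ‖(y i : ℂ)‖ ≤ height y := by rw [norm_real]; exact abs_le_height y i
    rw [hf]
    refine (norm_add_le _ _).trans ?_
    rw [norm_smul, norm_smul, norm_smul, hpre, add_mul]
    refine add_le_add ?_ ?_
    · calc _ ≤ (‖t‖ ^ 2 * (height y)⁻¹) * ((k t ^ 2 * (c * (1 + ‖t‖)) * (height y)⁻¹) * ee *
            (m * (height y)⁻¹)) := by
            gcongr
            refine (norm_mul_le _ _).trans (mul_le_mul ((norm_mul_le _ _).trans ?_) d1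
              (norm_nonneg _) (by positivity))
            exact mul_le_mul hK (hei i) (norm_nonneg _) (by positivity)
        _ = _ := by ring
    · calc _ ≤ (‖t‖ ^ 2 * (height y)⁻¹) * (height y * (k t ^ 2 * m * (height y)⁻¹ ^ 3)) := by
            gcongr
            exact hKY t ht y
        _ = _ := by field_simp

/-! ### Independence of the integral from t -/

lemma ConeRegular.hasFDerivAt {φ : HC → HC} {κ : ℝ} (hφ : ConeRegular φ κ) {t : ℂ}
    (ht : t ∈ sector κ) {σ : ℝ} (hσ : σ ^ 2 = 1) (y : Fin 3 → ℝ) :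
    ∃ B : HC →L[ℂ] HC, HasFDerivAt φ B (t • hyp σ y) ∧
      B 1 + (e 1 * B (e 1) + e 2 * B (e 2) + e 3 * B (e 3)) = 0 :=
  ⟨_, (hφ.diff t ht σ hσ y).hasFDerivAt, hφ.regular t ht σ hσ y⟩

lemma ConeRegular.continuous_comp {φ : HC → HC} {κ : ℝ} (hφ : ConeRegular φ κ) {t : ℂ}
    (ht : t ∈ sector κ) {σ : ℝ} (hσ : σ ^ 2 = 1) : Continuous fun y => φ (t • hyp σ y) :=
  continuous_iff_continuousAt.2 fun y => ContinuousAt.comp (g := φ)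
    (hφ.diff t ht σ hσ y).continuousAt ((continuous_hyp σ).const_smul t).continuousAt

lemma ConeRegular.continuous_coeff {φ : HC → HC} {κ : ℝ} (hφ : ConeRegular φ κ) {Y₀ : HC} {t : ℂ}
    (ht : t ∈ sector κ) {σ : ℝ} (hσ : σ ^ 2 = 1)
    (hN : ∀ y, (t • hyp σ y - Y₀).det ≠ 0) : Continuous (coeff Y₀ φ σ t) := by
  have h1 := hφ.continuous_comp ht hσ
  have h2 := continuous_hyp σ
  have h3 : Continuous fun y => kernel Y₀ (t • hyp σ y) := by
    have h4 : Continuous fun y => t • hyp σ y - Y₀ := (h2.const_smul t).sub continuous_const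
    exact ((h4.matrix_det.inv₀ hN).pow 2).smul (adj.continuous.comp h4)
  exact (continuous_const.div (continuous_ofReal.comp continuous_height) height_ne).smul
    ((h3.mul h2).mul h1)

/-- Cauchy's theorem: the integral over `t H₁` does not depend on `t`. -/
lemma ConeRegular.integral_coeff_eq {φ : HC → HC} {κ : ℝ} (hφ : ConeRegular φ κ) {Y₀ : HC}
    {σ : ℝ} (hσ : σ ^ 2 = 1) {T : Set ℂ} (hTo : IsOpen T) (hTc : IsPreconnected T)
    (hT : T ⊆ sector κ) (hA : Avoids Y₀ σ T) :
    (∀ t ∈ T, Integrable (coeff Y₀ φ σ t)) ∧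
      ∀ t ∈ T, ∀ t' ∈ T, ∫ y, coeff Y₀ φ σ t y = ∫ y, coeff Y₀ φ σ t' y := by
  obtain ⟨⟨M, hMc, hM⟩, hV⟩ := hφ.coeff_bound hσ hT hA
  have hcont : ∀ t ∈ T, Continuous (coeff Y₀ φ σ t) := fun t ht =>
    hφ.continuous_coeff (hT ht) hσ fun y => hA.det_ne_zero ht y
  have hder : ∀ t ∈ T, ∀ y, (∀ i, DifferentiableAt ℝ (flux Y₀ φ σ t i) y) ∧
      HasDerivAt (fun t : ℂ => coeff Y₀ φ σ t y)
        (∑ i, fderiv ℝ (flux Y₀ φ σ t i) y (Pi.single i 1)) t := by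
    intro t ht y
    obtain ⟨B, hB, hB0⟩ := hφ.hasFDerivAt (hT ht) hσ y
    exact hasDerivAt_coeff_eq_div hσ Y₀ φ t y (hA.det_ne_zero ht y) hB hB0
  have hint : ∀ t ∈ T, Integrable (fun y => deriv (fun t => coeff Y₀ φ σ t y) t) ∧
      HasDerivAt (fun t => ∫ y, coeff Y₀ φ σ t y) (∫ y, deriv (fun t => coeff Y₀ φ σ t y) t) t := by
    intro t ht
    refine hasDerivAt_integral_of_differentiableOn hTo
      (fun t ht => (hcont t ht).aestronglyMeasurable)
      (fun y t ht => (hder t ht y).2.differentiableAt.differentiableWithinAt) ht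
      -- By continuity M < M t + 1 near t, which makes the domination locally uniform.
      (b := fun y => (M t + 1) * (height y)⁻¹ ^ 4) (integrable_height_pow.const_mul _) ?_
    filter_upwards [hTo.mem_nhds ht, (hMc.continuousAt (hTo.mem_nhds ht)).eventually_le_const
      (lt_add_one _)] with s hs hs' y
    have := height_pos y
    exact (hM s hs y).trans (by gcongr)
  refine ⟨fun t ht => ?_, fun t ht t' ht' => ?_⟩
  · exact (integrable_height_pow.const_mul (M t)).mono' (hcont t ht).aestronglyMeasurable
      (Eventually.of_forall fun y => hM t ht y)
  · refine hTo.is_const_of_deriv_eq_zero hTc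
      (fun t ht => (hint t ht).2.differentiableAt.differentiableWithinAt) (fun t ht => ?_) ht ht'
    obtain ⟨C, hC⟩ := hV t ht
    have h1 : (fun y => deriv (fun t => coeff Y₀ φ σ t y) t) =
        fun y => ∑ i, fderiv ℝ (flux Y₀ φ σ t i) y (Pi.single i 1) :=
      funext fun y => (hder t ht y).2.deriv
    rw [(hint t ht).2.deriv, h1]
    exact integral_div_eq_zero (fun i y => (hder t ht y).1 i) hC (h1 ▸ (hint t ht).1)

/-! ### The explicit integrals behind the constant 2π² -/

lemma integral_radial :
    ∫ r in Ioi (0 : ℝ), r ^ 2 * ((1 + r ^ 2)⁻¹ ^ 2) = Real.pi / 4 := by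
  have hd : ∀ r ∈ Ici (0 : ℝ), HasDerivAt (fun r : ℝ => (Real.arctan r - r * (1 + r ^ 2)⁻¹) / 2)
      (r ^ 2 * ((1 + r ^ 2)⁻¹ ^ 2)) r := by
    intro r _
    have h0 : (1 + r ^ 2) ≠ 0 := by positivity
    have h1 : HasDerivAt (fun r : ℝ => 1 + r ^ 2) (2 * r) r := by
      simpa using (hasDerivAt_pow 2 r).const_add 1
    have h2 := ((Real.hasDerivAt_arctan r).sub ((hasDerivAt_id r).mul (h1.inv h0))).div_const 2
    refine (h2.congr_deriv ?_)
    simp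
    field_simp
  have hlim : Tendsto (fun r : ℝ => (Real.arctan r - r * (1 + r ^ 2)⁻¹) / 2) atTop
      (𝓝 ((Real.pi / 2 - 0) / 2)) := by
    refine (Tendsto.sub (tendsto_nhds_of_tendsto_nhdsWithin Real.tendsto_arctan_atTop) ?_).div_const 2
    refine squeeze_zero' (g := fun r => r⁻¹) ?_ ?_ tendsto_inv_atTop_zero
    · filter_upwards [eventually_gt_atTop 0] with r hr using by positivity
    · filter_upwards [eventually_gt_atTop 0] with r hr
      rw [← div_eq_mul_inv, div_le_iff₀ (by positivity)]
      field_simp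
      nlinarith
  have := integral_Ioi_of_hasDerivAt_of_nonneg' hd (fun r _ => by positivity) hlim
  rw [this]
  simp
  ring

/-- In polar coordinates the value is 3 · (4π/3) · (π/4). -/
lemma integral_height_pow : ∫ y : Fin 3 → ℝ, (height y)⁻¹ ^ 4 = Real.pi ^ 2 := by
  have h1 := (EuclideanSpace.volume_preserving_symm_measurableEquiv_toLp (Fin 3)).integral_comp'
    (fun y : Fin 3 → ℝ => (height y)⁻¹ ^ 4)
  rw [← h1]
  have h2 : ∀ x : EuclideanSpace ℝ (Fin 3), (height ((MeasurableEquiv.toLp 2 (Fin 3 → ℝ)).symm x))⁻¹ ^ 4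
      = (1 + ‖x‖ ^ 2)⁻¹ ^ 2 := by
    intro x
    have : height ((MeasurableEquiv.toLp 2 (Fin 3 → ℝ)).symm x) ^ 2 = 1 + ‖x‖ ^ 2 := by
      rw [height, Real.sq_sqrt (by positivity), EuclideanSpace.real_norm_sq_eq]
      rfl
    rw [← this, ← inv_pow, ← pow_mul]
  simp only [h2]
  have h3 := integral_fun_norm_addHaar (volume : Measure (EuclideanSpace ℝ (Fin 3)))
    (fun r : ℝ => (1 + r ^ 2)⁻¹ ^ 2)
  rw [h3, finrank_euclideanSpace_fin, Measure.real, EuclideanSpace.volume_ball_fin_three]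
  simp only [smul_eq_mul, nsmul_eq_mul, Nat.add_one_sub_one]
  rw [integral_radial]
  rw [ENNReal.ofReal_one, one_pow, one_mul, ENNReal.toReal_ofReal (by positivity)]
  push_cast
  ring

/-- The quadratic form of the second order term of `pairing` at `y'`. -/
noncomputable def hessian (y' x : Fin 3 → ℝ) : ℝ :=
  x 0 ^ 2 + x 1 ^ 2 + x 2 ^ 2 - ((y' 0 * x 0 + y' 1 * x 1 + y' 2 * x 2) / height y') ^ 2

/-- With s the height of y', the form has matrix 1 - y'y'ᵀ/s². Its positive square root A has
determinant s⁻¹, so the substitution z = Ax gives the factor s. Then z = 2w reduces to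
`integral_height_pow`, with total factor 8 · (1/4) = 2. -/
lemma integral_hessian (y' : Fin 3 → ℝ) :
    ∫ x, 4 / (hessian y' x + 4) ^ 2 = 2 * Real.pi ^ 2 * height y' := by
  have hh := height_pos y'
  have hsq := height_sq y'
  set s := height y'
  set A : Matrix (Fin 3) (Fin 3) ℝ := 1 - (s * (s + 1))⁻¹ • Matrix.vecMulVec y' y' with hA
  have hdet : A.det = s⁻¹ := by
    have h1 : A.det = 1 - (s * (s + 1))⁻¹ * (y' 0 ^ 2 + y' 1 ^ 2 + y' 2 ^ 2) := by
      rw [hA]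
      generalize (s * (s + 1))⁻¹ = c
      rw [Matrix.det_fin_three]
      simp [Matrix.vecMulVec_apply]
      ring
    rw [h1, show y' 0 ^ 2 + y' 1 ^ 2 + y' 2 ^ 2 = s ^ 2 - 1 by linarith]
    field_simp
    ring
  have hq : ∀ x, hessian y' x = height (A.toLin' x) ^ 2 - 1 := by
    intro x
    have h1 : ∀ j, A.toLin' x j = x j - (s * (s + 1))⁻¹ *
        (y' 0 * x 0 + y' 1 * x 1 + y' 2 * x 2) * y' j := by
      intro j
      rw [hA]
      generalize (s * (s + 1))⁻¹ = c
      simp [Matrix.vecMulVec_apply, Matrix.mulVec, dotProduct, Fin.sum_univ_three]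
      fin_cases j <;> simp <;> ring
    rw [height_sq, hessian, h1, h1, h1]
    change _ - (_ / s) ^ 2 = _
    set d := y' 0 * x 0 + y' 1 * x 1 + y' 2 * x 2 with hd
    have h2 : (s⁻¹) ^ 2 = 2 * (s * (s + 1))⁻¹ - (s * (s + 1))⁻¹ ^ 2 * (s ^ 2 - 1) := by
      field_simp; ring
    rw [div_eq_mul_inv, mul_pow, h2, hsq, hd]
    ring
  have h1 : ∫ x, 4 / (hessian y' x + 4) ^ 2 =
      ∫ x, (fun z => 4 / (height z ^ 2 + 3) ^ 2) (A.toLin' x) := by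
    congr 1; funext x; rw [hq]; ring_nf
  have hmap := Real.map_matrix_volume_pi_eq_smul_volume_pi (M := A) (by rw [hdet]; positivity)
  have hcont : Continuous fun z : Fin 3 → ℝ => 4 / (height z ^ 2 + 3) ^ 2 :=
    continuous_const.div (((continuous_height.pow 2).add continuous_const).pow 2)
      fun z => by positivity
  have h2 := integral_map (μ := volume) (φ := A.toLin')
    (LinearMap.continuous_of_finiteDimensional A.toLin').aemeasurable
    (f := fun z : Fin 3 → ℝ => 4 / (height z ^ 2 + 3) ^ 2) hcont.aestronglyMeasurable
  rw [h1, ← h2, hmap, integral_smul_measure, hdet, inv_inv, abs_of_pos hh,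
    ENNReal.toReal_ofReal hh.le, smul_eq_mul]
  have h3 := Measure.integral_comp_smul (volume : Measure (Fin 3 → ℝ))
    (fun z => 4 / (height z ^ 2 + 3) ^ 2) 2
  have h4 : ∀ z : Fin 3 → ℝ, 4 / (height ((2 : ℝ) • z) ^ 2 + 3) ^ 2 = 4⁻¹ * (height z)⁻¹ ^ 4 := by
    intro z
    have h5 : height ((2 : ℝ) • z) ^ 2 + 3 = 4 * height z ^ 2 := by
      rw [height_sq, height_sq]; simp; ring
    have := height_pos z
    rw [h5]; field_simp
  simp only [h4] at h3
  rw [integral_const_mul, integral_height_pow] at h3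
  rw [abs_of_pos (by positivity), Module.finrank_pi, Fintype.card_fin, smul_eq_mul] at h3
  have h6 : ∫ x : Fin 3 → ℝ, 4 / (height x ^ 2 + 3) ^ 2 = 2 * Real.pi ^ 2 := by linarith
  rw [h6]; ring

/-! ### The jump across the positive real axis -/

lemma mul_self_eq_one {σ : ℝ} (hσ : σ ^ 2 = 1) : σ * σ = 1 := by rw [← sq, hσ]

/-- Both sides are N(Y - Y'). -/
lemma pairing_sub_one_eq {σ : ℝ} (hσ : σ ^ 2 = 1) (y y' : Fin 3 → ℝ) :
    2 * (pairing σ σ y y' - 1) = (y 0 - y' 0) ^ 2 + (y 1 - y' 1) ^ 2 + (y 2 - y' 2) ^ 2 -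
      (height y - height y') ^ 2 := by
  rw [pairing, mul_self_eq_one hσ]
  linear_combination height_sq y + height_sq y'

/-- A global form of the quadratic growth of g - 1 at y', needed for domination. With s, s' the
heights and N = |y - y'|², Cauchy–Schwarz for s² - s'² = (y - y')·(y + y') yields N(1 + g) ≤ (g -
1)(s + s')². Then 1 + g is at least gap·s, and s + s' is at most s(1 + s'). -/
lemma pairing_sub_one_ge {σ : ℝ} (hσ : σ ^ 2 = 1) (y y' : Fin 3 → ℝ) :
    gap y' / (1 + height y') ^ 2 *
      ((y 0 - y' 0) ^ 2 + (y 1 - y' 1) ^ 2 + (y 2 - y' 2) ^ 2) / height y ≤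
      pairing σ σ y y' - 1 := by
  have h1 := pairing_sub_one_eq hσ y y'
  have h2 : gap y' * height y ≤ pairing σ σ y y' :=
    (le_max_right _ _).trans (pairing_ge (mul_self_eq_one hσ) y y')
  have hg := gap_pos y'
  have hs := one_le_height y
  have hs' := one_le_height y'
  have hsq := height_sq y
  have hsq' := height_sq y'
  have hp : pairing σ σ y y' = height y * height y' - (y 0 * y' 0 + y 1 * y' 1 + y 2 * y' 2) := by
    rw [pairing, mul_self_eq_one hσ, one_mul]
  set g := pairing σ σ y y'
  set s := height y
  set s' := height y'
  set N := (y 0 - y' 0) ^ 2 + (y 1 - y' 1) ^ 2 + (y 2 - y' 2) ^ 2 with hN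
  have hN0 : 0 ≤ N := by positivity
  have hcs : (s ^ 2 - s' ^ 2) ^ 2 ≤ N * ((s + s') ^ 2 - 2 - 2 * g) := by
    have e1 : s ^ 2 - s' ^ 2 = (y 0 - y' 0) * (y 0 + y' 0) + (y 1 - y' 1) * (y 1 + y' 1) +
        (y 2 - y' 2) * (y 2 + y' 2) := by rw [hsq, hsq']; ring
    have e2 : (s + s') ^ 2 - 2 - 2 * g = (y 0 + y' 0) ^ 2 + (y 1 + y' 1) ^ 2 +
        (y 2 + y' 2) ^ 2 := by
      rw [hp]; linear_combination hsq + hsq'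
    rw [e1, e2, hN]
    nlinarith only [sq_nonneg ((y 0 - y' 0) * (y 1 + y' 1) - (y 1 - y' 1) * (y 0 + y' 0)),
      sq_nonneg ((y 0 - y' 0) * (y 2 + y' 2) - (y 2 - y' 2) * (y 0 + y' 0)),
      sq_nonneg ((y 1 - y' 1) * (y 2 + y' 2) - (y 2 - y' 2) * (y 1 + y' 1))]
  have hmain : N * (1 + g) ≤ (g - 1) * (s + s') ^ 2 := by
    have e3 : 2 * ((g - 1) * (s + s') ^ 2) = N * (s + s') ^ 2 - (s ^ 2 - s' ^ 2) ^ 2 := by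
      rw [← mul_assoc, h1]; ring
    linarith
  have hg1 : 0 ≤ g - 1 := by
    have : 0 ≤ (g - 1) * (s + s') ^ 2 :=
      le_trans (mul_nonneg hN0 (by nlinarith only [h2, hg, hs])) hmain
    exact nonneg_of_mul_nonneg_left this (by positivity)
  have hle : (s + s') ^ 2 ≤ (s * (1 + s')) ^ 2 := by
    gcongr; nlinarith only [hs, hs']
  rw [div_le_iff₀ (by positivity), div_mul_eq_mul_div, div_le_iff₀ (by positivity)]
  have e4 : N * (gap y' * s) ≤ ((g - 1) * (s * (1 + s') ^ 2)) * s :=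
    calc N * (gap y' * s) ≤ N * (1 + g) := by gcongr; linarith
      _ ≤ (g - 1) * (s * (1 + s')) ^ 2 := hmain.trans (by gcongr)
      _ = _ := by ring
  have e5 : (gap y' * N) * s ≤ ((g - 1) * (s * (1 + s') ^ 2)) * s := by linarith
  have := le_of_mul_le_mul_right e5 (by linarith)
  linarith

/-- A rational parametrization of the circle of radius `ρ`. -/
noncomputable def arc (ρ η : ℝ) : ℂ := ρ * ((1 + I * η) / (1 - I * η))

lemma one_sub_I_mul_ne (η : ℝ) : (1 - I * η : ℂ) ≠ 0 := by
  intro h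
  have := congrArg Complex.re h
  simp at this

lemma arc_zero (ρ : ℝ) : arc ρ 0 = ρ := by simp [arc]

lemma arc_eq (ρ η : ℝ) : arc ρ η = ((ρ * (1 - η ^ 2) / (1 + η ^ 2) : ℝ) : ℂ) +
    ((2 * ρ * η / (1 + η ^ 2) : ℝ) : ℂ) * I := by
  have h := one_sub_I_mul_ne η
  have h2 : (1 + (η : ℂ) ^ 2) ≠ 0 := by exact_mod_cast (by positivity : (1 + η ^ 2) ≠ 0)
  rw [arc]
  push_cast
  field_simp
  linear_combination 2 * ρ * η ^ 2 * I_sq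

lemma arc_im (ρ η : ℝ) : (arc ρ η).im = 2 * ρ * η / (1 + η ^ 2) := by
  rw [arc_eq, add_im, ofReal_im, zero_add, im_ofReal_mul, I_im, mul_one]


lemma arc_ne_zero {ρ : ℝ} (hρ : 0 < ρ) (η : ℝ) : arc ρ η ≠ 0 := by
  have h1 : (1 + I * η : ℂ) ≠ 0 := by
    have := one_sub_I_mul_ne (-η)
    simpa using this
  exact mul_ne_zero (ofReal_ne_zero.2 hρ.ne') (div_ne_zero h1 (one_sub_I_mul_ne η))

lemma hasDerivAt_arc (ρ : ℝ) : HasDerivAt (arc ρ) (2 * I * ρ) 0 := by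
  have h1 : HasDerivAt (fun η : ℝ => I * (η : ℂ)) I 0 := by
    simpa using (Complex.ofRealCLM.hasDerivAt (x := 0)).const_mul I
  have h2 := ((h1.const_add 1).div (h1.const_sub 1) (by simp)).const_mul (ρ : ℂ)
  refine h2.congr_deriv ?_
  simp
  ring

lemma continuous_arc (ρ : ℝ) : Continuous (arc ρ) := by
  have h1 : Continuous fun η : ℝ => I * (η : ℂ) := continuous_const.mul continuous_ofReal
  exact continuous_const.mul ((continuous_const.add h1).div (continuous_const.sub h1)
    one_sub_I_mul_ne)

/-- The scalar factor of `N(t Y - Y₀)` on the circle `|t| = ρ`. -/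
noncomputable def denom (σ : ℝ) (y' : Fin 3 → ℝ) (η : ℝ) (y : Fin 3 → ℝ) : ℝ :=
  pairing σ σ y y' - 1 + 2 * η ^ 2 / (1 + η ^ 2)

lemma denom_pos {σ : ℝ} (hσ : σ ^ 2 = 1) (y' : Fin 3 → ℝ) {η : ℝ} (hη : η ≠ 0) (y : Fin 3 → ℝ) :
    0 < denom σ y' η y := by
  have h1 : 1 ≤ pairing σ σ y y' := (le_max_left _ _).trans (pairing_ge (mul_self_eq_one hσ) y y')
  have : 0 < 2 * η ^ 2 / (1 + η ^ 2) := by positivity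
  rw [denom]; linarith

/-- For t = ρe^{iθ} one has t² + ρ² = 2ρt cos θ, and cos θ = (1 - η²)/(1 + η²) for η = tan(θ/2). The
remaining factor is real and even in η, so both sides of the axis share it. -/
lemma det_arc {σ : ℝ} (hσ : σ ^ 2 = 1) (ρ η : ℝ) (y y' : Fin 3 → ℝ) :
    (arc ρ η • hyp σ y - (ρ : ℂ) • hyp σ y').det = 2 * ρ * arc ρ η * denom σ y' η y := by
  have h2 : (1 + (η : ℂ) ^ 2) ≠ 0 := by exact_mod_cast (by positivity : (1 + η ^ 2) ≠ 0)
  rw [det_smul_hyp_sub hσ hσ, denom, arc]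
  generalize pairing σ σ y y' = g
  push_cast
  have h3 : (1 + I * η : ℂ) = 2 - (1 - I * η) := by ring
  have h4 : (η : ℂ) ^ 2 = (1 - I * η) * (2 - (1 - I * η)) - 1 := by linear_combination η ^ 2 * I_sq
  have h5 : (1 - I * η : ℂ) * (2 - (1 - I * η)) ≠ 0 := by
    rw [h4] at h2
    intro h5
    exact h2 (by rw [h5]; ring)
  rw [h3, h4]
  generalize (1 - I * η : ℂ) = v at h5 ⊢
  have h6 := left_ne_zero_of_mul h5
  have h7 := right_ne_zero_of_mul h5
  rw [add_sub_cancel]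
  field_simp
  ring

/-- The numerator of `coeff`. -/
noncomputable def numer (Y₀ : HC) (φ : HC → HC) (σ : ℝ) (t : ℂ) (y : Fin 3 → ℝ) : HC :=
  t • (adj (t • hyp σ y - Y₀) * hyp σ y * φ (t • hyp σ y))

lemma coeff_arc {σ : ℝ} (hσ : σ ^ 2 = 1) {ρ : ℝ} (hρ : 0 < ρ) (φ : HC → HC) (η : ℝ)
    (y y' : Fin 3 → ℝ) :
    coeff ((ρ : ℂ) • hyp σ y') φ σ (arc ρ η) y =
      (I * σ / (4 * ρ ^ 2 * height y * denom σ y' η y ^ 2)) •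
        numer ((ρ : ℂ) • hyp σ y') φ σ (arc ρ η) y := by
  have h1 := arc_ne_zero hρ η
  have h2 : (ρ : ℂ) ≠ 0 := ofReal_ne_zero.2 hρ.ne'
  rw [coeff, kernel, numer, det_arc hσ, smul_mul_assoc, smul_mul_assoc, smul_smul, smul_smul]
  congr 1
  rw [inv_pow, mul_pow, mul_pow, mul_pow]
  field_simp
  norm_num

lemma ConeRegular.differentiableAt_numer {φ : HC → HC} {κ : ℝ} (hφ : ConeRegular φ κ) (Y₀ : HC)
    {t : ℂ} (ht : t ∈ sector κ) {σ : ℝ} (hσ : σ ^ 2 = 1) (y : Fin 3 → ℝ) :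
    DifferentiableAt ℂ (fun t => numer Y₀ φ σ t y) t := by
  have h1 : DifferentiableAt ℂ (fun t : ℂ => t • hyp σ y) t :=
    differentiableAt_id.smul_const _
  have h2 : DifferentiableAt ℂ (fun t : ℂ => φ (t • hyp σ y)) t :=
    DifferentiableAt.comp (g := φ) t (hφ.diff t ht σ hσ y) h1
  have h3 : DifferentiableAt ℂ (fun t : ℂ => adj (t • hyp σ y - Y₀)) t :=
    DifferentiableAt.comp (g := adj) t adj.differentiableAt (h1.sub_const Y₀)
  exact differentiableAt_id.fun_smul ((h3.mul_const _).fun_mul h2)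

/-- Cauchy's estimate turns the bound height⁻¹ for the holomorphic function `numer` into a Lipschitz
bound in t with the same decay, and the two points of the arc are at distance at most 4ρη. -/
lemma ConeRegular.norm_numer_sub_le {φ : HC → HC} {κ : ℝ} (hκ : 0 < κ) (hφ : ConeRegular φ κ)
    (Y₀ : HC) {σ : ℝ} (hσ : σ ^ 2 = 1) {ρ : ℝ} (hρ : 0 < ρ) :
    ∃ C : ℝ, 0 < C ∧ ∀ᶠ η in 𝓝[>] (0 : ℝ), (arc ρ η ∈ sector κ ∧ arc ρ (-η) ∈ sector κ) ∧
      ∀ y, ‖numer Y₀ φ σ (arc ρ η) y - numer Y₀ φ σ (arc ρ (-η)) y‖ ≤ C * η * (height y)⁻¹ := by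
  obtain ⟨C, hC0, hC⟩ := hφ.decay Y₀
  have hρs : (ρ : ℂ) ∈ sector κ := ⟨by simpa using hρ, by simp; positivity⟩
  set M : ℂ → ℝ := fun t => ‖t‖ * (C * ((1 + ‖t‖) ^ 2 * decayConst t ^ 2)) with hM
  have hMc : ContinuousOn M (sector κ) := by
    have h1 := continuousOn_decayConst κ
    have h2 : ContinuousOn (fun t : ℂ => ‖t‖) (sector κ) := continuous_norm.continuousOn
    exact h2.mul (continuousOn_const.mul (((continuousOn_const.add h2).pow 2).mul (h1.pow 2)))
  have hev : ∀ᶠ t in 𝓝 (ρ : ℂ), t ∈ sector κ ∧ M t ≤ M ρ + 1 :=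
    (show ∀ᶠ t in 𝓝 (ρ : ℂ), t ∈ sector κ from (isOpen_sector κ).mem_nhds hρs).and
      ((hMc.continuousAt ((isOpen_sector κ).mem_nhds hρs)).eventually_le_const (lt_add_one _))
  obtain ⟨r, hr, hball⟩ := Metric.eventually_nhds_iff_ball.1 hev
  have hMρ : 0 ≤ M ρ := by positivity
  have hbd : ∀ t ∈ Metric.ball (ρ : ℂ) r, ∀ y, ‖numer Y₀ φ σ t y‖ ≤ (M ρ + 1) * (height y)⁻¹ := by
    intro t ht y
    have hh := height_pos y
    rw [numer, norm_smul]
    calc _ ≤ ‖t‖ * (C * ((1 + ‖t‖) ^ 2 * decayConst t ^ 2) * (height y)⁻¹) := by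
          gcongr
          exact (hC t (hball t ht).1 σ hσ y).2
      _ = M t * (height y)⁻¹ := by rw [hM]; ring
      _ ≤ _ := by gcongr; exact (hball t ht).2
  refine ⟨(M ρ + 1) / (r / 4) * (4 * ρ), by positivity, ?_⟩
  have hlim : ∀ᶠ η in 𝓝 (0 : ℝ), arc ρ η ∈ Metric.ball (ρ : ℂ) (r / 2) :=
    (continuous_arc ρ).continuousAt.eventually (by
      rw [arc_zero]; exact Metric.ball_mem_nhds _ (by positivity))
  have hlim' : ∀ᶠ η in 𝓝 (0 : ℝ), arc ρ (-η) ∈ Metric.ball (ρ : ℂ) (r / 2) :=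
    ((continuous_arc ρ).comp continuous_neg).continuousAt.eventually (by
      simp only [Function.comp, neg_zero, arc_zero]
      exact Metric.ball_mem_nhds _ (by positivity))
  filter_upwards [nhdsWithin_le_nhds hlim, nhdsWithin_le_nhds hlim', self_mem_nhdsWithin]
    with η h1 h2 (hη : 0 < η)
  have hsub : Metric.ball (ρ : ℂ) (r / 2) ⊆ Metric.ball (ρ : ℂ) r :=
    Metric.ball_subset_ball (by linarith)
  refine ⟨⟨(hball _ (hsub h1)).1, (hball _ (hsub h2)).1⟩, fun y => ?_⟩
  have hd : ∀ t ∈ Metric.ball (ρ : ℂ) r, DifferentiableAt ℂ (fun t => numer Y₀ φ σ t y) t :=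
    fun t ht => hφ.differentiableAt_numer Y₀ (hball t ht).1 hσ y
  have hmv := (convex_ball (ρ : ℂ) (r / 2)).norm_image_sub_le_of_norm_deriv_le
    (fun t ht => hd t (hsub ht)) (fun t ht => norm_deriv_le_of_norm_le_ball hr
      (fun t ht => (hd t ht).differentiableWithinAt) (fun t ht => hbd t ht y) ht) h2 h1
  refine hmv.trans ?_
  have hdist : ‖arc ρ η - arc ρ (-η)‖ ≤ 4 * ρ * η := by
    have h3 : arc ρ η - arc ρ (-η) = ((4 * ρ * η / (1 + η ^ 2) : ℝ) : ℂ) * I := by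
      rw [arc_eq, arc_eq]; push_cast; ring
    rw [h3, norm_mul, norm_I, mul_one, norm_real, Real.norm_of_nonneg (by positivity)]
    exact div_le_self (by positivity) (by nlinarith)
  have hh := height_pos y
  calc _ ≤ (M ρ + 1) * (height y)⁻¹ / (r / 4) * (4 * ρ * η) := by gcongr
    _ = _ := by ring

lemma hessian_nonneg (y' x : Fin 3 → ℝ) : 0 ≤ hessian y' x := by
  have h1 := dot_sq_le y' x
  have h2 := height_pos y'
  have h3 := height_sq x
  have h4 : (y' 0 * x 0 + y' 1 * x 1 + y' 2 * x 2) ^ 2 ≤ (height x ^ 2 - 1) * height y' ^ 2 := by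
    nlinarith [sq_nonneg (x 0), sq_nonneg (x 1), sq_nonneg (x 2)]
  have h5 : ((y' 0 * x 0 + y' 1 * x 1 + y' 2 * x 2) / height y') ^ 2 ≤ height x ^ 2 - 1 := by
    rw [div_pow, div_le_iff₀ (by positivity)]; exact h4
  rw [hessian]; linarith

lemma tendsto_line (y' x : Fin 3 → ℝ) :
    Tendsto (fun η : ℝ => y' + η • x) (𝓝[≠] 0) (𝓝 y') := by
  have : Continuous fun η : ℝ => y' + η • x := by fun_prop
  exact (this.tendsto' 0 y' (by simp)).mono_left nhdsWithin_le_nhds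

lemma tendsto_denom {σ : ℝ} (hσ : σ ^ 2 = 1) (y' x : Fin 3 → ℝ) :
    Tendsto (fun η : ℝ => denom σ y' η (y' + η • x) / η ^ 2) (𝓝[≠] 0)
      (𝓝 ((hessian y' x + 4) / 2)) := by
  obtain ⟨h', hh, hv⟩ := hasFDerivAt_height y'
  have h1 : Tendsto (fun η : ℝ => η⁻¹ * (height (y' + η • x) - height y')) (𝓝[≠] 0)
      (𝓝 ((y' 0 * x 0 + y' 1 * x 1 + y' 2 * x 2) / height y')) := by
    have := hasDerivAt_iff_tendsto_slope_zero.1 (hh.hasLineDerivAt x)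
    rw [hv] at this
    simpa using this
  have h2 : Tendsto (fun η : ℝ => 2 / (1 + η ^ 2)) (𝓝[≠] 0) (𝓝 2) := by
    have : Continuous fun η : ℝ => 2 / (1 + η ^ 2) :=
      continuous_const.div (by fun_prop) fun η => by positivity
    exact (this.tendsto' 0 2 (by simp)).mono_left nhdsWithin_le_nhds
  have h3 := (((h1.pow 2).const_sub (x 0 ^ 2 + x 1 ^ 2 + x 2 ^ 2)).div_const 2).add h2
  have h4 : (x 0 ^ 2 + x 1 ^ 2 + x 2 ^ 2 - ((y' 0 * x 0 + y' 1 * x 1 + y' 2 * x 2) / height y') ^ 2)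
      / 2 + 2 = (hessian y' x + 4) / 2 := by rw [hessian]; ring
  rw [h4] at h3
  refine h3.congr' ?_
  filter_upwards [self_mem_nhdsWithin] with η (hη : η ≠ 0)
  have h5 := pairing_sub_one_eq hσ (y' + η • x) y'
  simp only [Pi.add_apply, Pi.smul_apply, smul_eq_mul, add_sub_cancel_left] at h5
  have h6 : pairing σ σ (y' + η • x) y' - 1 = ((η * x 0) ^ 2 + (η * x 1) ^ 2 + (η * x 2) ^ 2 -
    (height (y' + η • x) - height y') ^ 2) / 2 := by linarith
  rw [denom, h6]
  have h7 : (1 + η ^ 2) ≠ 0 := by positivity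
  field_simp

/-- Since adj(tY - Y₀) vanishes at the base point, only its own derivative survives, and adj(Y')Y' =
-1 gives the sign. The part v comes from moving y and does not involve p; it cancels between the two
arcs. -/
lemma ConeRegular.hasDerivAt_numer {φ : HC → HC} {κ : ℝ} (hκ : 0 < κ) (hφ : ConeRegular φ κ)
    {σ : ℝ} (hσ : σ ^ 2 = 1) {ρ : ℝ} (hρ : 0 < ρ) (y' x : Fin 3 → ℝ) : ∃ v : HC,
    ∀ {p : ℝ → ℂ} {p' : ℂ}, p 0 = ρ → HasDerivAt p p' 0 →
      HasDerivAt (fun η : ℝ => numer ((ρ : ℂ) • hyp σ y') φ σ (p η) (y' + η • x))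
        ((-(ρ * p')) • φ ((ρ : ℂ) • hyp σ y') + v) 0 := by
  obtain ⟨h', hh, -⟩ := hasFDerivAt_hyp σ y'
  have hY : HasDerivAt (fun η : ℝ => hyp σ (y' + η • x)) (h' x) 0 := hh.hasLineDerivAt x
  have hρs : (ρ : ℂ) ∈ sector κ := ⟨by simpa using hρ, by simp; positivity⟩
  refine ⟨((ρ : ℂ) * ρ) • (adj (h' x) * hyp σ y' * φ ((ρ : ℂ) • hyp σ y')), fun {p p'} hp0 hp => ?_⟩
  have y0 : y' + (0 : ℝ) • x = y' := by simp
  have hZ : HasDerivAt (fun η : ℝ => p η • hyp σ (y' + η • x))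
      ((ρ : ℂ) • h' x + p' • hyp σ y') 0 := by
    have := hp.fun_smul hY
    rwa [y0, hp0] at this
  obtain ⟨B, hB, -⟩ := hφ.hasFDerivAt hρs hσ y'
  have hφZ : HasDerivAt (fun η : ℝ => φ (p η • hyp σ (y' + η • x)))
      (B ((ρ : ℂ) • h' x + p' • hyp σ y')) 0 :=
    HasFDerivAt.comp_hasDerivAt (l' := B.restrictScalars ℝ) (l := φ)
      (f := fun η : ℝ => p η • hyp σ (y' + η • x)) (0 : ℝ)
      (by rw [y0, hp0]; exact hB.restrictScalars ℝ) hZ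
  have hadj : HasDerivAt (fun η : ℝ => adj (p η • hyp σ (y' + η • x) - (ρ : ℂ) • hyp σ y'))
      (adj ((ρ : ℂ) • h' x + p' • hyp σ y')) 0 :=
    HasFDerivAt.comp_hasDerivAt (l' := adj.restrictScalars ℝ) (l := adj)
      (f := fun η : ℝ => p η • hyp σ (y' + η • x) - (ρ : ℂ) • hyp σ y') (0 : ℝ)
      (adj.hasFDerivAt.restrictScalars ℝ) (hZ.sub_const _)
  have := hp.fun_smul ((hadj.fun_mul hY).fun_mul hφZ)
  simp only [y0, hp0, sub_self, map_zero, zero_mul, add_zero, smul_zero] at this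
  refine this.congr_deriv ?_
  have h1 := adj_mul_self (hyp σ y')
  rw [det_hyp hσ] at h1
  rw [map_add, map_smul, map_smul, add_mul, smul_mul_assoc, smul_mul_assoc, h1]
  simp only [add_mul, smul_mul_assoc, one_mul]
  module

/-- Substitute y = y' + ηx: the Jacobian is η³, the numerators differ by order η and the squared
denominator has order η⁴, so the integrand has a finite pointwise limit. Dominated convergence and
`integral_hessian` finish the computation. -/
lemma ConeRegular.tendsto_jump {φ : HC → HC} {κ : ℝ} (hκ : 0 < κ) (hφ : ConeRegular φ κ)
    {σ : ℝ} (hσ : σ ^ 2 = 1) {ρ : ℝ} (hρ : 0 < ρ) (y' : Fin 3 → ℝ) :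
    Tendsto (fun η : ℝ => ∫ y, (coeff ((ρ : ℂ) • hyp σ y') φ σ (arc ρ η) y -
      coeff ((ρ : ℂ) • hyp σ y') φ σ (arc ρ (-η)) y)) (𝓝[>] 0)
      (𝓝 ((σ * (2 * Real.pi ^ 2)) • φ ((ρ : ℂ) • hyp σ y'))) := by
  set Y₀ : HC := (ρ : ℂ) • hyp σ y' with hY₀
  obtain ⟨C, hC0, hC⟩ := hφ.norm_numer_sub_le hκ Y₀ hσ hρ
  have hρ' : (ρ : ℂ) ≠ 0 := ofReal_ne_zero.2 hρ.ne'
  set F : ℝ → (Fin 3 → ℝ) → HC := fun η x => (η ^ 3) •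
    (coeff Y₀ φ σ (arc ρ η) (y' + η • x) - coeff Y₀ φ σ (arc ρ (-η)) (y' + η • x)) with hF
  have hFint : ∀ η : ℝ, 0 < η → ∫ x, F η x = ∫ y, (coeff Y₀ φ σ (arc ρ η) y -
      coeff Y₀ φ σ (arc ρ (-η)) y) := by
    intro η hη
    have h1 := Measure.integral_comp_smul (volume : Measure (Fin 3 → ℝ))
      (fun z => coeff Y₀ φ σ (arc ρ η) (y' + z) - coeff Y₀ φ σ (arc ρ (-η)) (y' + z)) η
    have h2 := integral_add_left_eq_self (μ := (volume : Measure (Fin 3 → ℝ)))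
      (fun z => coeff Y₀ φ σ (arc ρ η) z - coeff Y₀ φ σ (arc ρ (-η)) z) y'
    rw [h2, Module.finrank_pi, Fintype.card_fin, abs_of_pos (by positivity)] at h1
    simp only [hF]
    rw [integral_smul, h1, smul_smul, mul_inv_cancel₀ (by positivity), one_smul]
  have hFeq : ∀ η : ℝ, 0 < η → ∀ x, F η x =
      (I * σ / (4 * ρ ^ 2 * height (y' + η • x) *
        ((denom σ y' η (y' + η • x) / η ^ 2 : ℝ) : ℂ) ^ 2)) •
      (η⁻¹ • (numer Y₀ φ σ (arc ρ η) (y' + η • x) - numer Y₀ φ σ (arc ρ (-η)) (y' + η • x))) := by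
    intro η hη x
    have hη' : (η : ℂ) ≠ 0 := ofReal_ne_zero.2 hη.ne'
    have hd : (denom σ y' η (y' + η • x) : ℂ) ≠ 0 :=
      ofReal_ne_zero.2 (denom_pos hσ y' hη.ne' _).ne'
    have hh := height_ne (y' + η • x)
    have hdn : denom σ y' (-η) (y' + η • x) = denom σ y' η (y' + η • x) := by
      simp [denom]
    simp only [hF, hY₀]
    rw [coeff_arc hσ hρ, coeff_arc hσ hρ, hdn, ← smul_sub, ← Complex.coe_smul, ← Complex.coe_smul,
      smul_smul, smul_smul]
    congr 1
    push_cast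
    field_simp
  set k : ℝ := gap y' / (1 + height y') ^ 2 with hk
  have hk0 : 0 < k := by have := gap_pos y'; have := height_pos y'; positivity
  have hk1 : k ≤ 1 := by
    have h1 := height_pos y'
    have h2 : gap y' ≤ height y' := by rw [gap]; linarith [Real.sqrt_nonneg (height y' ^ 2 - 1)]
    rw [hk, div_le_one (by positivity)]
    nlinarith
  have hlim : Tendsto (fun η => ∫ x, F η x) (𝓝[>] 0)
      (𝓝 (∫ x, (σ / height y' * (4 / (hessian y' x + 4) ^ 2)) • φ Y₀)) := by
    refine tendsto_integral_filter_of_dominated_convergence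
      (fun x => C / (4 * ρ ^ 2) * (k⁻¹ ^ 2 * (height x)⁻¹ ^ 4)) ?_ ?_
      ((integrable_height_pow.const_mul _).const_mul _) (Eventually.of_forall fun x => ?_)
    · filter_upwards [hC, self_mem_nhdsWithin] with η hη (hη0 : 0 < η)
      have hN : ∀ η' : ℝ, η' ≠ 0 → ∀ y, (arc ρ η' • hyp σ y - Y₀).det ≠ 0 := by
        intro η' hη' y
        rw [hY₀, det_arc hσ]
        exact mul_ne_zero (mul_ne_zero (mul_ne_zero two_ne_zero hρ') (arc_ne_zero hρ _))
          (ofReal_ne_zero.2 (denom_pos hσ y' hη' y).ne')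
      have hl : Continuous fun x : Fin 3 → ℝ => y' + η • x := by fun_prop
      have c1 := (hφ.continuous_coeff hη.1.1 hσ (hN η hη0.ne')).comp hl
      have c2 := (hφ.continuous_coeff hη.1.2 hσ (hN (-η) (neg_ne_zero.2 hη0.ne'))).comp hl
      exact ((c1.sub c2).const_smul (η ^ 3)).aestronglyMeasurable
    · filter_upwards [hC, self_mem_nhdsWithin, nhdsWithin_le_nhds (Iic_mem_nhds one_pos)] with
        η hη (hη0 : 0 < η) (hη1 : η ≤ 1)
      refine Eventually.of_forall fun x => ?_
      have hn := hη.2 (y' + η • x)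
      rw [hFeq η hη0, norm_smul, norm_smul]
      have hh := height_pos (y' + η • x)
      have hh1 := one_le_height (y' + η • x)
      have hhx := height_pos x
      have hd : k * (height x ^ 2 - 1) / height (y' + η • x) + 1 ≤
          denom σ y' η (y' + η • x) / η ^ 2 := by
        have h1 := pairing_sub_one_ge hσ (y' + η • x) y'
        simp only [Pi.add_apply, Pi.smul_apply, smul_eq_mul, add_sub_cancel_left] at h1
        rw [le_div_iff₀ (by positivity), denom]
        have h2 : η ^ 2 ≤ 2 * η ^ 2 / (1 + η ^ 2) := by
          have h4 : η ^ 2 ≤ 1 := pow_le_one₀ hη0.le hη1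
          rw [le_div_iff₀ (by positivity)]; nlinarith [sq_nonneg η]
        have h3 : (k * (height x ^ 2 - 1) / height (y' + η • x) + 1) * η ^ 2 =
            k * ((η * x 0) ^ 2 + (η * x 1) ^ 2 + (η * x 2) ^ 2) / height (y' + η • x) + η ^ 2 := by
          rw [height_sq x]; ring
        rw [h3]
        linarith
      set s := height (y' + η • x)
      -- The summand 1 absorbs -k/s because k ≤ 1 ≤ s. In the final bound the powers of s then
      -- cancel, leaving height(x)⁻⁴.
      have hd' : k * height x ^ 2 / s ≤ denom σ y' η (y' + η • x) / η ^ 2 := by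
        refine le_trans ?_ hd
        rw [div_add_one hh.ne']
        gcongr
        nlinarith
      set D := denom σ y' η (y' + η • x) / η ^ 2
      have hkx : 0 < k * height x ^ 2 / s := by positivity
      have hD : 0 < D := hkx.trans_le hd'
      have hnc : ‖I * σ / (4 * ρ ^ 2 * s * (D : ℂ) ^ 2)‖ = (4 * ρ ^ 2 * s * D ^ 2)⁻¹ := by
        rw [norm_div, norm_mul, norm_I, norm_real, Real.norm_eq_abs, abs_eq_one_of_sq hσ]
        simp [abs_of_pos hh, abs_of_pos hD, abs_of_pos hρ]
      rw [hnc, norm_inv, Real.norm_of_nonneg hη0.le]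
      calc _ ≤ (4 * ρ ^ 2 * s * (k * height x ^ 2 / s) ^ 2)⁻¹ * (η⁻¹ * (C * η * s⁻¹)) := by gcongr
        _ = _ := by field_simp
    · have hle : (𝓝[>] (0 : ℝ)) ≤ 𝓝[≠] 0 := nhdsWithin_mono _ fun η hη => ne_of_gt hη
      obtain ⟨v, hv⟩ := hφ.hasDerivAt_numer hκ hσ hρ y' x
      have hp := hv (p := arc ρ) (arc_zero ρ) (hasDerivAt_arc ρ)
      have hm := hv (p := fun η => arc ρ (-η)) (p' := -(2 * I * ρ)) (by simp [arc_zero]) (by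
        have h1 : HasDerivAt (fun η : ℝ => -η) (-1) 0 := hasDerivAt_neg 0
        have h2 : HasDerivAt (arc ρ) (2 * I * ρ) (-0) := by rw [neg_zero]; exact hasDerivAt_arc ρ
        have h3 := h2.scomp (0 : ℝ) h1
        rw [neg_one_smul] at h3
        exact h3)
      have h1 := hasDerivAt_iff_tendsto_slope_zero.1 (hp.fun_sub hm)
      have h2 : (-(ρ * (2 * I * ρ))) • φ Y₀ + v - ((-(ρ * (-(2 * I * ρ)))) • φ Y₀ + v) =
          (-(4 * I * ρ ^ 2)) • φ Y₀ := by module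
      rw [h2] at h1
      have h3 : Tendsto (fun η : ℝ => (height (y' + η • x) : ℂ)) (𝓝[≠] 0) (𝓝 (height y')) :=
        ((continuous_ofReal.comp continuous_height).tendsto y').comp (tendsto_line y' x)
      have h4 : Tendsto (fun η : ℝ => ((denom σ y' η (y' + η • x) / η ^ 2 : ℝ) : ℂ)) (𝓝[≠] 0)
          (𝓝 (((hessian y' x + 4) / 2 : ℝ) : ℂ)) :=
        (continuous_ofReal.tendsto _).comp (tendsto_denom hσ y' x)
      have hH := hessian_nonneg y' x
      have hH0 : (((hessian y' x + 4) / 2 : ℝ) : ℂ) ≠ 0 := ofReal_ne_zero.2 (by positivity)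
      have h5 := (tendsto_const_nhds (x := I * (σ : ℂ))).div
        ((h3.const_mul (4 * (ρ : ℂ) ^ 2)).mul (h4.pow 2))
        (mul_ne_zero (mul_ne_zero (mul_ne_zero (by norm_num : (4 : ℂ) ≠ 0) (pow_ne_zero 2 hρ')) (height_ne y'))
          (pow_ne_zero 2 hH0))
      have h6 := h5.smul h1
      have h7 : (I * σ / (4 * ρ ^ 2 * height y' * (((hessian y' x + 4) / 2 : ℝ) : ℂ) ^ 2)) •
          ((-(4 * I * ρ ^ 2)) • φ Y₀) = (σ / height y' * (4 / (hessian y' x + 4) ^ 2)) • φ Y₀ := by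
        rw [← Complex.coe_smul, smul_smul]
        congr 1
        have := height_ne y'
        have hH1 : ((hessian y' x : ℂ) + 4) ≠ 0 := by
          exact_mod_cast (by positivity : hessian y' x + 4 ≠ 0)
        push_cast
        field_simp
        linear_combination (-4 * σ : ℂ) * I_sq
      rw [h7] at h6
      refine (h6.mono_left hle).congr' ?_
      filter_upwards [self_mem_nhdsWithin] with η (hη0 : 0 < η)
      rw [hFeq η hη0]
      simp [hY₀, numer, arc_zero]
  rw [integral_smul_const, integral_const_mul, integral_hessian] at hlim
  have hs : σ / height y' * (2 * Real.pi ^ 2 * height y') = σ * (2 * Real.pi ^ 2) := by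
    have := height_pos y'
    field_simp
  rw [hs] at hlim
  refine hlim.congr' ?_
  filter_upwards [self_mem_nhdsWithin] with η (hη0 : 0 < η)
  exact hFint η hη0

/-! ### The Cayley transform and existence of continuations -/

/-- The inverse of `fracLin γ`, for `N(1 - Z) ≠ 0`. -/
noncomputable def cay (Z : HC) : HC := (2 * I) • (1 - Z)⁻¹ - I • 1

lemma det_one_sub (Z : HC) : (1 - Z).det = (Z - 1).det := by
  simp [Matrix.det_fin_two]; ring

lemma I_smul_cay_sub_one (Z : HC) : γ 1 0 * cay Z + γ 1 1 = (-2 : ℂ) • (1 - Z)⁻¹ := by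
  simp only [γ, cay]
  simp [smul_sub, smul_smul]
  rw [show I * (2 * I) = -2 by linear_combination 2 * I_sq]
  simp

lemma I_smul_cay_add_one (Z : HC) : γ 0 0 * cay Z + γ 0 1 = (-2 : ℂ) • (1 - Z)⁻¹ + (2 : ℂ) • 1 := by
  simp only [γ, cay]
  simp [smul_sub, smul_smul]
  rw [show I * (2 * I) = -2 by linear_combination 2 * I_sq, two_smul]
  module

lemma inv_smul_inv_one_sub {Z : HC} (hZ : (1 - Z).det ≠ 0) : ((-2 : ℂ) • (1 - Z)⁻¹)⁻¹ = (-(1 / 2) : ℂ) • (1 - Z) := by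
  refine Matrix.inv_eq_right_inv ?_
  rw [smul_mul_smul_comm, Matrix.nonsing_inv_mul _ (Ne.isUnit hZ)]
  norm_num

lemma det_smul_inv_one_sub (Z : HC) : ((-2 : ℂ) • (1 - Z)⁻¹).det = 4 * (1 - Z).det⁻¹ := by
  rw [Matrix.det_smul, Matrix.det_nonsing_inv, Ring.inverse_eq_inv']
  norm_num

lemma nonsing_cay {Z : HC} (hZ : (1 - Z).det ≠ 0) : Nonsing γ (cay Z) := by
  rw [Nonsing, I_smul_cay_sub_one, det_smul_inv_one_sub Z]
  exact mul_ne_zero (by norm_num) (inv_ne_zero hZ)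

lemma fracLin_cay {Z : HC} (hZ : (1 - Z).det ≠ 0) : fracLin γ (cay Z) = Z := by
  rw [fracLin, I_smul_cay_sub_one, I_smul_cay_add_one, inv_smul_inv_one_sub hZ, add_mul,
    smul_mul_smul_comm, Matrix.nonsing_inv_mul _ (Ne.isUnit hZ), smul_mul_smul_comm, one_mul]
  module

lemma factor_cay {Z : HC} (hZ : (1 - Z).det ≠ 0) : factor γ (cay Z) = (-(1 / 8) * (1 - Z).det) • (1 - Z) := by
  rw [factor, I_smul_cay_sub_one, inv_smul_inv_one_sub hZ, det_smul_inv_one_sub Z, smul_smul]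
  congr 1
  field_simp
  norm_num

lemma kernel_mul_factor_cay {Z : HC} (hZ : (1 - Z).det ≠ 0) : (8 : ℂ) • (kernel 1 Z * factor γ (cay Z)) = 1 := by
  have h1 : 1 - Z = -(Z - 1) := by abel
  rw [factor_cay hZ, kernel, smul_mul_smul_comm, h1, mul_neg, adj_mul_self, ← h1, ← det_one_sub,
    smul_neg, smul_neg, smul_smul, smul_smul, ← neg_smul]
  convert one_smul ℂ (1 : HC) using 2
  field_simp

lemma factor_cay_mul_kernel {Z : HC} (hZ : (1 - Z).det ≠ 0) : (8 : ℂ) • (factor γ (cay Z) * kernel 1 Z) = 1 := by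
  have h1 : 1 - Z = -(Z - 1) := by abel
  rw [factor_cay hZ, kernel, smul_mul_smul_comm, h1, neg_mul (Z - 1), self_mul_adj, ← h1, ← det_one_sub,
    smul_neg, smul_neg, smul_smul, smul_smul, ← neg_smul]
  convert one_smul ℂ (1 : HC) using 2
  field_simp

lemma det_one_sub_fracLin_ne_zero {X : HC} (hX : Nonsing γ X) : (1 - fracLin γ X).det ≠ 0 ∧
    cay (fracLin γ X) = X := by
  have hX' := hX
  rw [Nonsing] at hX'
  set C := γ 1 0 * X + γ 1 1 with hC
  have h1 : γ 0 0 * X + γ 0 1 = C + (2 : ℂ) • 1 := by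
    simp [hC, γ, two_smul]
  have h2 : 1 - fracLin γ X = (-2 : ℂ) • C⁻¹ := by
    rw [fracLin, ← hC, h1, add_mul, Matrix.mul_nonsing_inv _ (Ne.isUnit hX')]
    simp
  have h3 : (1 - fracLin γ X)⁻¹ = (-(1 / 2) : ℂ) • C := by
    rw [h2]
    refine Matrix.inv_eq_right_inv ?_
    rw [smul_mul_smul_comm, Matrix.nonsing_inv_mul _ (Ne.isUnit hX')]
    norm_num
  refine ⟨?_, ?_⟩
  · rw [h2, Matrix.det_smul, Matrix.det_nonsing_inv, Ring.inverse_eq_inv']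
    simp [hX']
  · rw [cay, h3]
    simp only [hC, γ]
    simp [smul_smul]
    rw [show (2 * I * (2⁻¹ * I) : ℂ) = -1 by linear_combination I_sq,
      show (2 * I * 2⁻¹ : ℂ) = I by ring]
    module

lemma det_one_sub_ne_zero_of_mem {Y : HC} (hY : Y ∈ Minkowski) : (1 - Y).det ≠ 0 := by
  intro h
  have hst : star Y = -Y := hY
  have h00 := congrFun (congrFun hst 0) 0
  have h11 := congrFun (congrFun hst 1) 1
  have h01 := congrFun (congrFun hst 0) 1
  simp only [Matrix.star_apply, Matrix.neg_apply, Complex.ext_iff, RCLike.star_def, conj_re,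
    conj_im, neg_re, neg_im] at h00 h11 h01
  rw [Matrix.det_fin_two] at h
  have h1 := congrArg Complex.re h
  have h2 := congrArg Complex.im h
  simp at h1 h2
  have a0 : (Y 0 0).re = 0 := by linarith
  have a1 : (Y 1 1).re = 0 := by linarith
  have a2 : (Y 1 0).im = (Y 0 1).im := by linarith
  rw [a0, a1, h01.1, a2] at h1
  rw [a0, a1, h01.1, a2] at h2
  have h3 : (Y 1 1).im = -(Y 0 0).im := by linarith
  rw [h3] at h1
  nlinarith [sq_nonneg (Y 0 0).im, sq_nonneg (Y 0 1).re, sq_nonneg (Y 0 1).im]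

lemma cay_mem_U2 {Y : HC} (hY : Y ∈ Minkowski) : cay Y ∈ U2 := by
  have hB := det_one_sub_ne_zero_of_mem hY
  have hst : star Y = -Y := hY
  have hs : star (1 - Y) = 1 + Y := by rw [star_sub, star_one, hst, sub_neg_eq_add]
  have hB' : (1 + Y).det ≠ 0 := by
    have := det_one_sub_ne_zero_of_mem (neg_mem hY)
    rwa [sub_neg_eq_add] at this
  have hX : cay Y = I • ((1 + Y) * (1 - Y)⁻¹) := by
    have : (1 + Y) * (1 - Y)⁻¹ = (2 : ℂ) • (1 - Y)⁻¹ - 1 := by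
      have h1 := Matrix.mul_nonsing_inv _ (Ne.isUnit hB)
      have h2 : 1 + Y = (2 : ℂ) • 1 - (1 - Y) := by rw [two_smul]; abel
      rw [h2, sub_mul, h1, smul_mul_assoc, one_mul]
    rw [this, cay, smul_sub, smul_smul, mul_comm]
  refine Matrix.mem_unitaryGroup_iff'.2 ?_
  have hsi : star ((1 - Y)⁻¹) = (1 + Y)⁻¹ := by
    rw [← hs, Matrix.star_eq_conjTranspose, Matrix.star_eq_conjTranspose,
      Matrix.conjTranspose_nonsing_inv]
  have hs' : star (1 + Y) = 1 - Y := by rw [star_add, star_one, hst, sub_eq_add_neg]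
  have hc : (1 - Y) * (1 + Y) = (1 + Y) * (1 - Y) := by noncomm_ring
  rw [hX, star_smul, star_mul, hsi, hs', smul_mul_smul_comm]
  have h1 : (1 + Y)⁻¹ * (1 - Y) * ((1 + Y) * (1 - Y)⁻¹) =
      ((1 + Y)⁻¹ * (1 + Y)) * ((1 - Y) * (1 - Y)⁻¹) := by
    rw [mul_assoc, ← mul_assoc (1 - Y), hc]; simp only [mul_assoc]
  rw [h1, Matrix.nonsing_inv_mul _ (Ne.isUnit hB'), Matrix.mul_nonsing_inv _ (Ne.isUnit hB)]
  simp

/-- The inverse of `h ↦ factor γ · h (fracLin γ ·)`. -/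
noncomputable def uncay {m : ℕ} (F : HC → Val m) (Z : HC) : Val m :=
  (8 : ℂ) • (kernel 1 Z * F (cay Z))

lemma eq_uncay {m : ℕ} {F fC : HC → Val m} {Z : HC} (hZ : (1 - Z).det ≠ 0)
    (h : F (cay Z) = factor γ (cay Z) * fC (fracLin γ (cay Z))) : fC Z = uncay F Z := by
  rw [uncay, h, fracLin_cay hZ, ← Matrix.mul_assoc, ← Matrix.smul_mul, kernel_mul_factor_cay hZ,
    Matrix.one_mul]

lemma factor_mul_uncay {m : ℕ} (F : HC → Val m) {X : HC} (hX : Nonsing γ X) :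
    F X = factor γ X * uncay F (fracLin γ X) := by
  obtain ⟨h1, h2⟩ := det_one_sub_fracLin_ne_zero hX
  have h3 := factor_cay_mul_kernel h1
  rw [h2] at h3
  rw [uncay, h2, Matrix.mul_smul, ← Matrix.mul_assoc, ← Matrix.smul_mul, h3, Matrix.one_mul]

theorem exists_isContinuation {m : ℕ} {f : Minkowski → Val m} (hf : f ∈ V m) :
    ∃ fC : HC → Val m, IsContinuation f fC := by
  obtain ⟨-, W, hW, hU, F, hF, h⟩ := hf
  refine ⟨uncay F, fun Y => ?_, W, hW, hU, F, hF, fun X _ hX => factor_mul_uncay F hX⟩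
  have hZ := det_one_sub_ne_zero_of_mem Y.2
  have h1 := h (cay Y) (cay_mem_U2 Y.2) (nonsing_cay hZ)
  have h2 : (⟨fracLin γ (cay Y), fracLin_γ_mem (cay_mem_U2 Y.2) (nonsing_cay hZ)⟩ : Minkowski) = Y :=
    Subtype.ext (fracLin_cay hZ)
  rw [h2] at h1
  rw [uncay, h1, ← Matrix.mul_assoc, ← Matrix.smul_mul, kernel_mul_factor_cay hZ, Matrix.one_mul]

/-! ### Compactness of U(2) and a uniform tube around 𝕄 -/

lemma isCompact_U2 : IsCompact U2 := by
  have hcl : IsClosed U2 := by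
    have : U2 = (fun X : HC => star X * X) ⁻¹' {1} := by
      ext X
      exact Matrix.mem_unitaryGroup_iff'
    rw [this]
    exact isClosed_singleton.preimage (by fun_prop)
  refine (isCompact_univ_pi fun _ : Fin 2 => isCompact_univ_pi fun _ : Fin 2 =>
    isCompact_closedBall (0 : ℂ) 1).of_isClosed_subset hcl fun X hX i _ j _ => ?_
  rw [mem_closedBall_zero_iff]
  exact entry_norm_bound_of_unitary hX i j

lemma isOpen_setOf_det_ne_zero : IsOpen {Z : HC | (1 - Z).det ≠ 0} :=
  isOpen_ne.preimage (by fun_prop)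

lemma differentiableAt_cay {Z : HC} (hZ : (1 - Z).det ≠ 0) : DifferentiableAt ℂ cay Z := by
  obtain ⟨d, hd, -⟩ := hasFDerivAt_det_sub 1 Z
  have h1 : DifferentiableAt ℂ (fun Z : HC => (2 * I * (Z - 1).det⁻¹) • adj (1 - Z)) Z := by
    have h2 : DifferentiableAt ℂ (fun Z : HC => (Z - 1).det⁻¹) Z :=
      hd.differentiableAt.inv (by rwa [← det_one_sub])
    have h3 : DifferentiableAt ℂ (fun Z : HC => adj (1 - Z)) Z :=
      DifferentiableAt.comp (g := adj) Z adj.differentiableAt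
        ((differentiableAt_const (1 : HC)).sub differentiableAt_id)
    exact (h2.const_mul _).fun_smul h3
  have h4 : cay = fun Z : HC => (2 * I * (Z - 1).det⁻¹) • adj (1 - Z) - I • 1 := by
    funext Z
    rw [cay, inv_eq_smul_adj, smul_smul, det_one_sub]
  rw [h4]
  exact h1.sub_const _

lemma isOpen_setOf_cay_mem {W : Set HC} (hW : IsOpen W) :
    IsOpen {Z : HC | (1 - Z).det ≠ 0 ∧ cay Z ∈ W} := by
  have h : ContinuousOn cay {Z : HC | (1 - Z).det ≠ 0} := fun Z hZ =>
    (differentiableAt_cay hZ).continuousAt.continuousWithinAt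
  exact h.isOpen_inter_preimage isOpen_setOf_det_ne_zero hW

lemma differentiableOn_uncay {W : Set HC} (hW : IsOpen W) {F : HC → HC}
    (hF : DifferentiableOn ℂ F W) :
    DifferentiableOn ℂ (uncay (m := 2) F) {Z : HC | (1 - Z).det ≠ 0 ∧ cay Z ∈ W} := by
  rintro Z ⟨hZ, hZW⟩
  obtain ⟨A, hA, -⟩ := hasFDerivAt_kernel 1 Z (by rwa [← det_one_sub])
  have h1 : DifferentiableAt ℂ (fun Z => F (cay Z)) Z :=
    DifferentiableAt.comp (g := F) Z (hF.differentiableAt (hW.mem_nhds hZW)) (differentiableAt_cay hZ)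
  exact ((hA.differentiableAt.fun_mul h1).const_smul (8 : ℂ)).differentiableWithinAt

/-- `(1 - (1 + iε) Y) (1 - Y)⁻¹` in terms of `X = cay Y`. -/
noncomputable def tilt (ε : ℝ) (X : HC) : HC := 1 - (ε / 2 : ℂ) • (X - I • 1)

lemma tilt_cay_mul {Y : HC} (hY : (1 - Y).det ≠ 0) (ε : ℝ) :
    tilt ε (cay Y) * (1 - Y) = 1 - (1 + I * ε : ℂ) • Y := by
  have h := Matrix.nonsing_inv_mul _ (Ne.isUnit hY)
  rw [tilt, cay, sub_mul, smul_mul_assoc, sub_mul, sub_mul, smul_mul_assoc, h, smul_mul_assoc,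
    one_mul]
  module

lemma cay_smul {Y : HC} (hY : (1 - Y).det ≠ 0) {ε : ℝ} :
    cay ((1 + I * ε : ℂ) • Y) = (cay Y + I • 1) * (tilt ε (cay Y))⁻¹ - I • 1 := by
  rw [cay, ← tilt_cay_mul hY, Matrix.mul_inv_rev, cay, sub_add_cancel, smul_mul_assoc]

/-- In the coordinate X = cay Y, scaling Y by 1 + iε extends to all of U(2), including the points at
infinity of 𝕄, and is the identity for ε = 0. Compactness then gives one range of ε for all X. -/
lemma eventually_tilt {W : Set HC} (hW : IsOpen W) (hU : U2 ⊆ W) :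
    ∀ᶠ ε in 𝓝 (0 : ℝ), ∀ X ∈ U2, (tilt ε X).det ≠ 0 ∧
      (X + I • 1) * (tilt ε X)⁻¹ - I • 1 ∈ W := by
  refine isCompact_U2.eventually_forall_of_forall_eventually fun X hX => ?_
  have hc : Continuous fun p : ℝ × HC => tilt p.1 p.2 := by
    unfold tilt
    fun_prop
  have h0 : tilt 0 X = 1 := by simp [tilt]
  have hd : Tendsto (fun p : ℝ × HC => (tilt p.1 p.2).det) (𝓝 (0, X)) (𝓝 1) := by
    have : Continuous fun p : ℝ × HC => (tilt p.1 p.2).det := hc.matrix_det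
    simpa [h0] using this.tendsto (0, X)
  have hadj : Tendsto (fun p : ℝ × HC => (p.2 + I • 1) * ((tilt p.1 p.2).det⁻¹ • adj (tilt p.1 p.2)) -
      I • 1) (𝓝 (0, X)) (𝓝 X) := by
    have h1 : Continuous fun p : ℝ × HC => adj (tilt p.1 p.2) := adj.continuous.comp hc
    have h2 := h1.tendsto (0, X)
    simp only [h0, adj_one] at h2
    have h3 : Tendsto (fun p : ℝ × HC => p.2 + I • 1) (𝓝 (0, X)) (𝓝 (X + I • 1)) :=
      (continuous_snd.add continuous_const).tendsto (0, X)
    have h4 := (h3.mul ((hd.inv₀ one_ne_zero).smul h2)).sub_const (I • 1)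
    simpa using h4
  filter_upwards [hd.eventually_ne one_ne_zero, hadj (hW.mem_nhds (hU hX))] with p hp1 hp2
  refine ⟨hp1, ?_⟩
  rwa [inv_eq_smul_adj]

lemma exists_tube {W : Set HC} (hW : IsOpen W) (hU : U2 ⊆ W) : ∃ κ : ℝ, 0 < κ ∧
    ∀ Y ∈ Minkowski, ∀ ε : ℝ, |ε| < κ →
      (1 - (1 + I * ε : ℂ) • Y).det ≠ 0 ∧ cay ((1 + I * ε : ℂ) • Y) ∈ W := by
  obtain ⟨κ, hκ, h⟩ := Metric.eventually_nhds_iff.1 (eventually_tilt hW hU)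
  refine ⟨κ, hκ, fun Y hY ε hε => ?_⟩
  have hY' := det_one_sub_ne_zero_of_mem hY
  obtain ⟨h1, h2⟩ := h (y := ε) (by simpa using hε) (cay Y) (cay_mem_U2 hY)
  rw [cay_smul hY', ← tilt_cay_mul hY', Matrix.det_mul]
  exact ⟨mul_ne_zero h1 hY', h2⟩

lemma smul_hyp_mem (r σ : ℝ) (y : Fin 3 → ℝ) : (r : ℂ) • hyp σ y ∈ Minkowski := by
  rw [Complex.coe_smul]
  exact Submodule.smul_mem _ r (hyp_mem σ y)

lemma smul_hyp_eq {t : ℂ} {κ : ℝ} (ht : t ∈ sector κ) (σ : ℝ) (y : Fin 3 → ℝ) :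
    ∃ ε : ℝ, |ε| < κ ∧ t • hyp σ y = (1 + I * ε : ℂ) • ((t.re : ℂ) • hyp σ y) := by
  obtain ⟨h1, h2⟩ := ht
  refine ⟨t.im / t.re, ?_, ?_⟩
  · rwa [abs_div, abs_of_pos h1, div_lt_iff₀ h1]
  · have hr : (t.re : ℂ) ≠ 0 := ofReal_ne_zero.2 h1.ne'
    rw [smul_smul]
    congr 1
    push_cast
    field_simp
    rw [mul_comm I]
    exact (re_add_im t).symm

/-! ### Regularity of the continuation on the cone -/

/-- The left Cauchy–Fueter operator applied to a complex-linear map. -/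
noncomputable def fueterSymbol (B : HC →L[ℂ] HC) : HC :=
  B 1 + (e 1 * B (e 1) + e 2 * B (e 2) + e 3 * B (e 3))

/-- By complex linearity the term -ẽ₀B(ẽ₀) with ẽ₀ = -i becomes -(-i)²B(1) = B(1). -/
lemma LeftRegular.fueterSymbol_eq_zero {f : Minkowski → HC} (hf : LeftRegular (m := 2) f)
    {φ : HC → HC} (h : ∀ Y : Minkowski, φ Y = f Y) (Y : Minkowski)
    (hd : DifferentiableAt ℂ φ Y) : fueterSymbol (fderiv ℂ φ Y) = 0 := by
  have h1 : HasFDerivAt f (((fderiv ℂ φ Y).restrictScalars ℝ).comp Minkowski.subtypeL) Y := by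
    have h2 : HasFDerivAt (𝕜 := ℝ) φ ((fderiv ℂ φ Y).restrictScalars ℝ) (Minkowski.subtypeL Y) :=
      hd.hasFDerivAt.restrictScalars ℝ
    have h3 : HasFDerivAt (fun Z : Minkowski => φ (Minkowski.subtypeL Z))
        (((fderiv ℂ φ Y).restrictScalars ℝ).comp Minkowski.subtypeL) Y :=
      HasFDerivAt.comp (g := φ) Y h2 Minkowski.subtypeL.hasFDerivAt
    have h4 : (fun Z : Minkowski => φ (Minkowski.subtypeL Z)) = f := funext h
    rwa [h4] at h3
  have hp : ∀ j, pderiv (m := 2) j f Y = fderiv ℂ φ Y (et j) := by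
    intro j
    have := h1.fderiv
    exact congrArg (fun A : Minkowski →L[ℝ] HC => A ⟨et j, et_mem j⟩) this
  have h5 := hf.2 Y
  rw [hp, hp, hp, hp] at h5
  have h0 : et 0 = -I • 1 := by simp [et, e]
  have e1 : et 1 = e 1 := rfl
  have e2 : et 2 = e 2 := rfl
  have e3 : et 3 = e 3 := rfl
  have h6 : fderiv ℂ φ Y (-I • 1) = -I • fderiv ℂ φ Y 1 := map_smul _ _ _
  have h7 : (-I • (1 : HC)) * (-I • fderiv ℂ φ Y 1) = -fderiv ℂ φ Y 1 := by
    rw [smul_mul_smul_comm, one_mul, neg_mul_neg, I_mul_I, neg_one_smul]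
  rw [e1, e2, e3, h0, h6] at h5
  rw [fueterSymbol, ← h5]
  have h8 : -((-I • (1 : HC)) * (-I • fderiv ℂ φ Y 1)) = fderiv ℂ φ Y 1 := by rw [h7, neg_neg]
  refine Eq.trans ?_ (congrArg (fun A : HC => A + e 1 * fderiv ℂ φ Y (e 1) +
    e 2 * fderiv ℂ φ Y (e 2) + e 3 * fderiv ℂ φ Y (e 3)) h8.symm)
  abel

lemma eq_zero_on_sector {G : ℂ → HC} {κ : ℝ} (hκ : 0 < κ) (hG : DifferentiableOn ℂ G (sector κ))
    (h0 : ∀ r : ℝ, 0 < r → G r = 0) {t : ℂ} (ht : t ∈ sector κ) : G t = 0 := by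
  have h1 : (1 : ℂ) ∈ sector κ := ⟨by simp, by simpa using hκ⟩
  have hfr : ∃ᶠ z in 𝓝[≠] (1 : ℂ), G z = 0 := by
    have ht : Tendsto (fun r : ℝ => (r : ℂ)) (𝓝[>] 1) (𝓝[≠] 1) := by
      refine tendsto_nhdsWithin_iff.2 ⟨?_, ?_⟩
      · exact (continuous_ofReal.tendsto' 1 1 ofReal_one).mono_left nhdsWithin_le_nhds
      · filter_upwards [self_mem_nhdsWithin] with r (hr : 1 < r)
        exact ofReal_ne_one.2 hr.ne'
    refine ht.frequently (Eventually.frequently ?_)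
    filter_upwards [self_mem_nhdsWithin] with r (hr : 1 < r)
    exact h0 r (by linarith)
  exact (hG.analyticOnNhd (isOpen_sector κ)).eqOn_zero_of_preconnected_of_frequently_eq_zero
    (convex_sector κ).isPreconnected h1 hfr ht

theorem exists_coneRegular {f : Minkowski → HC} {φ : HC → HC} (hf : LeftRegular (m := 2) f)
    (hφ : IsContinuation (m := 2) f φ) : ∃ κ : ℝ, 0 < κ ∧ ConeRegular φ κ := by
  obtain ⟨hfφ, W, hW, hU, F, hF, h⟩ := hφ
  have : LocallyCompactSpace HC := inferInstanceAs (LocallyCompactSpace (Fin 2 → Fin 2 → ℂ))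
  -- The continuation is controlled by F on a compact neighbourhood L of U(2), where F is bounded; F
  -- need not be bounded on W.
  obtain ⟨L, hL, hUL, hLW⟩ := exists_compact_between isCompact_U2 hW hU
  obtain ⟨κ, hκ, htube⟩ := exists_tube isOpen_interior hUL
  set Ω := {Z : HC | (1 - Z).det ≠ 0 ∧ cay Z ∈ W} with hΩ
  have hΩo : IsOpen Ω := isOpen_setOf_cay_mem hW
  have hφΩ : ∀ Z ∈ Ω, φ Z = uncay (m := 2) F Z := fun Z hZ =>
    eq_uncay (m := 2) hZ.1 (h _ hZ.2 (nonsing_cay hZ.1))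
  have hφd : DifferentiableOn ℂ φ Ω := (differentiableOn_uncay hW hF).congr hφΩ
  have hmem : ∀ t ∈ sector κ, ∀ σ y, (1 - t • hyp σ y).det ≠ 0 ∧ cay (t • hyp σ y) ∈ interior L := by
    intro t ht σ y
    obtain ⟨ε, hε, he⟩ := smul_hyp_eq ht σ y
    rw [he]
    exact htube _ (smul_hyp_mem _ _ _) ε hε
  have hmemΩ : ∀ t ∈ sector κ, ∀ σ y, t • hyp σ y ∈ Ω := fun t ht σ y =>
    ⟨(hmem t ht σ y).1, hLW (interior_subset (hmem t ht σ y).2)⟩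
  refine ⟨κ, hκ, ?_, ?_, ?_⟩
  · exact fun t ht σ _ y => hφd.differentiableAt (hΩo.mem_nhds (hmemΩ t ht σ y))
  · intro t ht σ _ y
    -- For real t > 0 the point tY lies in 𝕄, where f is left-regular, and the symbol is holomorphic
    -- in t.
    refine eq_zero_on_sector (G := fun t => fueterSymbol (fderiv ℂ φ (t • hyp σ y))) hκ ?_ ?_ ht
    · intro s hs
      have hl : ∀ v, DifferentiableAt ℂ (fun t : ℂ => fderiv ℂ φ (t • hyp σ y) v) s := fun v =>
        differentiableAt_fderiv_line hΩo hφd (hyp σ y) v (hmemΩ s hs σ y)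
      exact ((hl 1).fun_add ((((hl (e 1)).const_mul (e 1)).fun_add
        ((hl (e 2)).const_mul (e 2))).fun_add ((hl (e 3)).const_mul (e 3)))).differentiableWithinAt
    · intro r hr
      have hrs : (r : ℂ) ∈ sector κ := ⟨by simpa using hr, by simp; positivity⟩
      exact hf.fueterSymbol_eq_zero hfφ ⟨_, smul_hyp_mem r σ y⟩
        (hφd.differentiableAt (hΩo.mem_nhds (hmemΩ r hrs σ y)))
  · obtain ⟨C, hC⟩ := hL.exists_bound_of_continuousOn (hF.continuousOn.mono hLW)
    refine ⟨‖(-8 : ℂ)‖ * C, fun t ht σ _ y => ⟨(-8 : ℂ) • F (cay (t • hyp σ y)), ?_, ?_⟩⟩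
    · rw [norm_smul]
      exact mul_le_mul_of_nonneg_left (hC _ (interior_subset (hmem t ht σ y).2)) (norm_nonneg _)
    · rw [hφΩ _ (hmemΩ t ht σ y), uncay, kernel, det_one_sub]
      have h1 : adj (1 - t • hyp σ y) = -adj (t • hyp σ y - 1) := by
        rw [← map_neg, neg_sub]
      change _ = _ • (adj (1 - t • hyp σ y) * _)
      rw [h1, mul_smul_comm, smul_smul, neg_mul, smul_neg, smul_mul_assoc, smul_smul, ← neg_smul]
      congr 1
      ring

/-! ### Assembling the integral formula for HC-valued functions -/

lemma avoids_of_le {ρ : ℝ} (hρ : 0 < ρ) {σ σ' : ℝ} (hσ : σ ^ 2 = 1) (hσ' : σ' ^ 2 = 1)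
    (y' : Fin 3 → ℝ) {T : Set ℂ} {d : ℂ → ℝ} (hd : ContinuousOn d T) (hd0 : ∀ t ∈ T, 0 < d t)
    (h : ∀ t ∈ T, d t ≤ |t.im| ∨ (d t ≤ t.re ∧ σ * σ' = -1)) :
    Avoids ((ρ : ℂ) • hyp σ' y') σ T := by
  have hg : 0 < 2 * ρ * gap y' := by have := gap_pos y'; positivity
  refine ⟨fun t => ((1 + ‖t‖) / d t + 1) ^ 2 / (2 * ρ * gap y'), ?_, fun t ht y => ?_⟩
  · have h1 : ContinuousOn (fun t : ℂ => 1 + ‖t‖) T := by fun_prop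
    exact (((h1.div hd fun t ht => (hd0 t ht).ne').add continuousOn_const).pow 2).div_const _
  · rw [div_mul_eq_mul_div, le_div_iff₀ hg, mul_comm]
    exact height_le_det_sub (hd0 t ht) hρ hσ hσ' y y' (h t ht)

lemma avoids_of_mul_im_pos {ρ : ℝ} (hρ : 0 < ρ) {σ σ' : ℝ} (hσ : σ ^ 2 = 1) (hσ' : σ' ^ 2 = 1)
    (y' : Fin 3 → ℝ) (s κ : ℝ) :
    Avoids ((ρ : ℂ) • hyp σ' y') σ (sector κ ∩ {t | 0 < s * t.im}) :=
  avoids_of_le hρ hσ hσ' y' (d := fun t => |t.im|) continuous_im.abs.continuousOn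
    (fun t ht => abs_pos.2 fun h => by simpa [h] using ht.2) fun _ _ => Or.inl le_rfl

lemma avoids_opposite {ρ : ℝ} (hρ : 0 < ρ) {σ σ' : ℝ} (hσ : σ ^ 2 = 1) (hσ' : σ' ^ 2 = 1)
    (h : σ * σ' = -1) (y' : Fin 3 → ℝ) (κ : ℝ) : Avoids ((ρ : ℂ) • hyp σ' y') σ (sector κ) :=
  avoids_of_le hρ hσ hσ' y' (d := re) continuous_re.continuousOn (fun _ ht => ht.1)
    fun _ _ => Or.inr ⟨le_rfl, h⟩

lemma isOpen_sector_inter (s κ : ℝ) : IsOpen (sector κ ∩ {t | 0 < s * t.im}) :=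
  (isOpen_sector κ).inter (isOpen_lt continuous_const (continuous_const.mul continuous_im))

lemma isPreconnected_sector_inter (s κ : ℝ) : IsPreconnected (sector κ ∩ {t | 0 < s * t.im}) := by
  refine ((convex_sector κ).inter ?_).isPreconnected
  exact convex_halfSpace_gt (f := fun t : ℂ => s * t.im)
    ⟨fun x y => by simp [mul_add], fun c x => by simp; ring⟩ 0

section

variable {φ : HC → HC} {κ : ℝ}

/-- The jump of the integral across the positive axis reproduces `φ`. -/
theorem ConeRegular.integral_coeff_sub (hκ : 0 < κ) (hφ : ConeRegular φ κ) {σ : ℝ}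
    (hσ : σ ^ 2 = 1) {ρ : ℝ} (hρ : 0 < ρ) (y' : Fin 3 → ℝ) {t t' : ℂ}
    (ht : t ∈ sector κ ∩ {t | 0 < (1 : ℝ) * t.im}) (ht' : t' ∈ sector κ ∩ {t | 0 < (-1 : ℝ) * t.im}) :
    (∫ y, coeff ((ρ : ℂ) • hyp σ y') φ σ t y) - ∫ y, coeff ((ρ : ℂ) • hyp σ y') φ σ t' y =
      (σ * (2 * Real.pi ^ 2)) • φ ((ρ : ℂ) • hyp σ y') := by
  obtain ⟨i1, c1⟩ := hφ.integral_coeff_eq hσ (isOpen_sector_inter 1 κ)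
    (isPreconnected_sector_inter 1 κ) inter_subset_left (avoids_of_mul_im_pos hρ hσ hσ y' 1 κ)
  obtain ⟨i2, c2⟩ := hφ.integral_coeff_eq hσ (isOpen_sector_inter (-1) κ)
    (isPreconnected_sector_inter (-1) κ) inter_subset_left
    (avoids_of_mul_im_pos hρ hσ hσ y' (-1) κ)
  -- The integral is constant on each half of the sector, so t and t' may be replaced by the two
  -- points of the arc and η sent to 0.
  refine tendsto_nhds_unique ?_ (hφ.tendsto_jump hκ hσ hρ y')
  refine tendsto_const_nhds.congr' ?_
  obtain ⟨C, -, hC⟩ := hφ.norm_numer_sub_le hκ ((ρ : ℂ) • hyp σ y') hσ hρ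
  filter_upwards [hC, self_mem_nhdsWithin] with η hη (hη0 : 0 < η)
  have hp : arc ρ η ∈ sector κ ∩ {t | 0 < (1 : ℝ) * t.im} := by
    refine ⟨hη.1.1, ?_⟩
    rw [mem_ofPred_eq, arc_im]
    positivity
  have hm : arc ρ (-η) ∈ sector κ ∩ {t | 0 < (-1 : ℝ) * t.im} := by
    refine ⟨hη.1.2, ?_⟩
    rw [mem_ofPred_eq, arc_im, show -1 * (2 * ρ * -η / (1 + (-η) ^ 2)) = 2 * ρ * η / (1 + η ^ 2) by
      ring]
    positivity
  rw [integral_sub (i1 _ hp) (i2 _ hm), c1 _ ht _ hp, c2 _ ht' _ hm]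

lemma integrable_pullback_deformedSheet {R : ℝ} (hR : 0 < R) (ε : ℝ) {σ : ℝ} (hσ : σ = 1 ∨ σ = -1)
    {Y₀ : HC} (h : Integrable (coeff Y₀ φ σ ((R : ℂ) * (1 + I * (σ * ε))))) :
    Integrable (pullback (m := 2) (fueterForm φ Y₀) (deformedSheet R ε σ)) := by
  have h1 := (h.comp_smul (inv_ne_zero hR.ne')).smul ((R⁻¹) ^ 3 : ℝ)
  exact h1.congr (Eventually.of_forall fun y => (pullback_deformedSheet hR ε hσ Y₀ φ y).symm)

lemma integral_pullback_deformedSheet {R : ℝ} (hR : 0 < R) (ε : ℝ) {σ : ℝ} (hσ : σ = 1 ∨ σ = -1)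
    (Y₀ : HC) : ∫ y, pullback (m := 2) (fueterForm φ Y₀) (deformedSheet R ε σ) y =
      ∫ y, coeff Y₀ φ σ ((R : ℂ) * (1 + I * (σ * ε))) y := by
  have h1 := Measure.integral_comp_inv_smul (volume : Measure (Fin 3 → ℝ))
    (coeff Y₀ φ σ ((R : ℂ) * (1 + I * (σ * ε)))) R
  have h2 : ∫ y, pullback (m := 2) (fueterForm φ Y₀) (deformedSheet R ε σ) y =
      ∫ y, ((R⁻¹) ^ 3 : ℝ) • coeff Y₀ φ σ ((R : ℂ) * (1 + I * (σ * ε))) (R⁻¹ • y) :=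
    integral_congr_ae (Eventually.of_forall fun y => pullback_deformedSheet hR ε hσ Y₀ φ y)
  rw [h2, integral_smul, h1, smul_smul]
  convert one_smul ℝ _ using 2
  rw [Module.finrank_fin_fun, abs_of_pos (by positivity)]
  field_simp

lemma mul_mem_sector {R : ℝ} (hR : 0 < R) {ε : ℝ} (hε : |ε| < κ) {σ : ℝ} (hσ : σ ^ 2 = 1) :
    (R : ℂ) * (1 + I * (σ * ε)) ∈ sector κ ∧ ((R : ℂ) * (1 + I * (σ * ε))).im = R * (σ * ε) := by
  have h1 : ((R : ℂ) * (1 + I * (σ * ε))).re = R := by simp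
  have h2 : ((R : ℂ) * (1 + I * (σ * ε))).im = R * (σ * ε) := by simp
  refine ⟨⟨hR.trans_eq h1.symm, ?_⟩, h2⟩
  rw [h1, h2, abs_mul, abs_mul, abs_of_pos hR, abs_eq_one_of_sq hσ, one_mul, mul_comm]
  exact mul_lt_mul_of_pos_right hε hR

lemma exists_mul_mem_sector_inter {σ : ℝ} (hσ : σ ^ 2 = 1) {R : ℝ} (hR : 0 < R) {ε : ℝ} (hε : |ε| < κ) (hε0 : ε ≠ 0) :
    ∃ s : ℝ, (R : ℂ) * (1 + I * (σ * ε)) ∈ sector κ ∩ {t | 0 < s * t.im} := by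
  obtain ⟨h1, h2⟩ := mul_mem_sector (κ := κ) hR hε hσ
  refine ⟨σ * ε, h1, ?_⟩
  have hσ0 : σ ≠ 0 := fun h => by simp [h] at hσ
  rw [mem_ofPred_eq, h2]
  have : 0 < (σ * ε) ^ 2 := by positivity
  nlinarith

lemma ConeRegular.integrable_pullback (hφ : ConeRegular φ κ) {ρ : ℝ} (hρ : 0 < ρ) {σ σ' : ℝ}
    (hσ : σ = 1 ∨ σ = -1) (hσ' : σ' ^ 2 = 1) (y' : Fin 3 → ℝ) {R : ℝ} (hR : 0 < R) {ε : ℝ}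
    (hε : |ε| < κ) (hε0 : ε ≠ 0) :
    Integrable (pullback (m := 2) (fueterForm φ ((ρ : ℂ) • hyp σ' y')) (deformedSheet R ε σ)) := by
  have hσ2 : σ ^ 2 = 1 := by rcases hσ with rfl | rfl <;> norm_num
  obtain ⟨s, hs⟩ := exists_mul_mem_sector_inter (κ := κ) hσ2 hR hε hε0
  exact integrable_pullback_deformedSheet hR ε hσ ((hφ.integral_coeff_eq hσ2
    (isOpen_sector_inter s κ) (isPreconnected_sector_inter s κ) inter_subset_left
    (avoids_of_mul_im_pos hρ hσ2 hσ' y' s κ)).1 _ hs)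

lemma ConeRegular.integral_opposite (hφ : ConeRegular φ κ) {ρ : ℝ} (hρ : 0 < ρ) {σ σ' : ℝ}
    (hσ : σ = 1 ∨ σ = -1) (hσ' : σ' ^ 2 = 1) (h : σ * σ' = -1) (y' : Fin 3 → ℝ) {R R' : ℝ}
    (hR : 0 < R) (hR' : 0 < R') {ε ε' : ℝ} (hε : |ε| < κ) (hε' : |ε'| < κ) :
    ∫ y, pullback (m := 2) (fueterForm φ ((ρ : ℂ) • hyp σ' y')) (deformedSheet R ε σ) y =
      ∫ y, pullback (m := 2) (fueterForm φ ((ρ : ℂ) • hyp σ' y')) (deformedSheet R' ε' σ) y := by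
  have hσ2 : σ ^ 2 = 1 := by rcases hσ with rfl | rfl <;> norm_num
  rw [integral_pullback_deformedSheet hR ε hσ, integral_pullback_deformedSheet hR' ε' hσ]
  exact (hφ.integral_coeff_eq hσ2 (isOpen_sector κ) (convex_sector κ).isPreconnected subset_rfl
    (avoids_opposite hρ hσ2 hσ' h y' κ)).2 _ (mul_mem_sector hR hε hσ2).1 _
    (mul_mem_sector hR' hε' hσ2).1

/-- For σ = -1 a positive ε puts t in the lower half plane. This reversal cancels the factor σ in
the jump, which is why Y^ε is defined by cases. -/
lemma ConeRegular.integral_same (hκ : 0 < κ) (hφ : ConeRegular φ κ) {ρ : ℝ} (hρ : 0 < ρ) {σ : ℝ}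
    (hσ : σ = 1 ∨ σ = -1) (y' : Fin 3 → ℝ) {R R' : ℝ} (hR : 0 < R) (hR' : 0 < R') {ε : ℝ}
    (hε0 : 0 < ε) (hε : ε < κ) :
    (∫ y, pullback (m := 2) (fueterForm φ ((ρ : ℂ) • hyp σ y')) (deformedSheet R ε σ) y) -
      ∫ y, pullback (m := 2) (fueterForm φ ((ρ : ℂ) • hyp σ y')) (deformedSheet R' (-ε) σ) y =
      (2 * Real.pi ^ 2) • φ ((ρ : ℂ) • hyp σ y') := by
  have hσ2 : σ ^ 2 = 1 := by rcases hσ with rfl | rfl <;> norm_num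
  rw [integral_pullback_deformedSheet hR ε hσ, integral_pullback_deformedSheet hR' (-ε) hσ]
  obtain ⟨a1, a2⟩ := mul_mem_sector (κ := κ) hR (ε := ε) (by rwa [abs_of_pos hε0]) hσ2
  obtain ⟨b1, b2⟩ := mul_mem_sector (κ := κ) hR' (ε := -ε) (by rwa [abs_neg, abs_of_pos hε0]) hσ2
  have hp := mul_pos hR hε0
  have hp' := mul_pos hR' hε0
  rcases hσ with rfl | rfl
  · rw [hφ.integral_coeff_sub hκ hσ2 hρ y' ⟨a1, by rw [mem_ofPred_eq, a2]; linarith⟩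
      ⟨b1, by rw [mem_ofPred_eq, b2]; linarith⟩, one_mul]
  · rw [← neg_sub, hφ.integral_coeff_sub hκ hσ2 hρ y' ⟨b1, by rw [mem_ofPred_eq, b2]; linarith⟩
      ⟨a1, by rw [mem_ofPred_eq, a2]; linarith⟩, neg_one_mul, neg_smul, neg_neg]

theorem ConeRegular.integral_formula (hκ : 0 < κ) (hφ : ConeRegular φ κ) {ρ : ℝ} (hρ : 0 < ρ)
    {σ : ℝ} (hσ : σ = 1 ∨ σ = -1) (y' : Fin 3 → ℝ) {R R' : ℝ} (hR : 0 < R) (hR' : 0 < R') {ε : ℝ}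
    (hε0 : 0 < ε) (hε : ε < κ) {ω : HC → (Fin 3 → HC) → HC}
    (hω : ω = fueterForm (m := 2) φ ((ρ : ℂ) • hyp σ y')) :
    ((∫ y, pullback (m := 2) ω (deformedSheet R ε 1) y) +
        ∫ y, pullback (m := 2) ω (deformedSheet R ε (-1)) y) -
      ((∫ y, pullback (m := 2) ω (deformedSheet R' (-ε) 1) y) +
        ∫ y, pullback (m := 2) ω (deformedSheet R' (-ε) (-1)) y) =
      (2 * Real.pi ^ 2) • φ ((ρ : ℂ) • hyp σ y') := by
  have hε1 : |ε| < κ := by rwa [abs_of_pos hε0]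
  have hε2 : |-ε| < κ := by rwa [abs_neg]
  subst hω
  rw [← hφ.integral_same hκ hρ hσ y' hR hR' hε0 hε]
  rcases hσ with rfl | rfl
  · rw [hφ.integral_opposite hρ (σ := -1) (σ' := 1) (by simp) (by simp) (by simp) y' hR hR' hε1 hε2]
    abel
  · rw [hφ.integral_opposite hρ (σ := 1) (σ' := -1) (by simp) (by simp) (by simp) y' hR hR' hε1 hε2]
    abel

end

/-! ### Reduction of m columns to HC-valued functions -/

/-- The matrix whose columns all equal the `b`-th column. -/
noncomputable def col {m : ℕ} (b : Fin m) : Val m →L[ℂ] HC :=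
  LinearMap.toContinuousLinearMap
    { toFun := fun M => Matrix.of fun i _ => M i b
      map_add' := fun A B => by ext; simp
      map_smul' := fun c A => by ext; simp }

lemma col_apply {m : ℕ} (b : Fin m) (M : Val m) (i j : Fin 2) : col b M i j = M i b := rfl

lemma col_mul {m : ℕ} (b : Fin m) (A : HC) (M : Val m) : col b (A * M) = A * col b M := by
  ext i j
  simp [col_apply, Matrix.mul_apply]

lemma LeftRegular.col {m : ℕ} {f : Minkowski → Val m} (hf : LeftRegular f) (b : Fin m) :
    LeftRegular (m := 2) fun Y => col b (f Y) := by
  have h1 : ∀ Y, HasFDerivAt (fun Y => MinkowskiFueter.col b (f Y))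
      (((MinkowskiFueter.col b).restrictScalars ℝ).comp (fderiv ℝ f Y)) Y := fun Y =>
    HasFDerivAt.comp (g := MinkowskiFueter.col b) Y
      (((MinkowskiFueter.col b).restrictScalars ℝ).hasFDerivAt) (hf.1 Y).hasFDerivAt
  refine ⟨fun Y => (h1 Y).differentiableAt, fun Y => ?_⟩
  have h2 : ∀ j, pderiv (m := 2) j (fun Y => MinkowskiFueter.col b (f Y)) Y =
      MinkowskiFueter.col b (pderiv j f Y) := fun j =>
    congrArg (fun A : Minkowski →L[ℝ] HC => A ⟨et j, et_mem j⟩) (h1 Y).fderiv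
  have h3 := congrArg (MinkowskiFueter.col b) (hf.2 Y)
  simp only [map_add, map_neg, col_mul, map_zero] at h3
  rw [h2, h2, h2, h2]
  exact h3

lemma IsContinuation.col {m : ℕ} {f : Minkowski → Val m} {fC : HC → Val m}
    (h : IsContinuation f fC) (b : Fin m) :
    IsContinuation (m := 2) (fun Y => col b (f Y)) fun Z => col b (fC Z) := by
  obtain ⟨h1, W, hW, hU, F, hF, h2⟩ := h
  refine ⟨fun Y => congrArg _ (h1 Y), W, hW, hU, fun X => MinkowskiFueter.col b (F X), ?_,
    fun X hX hN => ?_⟩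
  · exact (MinkowskiFueter.col b).differentiable.comp_differentiableOn hF
  · exact (congrArg _ (h2 X hX hN)).trans (col_mul _ _ _)

lemma differentiableAt_of_col {m : ℕ} {fC : HC → Val m} {Z : HC}
    (h : ∀ b, DifferentiableAt ℂ (fun Z => col b (fC Z)) Z) : DifferentiableAt ℂ fC Z := by
  refine differentiableAt_pi.2 fun i => differentiableAt_pi.2 fun b => ?_
  exact DifferentiableAt.comp
    (g := (LinearMap.toContinuousLinearMap (Matrix.entryLinearMap ℂ ℂ i (0 : Fin 2)) : HC →L[ℂ] ℂ)) Z
    (ContinuousLinearMap.differentiableAt _) (h b)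

/-- Left multiplication acts on each column separately, so repeating one column reduces general m to
m = 2; entry (a, 0) recovers the original. -/
lemma pullback_apply {m : ℕ} (fC : HC → Val m) (Y₀ : HC) (ψ : (Fin 3 → ℝ) → HC) (y : Fin 3 → ℝ)
    (a : Fin 2) (b : Fin m) : pullback (fueterForm fC Y₀) ψ y a b =
      pullback (m := 2) (fueterForm (fun Z => col b (fC Z)) Y₀) ψ y a 0 := by
  simp only [pullback, fueterForm, Matrix.mul_apply (M := _ * Dz _)]
  rfl

lemma ConeRegular.mono {φ : HC → HC} {κ κ' : ℝ} (h : ConeRegular φ κ) (hκ : κ' ≤ κ) :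
    ConeRegular φ κ' := by
  have hs : sector κ' ⊆ sector κ := fun t ht =>
    ⟨ht.1, ht.2.trans_le (mul_le_mul_of_nonneg_right hκ ht.1.le)⟩
  obtain ⟨C, hC⟩ := h.bound
  exact ⟨fun t ht => h.diff t (hs ht), fun t ht => h.regular t (hs ht), C, fun t ht => hC t (hs ht)⟩

lemma exists_forall_coneRegular_col {m : ℕ} {f : Minkowski → Val m} {fC : HC → Val m}
    (hf : LeftRegular f) (h : IsContinuation f fC) :
    ∃ κ : ℝ, 0 < κ ∧ ∀ b, ConeRegular (fun Z => col b (fC Z)) κ := by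
  have h1 : ∀ b, ∀ᶠ κ in 𝓝[>] (0 : ℝ), ConeRegular (fun Z => col b (fC Z)) κ := by
    intro b
    obtain ⟨κ, hκ, hc⟩ := exists_coneRegular (hf.col b) (h.col b)
    filter_upwards [nhdsWithin_le_nhds (Iic_mem_nhds hκ)] with κ' hκ'
    exact hc.mono hκ'
  obtain ⟨κ, h2, h3⟩ := ((eventually_all.2 h1).and self_mem_nhdsWithin).exists
  exact ⟨κ, h3, h2⟩

lemma mem_deformedHyperboloid {R : ℝ} (hR : 0 < R) {ε : ℝ} {Z : HC}
    (hZ : Z ∈ deformedHyperboloid R ε) : ∃ σ : ℝ, σ ^ 2 = 1 ∧ ∃ y,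
      Z = ((R : ℂ) * (1 + I * (σ * ε))) • hyp σ y := by
  rw [← range_deformedSheet] at hZ
  rcases hZ with ⟨y, rfl⟩ | ⟨y, rfl⟩
  · exact ⟨1, by simp, R⁻¹ • y, congrFun (deformedSheet_eq hR ε (Or.inl rfl)) y⟩
  · exact ⟨-1, by simp, R⁻¹ • y, congrFun (deformedSheet_eq hR ε (Or.inr rfl)) y⟩

lemma exists_eq_smul_hyp {Y : HC} (hY : Y ∈ Minkowski) (hd : Y.det.re < 0) :
    ∃ ρ : ℝ, 0 < ρ ∧ ∃ σ : ℝ, (σ = 1 ∨ σ = -1) ∧ ∃ y, Y = (ρ : ℂ) • hyp σ y := by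
  have hst : star Y = -Y := hY
  have him : Y.det.im = 0 := by
    have h1 : star Y.det = Y.det := by
      rw [← Matrix.det_conjTranspose, ← Matrix.star_eq_conjTranspose, hst]
      simp [Matrix.det_fin_two]
    exact conj_eq_iff_im.1 h1
  have hρ : 0 < √(-Y.det.re) := Real.sqrt_pos.2 (by linarith)
  have hmem : Y ∈ hyperboloid √(-Y.det.re) := by
    refine ⟨hY, ?_⟩
    rw [← ofReal_pow, Real.sq_sqrt (by linarith)]
    apply Complex.ext <;> simp [him]
  rw [← range_sheet] at hmem
  rcases hmem with ⟨y, hy⟩ | ⟨y, hy⟩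
  · exact ⟨_, hρ, 1, Or.inl rfl, _, hy.symm.trans (sheet_eq_smul_hyp hρ 1 y)⟩
  · exact ⟨_, hρ, -1, Or.inr rfl, _, hy.symm.trans (sheet_eq_smul_hyp hρ (-1) y)⟩

/-- A matrix entry as a continuous real-linear functional. -/
noncomputable def entry (a c : Fin 2) : HC →L[ℝ] ℂ :=
  (LinearMap.toContinuousLinearMap (Matrix.entryLinearMap ℂ ℂ a c)).restrictScalars ℝ

lemma formIntegrable_of_col {m : ℕ} {fC : HC → Val m} {Y₀ : HC} {R ε : ℝ}
    (h : ∀ b, ∀ σ : ℝ, σ = 1 ∨ σ = -1 → Integrable (pullback (m := 2)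
      (fueterForm (fun Z => col b (fC Z)) Y₀) (deformedSheet R ε σ))) :
    FormIntegrable (fueterForm fC Y₀) R ε := by
  intro a b
  have h1 : ∀ σ : ℝ, σ = 1 ∨ σ = -1 →
      Integrable fun y => pullback (fueterForm fC Y₀) (deformedSheet R ε σ) y a b := fun σ hσ =>
    ((entry a 0).integrable_comp (h b σ hσ)).congr
      (Eventually.of_forall fun y => (pullback_apply fC Y₀ _ y a b).symm)
  exact ⟨h1 1 (Or.inl rfl), h1 (-1) (Or.inr rfl)⟩

lemma formIntegral_apply {m : ℕ} {fC : HC → Val m} {Y₀ : HC} {R ε : ℝ} (b : Fin m)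
    (h : ∀ σ : ℝ, σ = 1 ∨ σ = -1 → Integrable (pullback (m := 2)
      (fueterForm (fun Z => col b (fC Z)) Y₀) (deformedSheet R ε σ))) (a : Fin 2) :
    formIntegral (fueterForm fC Y₀) R ε a b = entry a 0
      ((∫ y, pullback (m := 2) (fueterForm (fun Z => col b (fC Z)) Y₀) (deformedSheet R ε 1) y) +
        ∫ y, pullback (m := 2) (fueterForm (fun Z => col b (fC Z)) Y₀) (deformedSheet R ε (-1)) y) := by
  have h1 : ∀ σ : ℝ, σ = 1 ∨ σ = -1 →
      ∫ y, pullback (fueterForm fC Y₀) (deformedSheet R ε σ) y a b = entry a 0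
        (∫ y, pullback (m := 2) (fueterForm (fun Z => col b (fC Z)) Y₀) (deformedSheet R ε σ) y) :=
    fun σ hσ => (integral_congr_ae (Eventually.of_forall fun y =>
      pullback_apply fC Y₀ _ y a b)).trans ((entry a 0).integral_comp_comm (h σ hσ))
  exact (congrArg₂ (· + ·) (h1 1 (Or.inl rfl)) (h1 (-1) (Or.inr rfl))).trans (map_add _ _ _).symm

end MinkowskiFueter

theorem mainTheorem9 (m : ℕ) (f : MinkowskiFueter.Minkowski → MinkowskiFueter.Val m)
    (hf : f ∈ MinkowskiFueter.V m) :
    (∃ fC : MinkowskiFueter.HC → MinkowskiFueter.Val m, MinkowskiFueter.IsContinuation f fC) ∧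
    ∀ fC : MinkowskiFueter.HC → MinkowskiFueter.Val m, MinkowskiFueter.IsContinuation f fC →
      ∃ ε₀ : ℝ, 0 < ε₀ ∧ ∀ ε : ℝ, 0 < ε → ε < ε₀ → ∀ R R' : ℝ, 0 < R → 0 < R' →
        (∀ Z ∈ MinkowskiFueter.deformedHyperboloid R ε ∪
            MinkowskiFueter.deformedHyperboloid R' (-ε), DifferentiableAt ℂ fC Z) ∧
        ∀ Y₀ : MinkowskiFueter.Minkowski, (Y₀ : MinkowskiFueter.HC).det.re < 0 →
          (∀ Z ∈ MinkowskiFueter.deformedHyperboloid R ε ∪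
            MinkowskiFueter.deformedHyperboloid R' (-ε), (Z - Y₀).det ≠ 0) ∧
          MinkowskiFueter.FormIntegrable (MinkowskiFueter.fueterForm fC Y₀) R ε ∧
          MinkowskiFueter.FormIntegrable (MinkowskiFueter.fueterForm fC Y₀) R' (-ε) ∧
          f Y₀ = (1 / (2 * Real.pi ^ 2) : ℝ) •
            (MinkowskiFueter.formIntegral (MinkowskiFueter.fueterForm fC Y₀) R ε -
              MinkowskiFueter.formIntegral (MinkowskiFueter.fueterForm fC Y₀) R' (-ε)) := by
  refine ⟨MinkowskiFueter.exists_isContinuation hf, fun fC hfC => ?_⟩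
  obtain ⟨κ, hκ, hcone⟩ := MinkowskiFueter.exists_forall_coneRegular_col hf.1 hfC
  refine ⟨κ, hκ, fun ε hε0 hε R R' hR hR' => ?_⟩
  have hε1 : |ε| < κ := by rwa [abs_of_pos hε0]
  have hε2 : |-ε| < κ := by rwa [abs_neg]
  have hmem : ∀ Z ∈ MinkowskiFueter.deformedHyperboloid R ε ∪ MinkowskiFueter.deformedHyperboloid R' (-ε),
      ∃ σ : ℝ, σ ^ 2 = 1 ∧ ∃ s, ∃ t ∈ MinkowskiFueter.sector κ ∩ {t | 0 < s * t.im}, ∃ y, Z = t • MinkowskiFueter.hyp σ y := by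
    rintro Z (hZ | hZ)
    · obtain ⟨σ, hσ, y, rfl⟩ := MinkowskiFueter.mem_deformedHyperboloid hR hZ
      obtain ⟨s, hs⟩ := MinkowskiFueter.exists_mul_mem_sector_inter hσ hR hε1 hε0.ne'
      exact ⟨σ, hσ, s, _, hs, y, rfl⟩
    · obtain ⟨σ, hσ, y, rfl⟩ := MinkowskiFueter.mem_deformedHyperboloid hR' hZ
      obtain ⟨s, hs⟩ := MinkowskiFueter.exists_mul_mem_sector_inter hσ hR' hε2 (neg_ne_zero.2 hε0.ne')
      exact ⟨σ, hσ, s, _, hs, y, rfl⟩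
  refine ⟨fun Z hZ => ?_, fun Y₀ hY₀ => ?_⟩
  · obtain ⟨σ, hσ, s, t, ht, y, rfl⟩ := hmem Z hZ
    exact MinkowskiFueter.differentiableAt_of_col fun b => (hcone b).diff t ht.1 σ hσ y
  obtain ⟨ρ, hρ, σ', hσ', y', hY⟩ := MinkowskiFueter.exists_eq_smul_hyp Y₀.2 hY₀
  have hσ2 : σ' ^ 2 = 1 := by rcases hσ' with rfl | rfl <;> norm_num
  have hfY : fC Y₀ = f Y₀ := hfC.1 Y₀
  rw [← hfY, hY]
  have hI : ∀ b, ∀ σ : ℝ, σ = 1 ∨ σ = -1 → MeasureTheory.Integrable (MinkowskiFueter.pullback (m := 2)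
      (MinkowskiFueter.fueterForm (fun Z => MinkowskiFueter.col b (fC Z)) ((ρ : ℂ) • MinkowskiFueter.hyp σ' y')) (MinkowskiFueter.deformedSheet R ε σ)) :=
    fun b σ hσ => (hcone b).integrable_pullback hρ hσ hσ2 y' hR hε1 hε0.ne'
  have hI' : ∀ b, ∀ σ : ℝ, σ = 1 ∨ σ = -1 → MeasureTheory.Integrable (MinkowskiFueter.pullback (m := 2)
      (MinkowskiFueter.fueterForm (fun Z => MinkowskiFueter.col b (fC Z)) ((ρ : ℂ) • MinkowskiFueter.hyp σ' y')) (MinkowskiFueter.deformedSheet R' (-ε) σ)) :=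
    fun b σ hσ => (hcone b).integrable_pullback hρ hσ hσ2 y' hR' hε2 (neg_ne_zero.2 hε0.ne')
  refine ⟨fun Z hZ => ?_, MinkowskiFueter.formIntegrable_of_col hI, MinkowskiFueter.formIntegrable_of_col hI', ?_⟩
  · obtain ⟨σ, hσ, s, t, ht, y, rfl⟩ := hmem Z hZ
    exact (MinkowskiFueter.avoids_of_mul_im_pos hρ hσ hσ2 y' s κ).det_ne_zero ht y
  · ext a b
    have h := congrArg (MinkowskiFueter.entry a 0)
      ((hcone b).integral_formula hκ hρ hσ' y' hR hR' hε0 hε rfl)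
    rw [map_sub, ← MinkowskiFueter.formIntegral_apply b (hI b), ← MinkowskiFueter.formIntegral_apply b (hI' b), map_smul] at h
    rw [Matrix.smul_apply, Matrix.sub_apply, h, smul_smul, one_div,
      inv_mul_cancel₀ (by positivity), one_smul]
    rfl
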